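/- Let $(M^m,g)$ be a smooth Riemannian manifold, let $(N^{2n},J,h)$ be an almost Hermitian manifold, and let $\varphi:M\to N$ be a smooth map which is an almost submersion (the set of regular points, where $d\varphi_x$ is surjective, is dense) and pseudo horizontally weakly conformal, i.e. $[d\varphi\circ d\varphi^{t},J]=0$. At a regular point put $\mathcal V=\ker d\varphi$ and $\mathcal H=\mathcal V^{\perp}$. Let $F$ be the induced $f$-structure: $F=0$ on $\mathcal V$, $F(\mathcal H)\subseteq\mathcal H$ and $d\varphi\circ F=J\circ d\varphi$. Put $\Omega(X,Y)=h(X,JY)$ and $\Phi(X,Y)=g(X,FY)$. Let $\mu^{\mathcal V}=\frac1{m-2n}\sum_\alpha(\nabla_{E_\alpha}E_\alpha)^{\mathcal H}$ be the mean curvature of $\mathcal V$, where $(E_\alpha)$ is an orthonormal frame of $\mathcal V$ (and $\mu^{\mathcal V}=0$ if $m=2n$). Put $\mathrm{div}^{\mathcal H}F=\sum_a(\nabla_{e_a}F)e_a$, where $(e_a)$ is an orthonormal frame of $\mathcal H$. The exterior derivative is normalized by $3\,d\alpha(X,Y,Z)=X\alpha(Y,Z)+Y\alpha(Z,X)+Z\alpha(X,Y)-\alpha([X,Y],Z)-\alpha([Y,Z],X)-\alpha([Z,X],Y)$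 for $2$-forms $\alpha$. An adapted frame at a regular point is an orthonormal basis $\{E_i,FE_i\}_{i=1,\dots,n}$ of $\mathcal H$ such that $E_i$ and $FE_i$ are eigenvectors of $\varphi^*h$ (with respect to $g$) for the eigenvalue $\lambda_i^2$. Then there is an adapted frame at every regular point. Moreover, let $D$ be any dense subset of $M$ that consists of regular points (for instance the set of all of them), and let an adapted frame be given at each point of $D$. The following are equivalent: (a) $\varphi$ is harmonic, i.e. its tension field $\mathrm{trace}\,\nabla d\varphi$ vanishes on $M$; (b) at every point of $D$ and for all $k=1,\dots,n$, $$3\sum_{i=1}^{n}(d\varphi^*\Omega)(E_i,FE_i,E_k)-\lambda_k^2\,g\big(F\,\mathrm{div}^{\mathcal H}F+(m-2n)\mu^{\mathcal V},E_k\big)=0,$$ $$3\sum_{i=1}^{n}(d\varphi^*\Omega)(E_i,FE_i,FE_k)-\lambda_k^2\,g\big(F\,\mathrm{div}^{\mathcal H}F+(m-2n)\mu^{\mathcal V},FE_k\big)=0;$$ (c) at every point of $D$ and for all $k=1,\dots,n$, $$3\sum_{i=1}^{n}\big[(d\varphi^*\Omega)(E_i,FE_i,E_k)-\lambda_k^2\,d\Phi(E_i,FE_i,E_k)\big]-\lambda_k^2(m-2n)\,g(\mu^{\mathcal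 V},E_k)=0,$$ $$3\sum_{i=1}^{n}\big[(d\varphi^*\Omega)(E_i,FE_i,FE_k)-\lambda_k^2\,d\Phi(E_i,FE_i,FE_k)\big]-\lambda_k^2(m-2n)\,g(\mu^{\mathcal V},FE_k)=0.$$ -/

import Mathlib

open Bundle FiberBundle
open scoped Manifold ContDiff

noncomputable section

namespace PHWC

/-! ## Riemannian geometry on a manifold whose tangent spaces carry a smooth inner product -/

section Riemannian

variable {E : Type*} [NormedAddCommGroup E] [NormedSpace ℝ E] [FiniteDimensional ℝ E]
  {H : Type*} [TopologicalSpace H] (I : ModelWithCorners ℝ E H)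
  {M : Type*} [TopologicalSpace M] [ChartedSpace H M] [IsManifold I ∞ M]

instance instFiniteDimensionalTangent (x : M) : FiniteDimensional ℝ (TangentSpace I x) :=
  inferInstanceAs (FiniteDimensional ℝ E)

/-- The exterior derivative of a `2`-form `α` on `M`, evaluated on `u, v, w ∈ T_x M`, by the
invariant formula
`3 dα(X,Y,Z) = X α(Y,Z) + Y α(Z,X) + Z α(X,Y) - α([X,Y],Z) - α([Y,Z],X) - α([Z,X],Y)`
for vector fields `X, Y, Z` that extend `u, v, w` (the normalization of the exterior derivative
of a `2`-form that carries the factor `1/3`). -/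
def extDerivTwo (α : ∀ q : M, TangentSpace I q → TangentSpace I q → ℝ) (x : M)
    (u v w : TangentSpace I x) : ℝ :=
  let X : ∀ q : M, TangentSpace I q := extend E u
  let Y : ∀ q : M, TangentSpace I q := extend E v
  let Z : ∀ q : M, TangentSpace I q := extend E w
  (1 / 3 : ℝ) *
    (mvfderiv I (fun q => α q (Y q) (Z q)) x u
      + mvfderiv I (fun q => α q (Z q) (X q)) x v
      + mvfderiv I (fun q => α q (X q) (Y q)) x w
      - α x (VectorField.mlieBracket I X Y x) w
      - α x (VectorField.mlieBracket I Y Z x) u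
      - α x (VectorField.mlieBracket I Z X x) v)

variable [RiemannianBundle (fun x : M => TangentSpace I x)]

/-- The right-hand side of the Koszul formula for `⟨∇_u Y, w⟩` at `x`. The value does not depend
on the vector fields `X, Z` that extend `u, w`. -/
def koszul (Y : ∀ q : M, TangentSpace I q) (x : M) (u w : TangentSpace I x) : ℝ :=
  let X : ∀ q : M, TangentSpace I q := extend E u
  let Z : ∀ q : M, TangentSpace I q := extend E w
  (1 / 2 : ℝ) *
    (mvfderiv I (fun q => inner ℝ (Y q) (Z q)) x u
      + mvfderiv I (fun q => inner ℝ (X q) (Z q)) x (Y x)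
      - mvfderiv I (fun q => inner ℝ (X q) (Y q)) x w
      + inner ℝ (VectorField.mlieBracket I X Y x) w
      - inner ℝ (VectorField.mlieBracket I X Z x) (Y x)
      - inner ℝ (VectorField.mlieBracket I Y Z x) u)

/-- The Levi-Civita connection: `leviCivita I Y x u = (∇_u Y)(x)`, the vector whose inner product
with every `w` is given by the Koszul formula. -/
def leviCivita (Y : ∀ q : M, TangentSpace I q) (x : M) (u : TangentSpace I x) :
    TangentSpace I x :=
  ∑ a, koszul I Y x u (stdOrthonormalBasis ℝ (TangentSpace I x) a) •
    stdOrthonormalBasis ℝ (TangentSpace I x) a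

/-- The covariant derivative of a field of endomorphisms:
`(∇_u A) v = ∇_u (A Y) - A (∇_u Y)` for a vector field `Y` that extends `v`. -/
def covDerivEnd (A : ∀ q : M, TangentSpace I q →ₗ[ℝ] TangentSpace I q) (x : M)
    (u v : TangentSpace I x) : TangentSpace I x :=
  leviCivita I (fun q => A q (extend E v q)) x u - A x (leviCivita I (extend E v) x u)

end Riemannian

/-- An almost Hermitian structure on a Riemannian manifold: a smooth field `J` of orthogonal
endomorphisms of the tangent spaces with `J² = -1`. -/
structure AlmostHermitian {E : Type*} [NormedAddCommGroup E] [NormedSpace ℝ E]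
    {H : Type*} [TopologicalSpace H] (I : ModelWithCorners ℝ E H)
    (N : Type*) [TopologicalSpace N] [ChartedSpace H N] [IsManifold I ∞ N]
    [RiemannianBundle (fun x : N => TangentSpace I x)] where
  J : ∀ y : N, TangentSpace I y →L[ℝ] TangentSpace I y
  smooth : ContMDiff I (I.prod 𝓘(ℝ, E →L[ℝ] E)) ∞
    (fun y : N => TotalSpace.mk' (E →L[ℝ] E)
      (E := fun y : N => TangentSpace I y →L[ℝ] TangentSpace I y) y (J y))
  sq : ∀ (y : N) (v : TangentSpace I y), J y (J y v) = -v
  isometry : ∀ (y : N) (v w : TangentSpace I y), inner ℝ (J y v) (J y w) = inner ℝ v w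

/-! ## Maps between Riemannian manifolds -/

section Maps

variable {E : Type*} [NormedAddCommGroup E] [NormedSpace ℝ E] [FiniteDimensional ℝ E]
  {H : Type*} [TopologicalSpace H] (I : ModelWithCorners ℝ E H)
  {M : Type*} [TopologicalSpace M] [ChartedSpace H M] [IsManifold I ∞ M]
  {E' : Type*} [NormedAddCommGroup E'] [NormedSpace ℝ E'] [FiniteDimensional ℝ E']
  {H' : Type*} [TopologicalSpace H'] (I' : ModelWithCorners ℝ E' H')
  {N : Type*} [TopologicalSpace N] [ChartedSpace H' N] [IsManifold I' ∞ N]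

/-- The differential of `φ` at `x`, as a linear map. -/
def tangentMap (φ : M → N) (x : M) : TangentSpace I x →ₗ[ℝ] TangentSpace I' (φ x) :=
  (mfderiv I I' φ x).toLinearMap

/-- The set of regular points of `φ`. -/
def regularSet (φ : M → N) : Set M := {x | Function.Surjective (tangentMap I I' φ x)}

/-- An almost submersion: a smooth map which is submersive on a dense set. -/
def IsAlmostSubmersion (φ : M → N) : Prop :=
  ContMDiff I I' ∞ φ ∧ Dense (regularSet I I' φ)

/-- The vertical space `V_x = ker dφ_x`. -/
def vertical (φ : M → N) (x : M) : Submodule ℝ (TangentSpace I x) :=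
  LinearMap.ker (tangentMap I I' φ x)

variable [RiemannianBundle (fun x : N => TangentSpace I' x)]

/-- The pull-back of the Levi-Civita connection of `N` to `φ⁻¹ TN`, applied to a section `W` of
`φ⁻¹ TN` along `u ∈ T_x M`: in the local frame `(∂_α)` of `TN` around `φ x` given by the chart at
`φ x`, one has `W = ∑ W^α (∂_α ∘ φ)` and
`∇^φ_u W = ∑ u(W^α) ∂_α + ∑ W^α ∇^N_{dφ(u)} ∂_α`. -/
def pullbackConnection (φ : M → N) (W : ∀ q : M, TangentSpace I' (φ q)) (x : M)
    (u : TangentSpace I x) : TangentSpace I' (φ x) :=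
  let e := trivializationAt E' (TangentSpace I' : N → Type _) (φ x)
  e.symmL ℝ (φ x) (mvfderiv I (fun q => e.continuousLinearMapAt ℝ (φ q) (W q)) x u)
    + leviCivita I' (extend E' (W x)) (φ x) (tangentMap I I' φ x u)

variable [RiemannianBundle (fun x : M => TangentSpace I x)]

/-- The horizontal space `H_x = (ker dφ_x)^⊥`. -/
def horizontal (φ : M → N) (x : M) : Submodule ℝ (TangentSpace I x) :=
  (vertical I I' φ x)ᗮ

/-- The second fundamental form of a map,
`∇dφ(u, v) = ∇^φ_u (dφ Y) - dφ (∇_u Y)` for a vector field `Y` that extends `v`. -/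
def secondFundamentalForm (φ : M → N) (x : M) (u v : TangentSpace I x) :
    TangentSpace I' (φ x) :=
  pullbackConnection I I' φ (fun q => tangentMap I I' φ q (extend E v q)) x u
    - tangentMap I I' φ x (leviCivita I (extend E v) x u)

/-- The tension field `τ(φ) = trace ∇dφ`. -/
def tensionField (φ : M → N) (x : M) : TangentSpace I' (φ x) :=
  ∑ a, secondFundamentalForm I I' φ x (stdOrthonormalBasis ℝ (TangentSpace I x) a)
    (stdOrthonormalBasis ℝ (TangentSpace I x) a)

/-- A map is harmonic if its tension field vanishes identically. -/
def IsHarmonic (φ : M → N) : Prop := ∀ x : M, tensionField I I' φ x = 0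

/-- The mean curvature vector of the vertical distribution,
`μ^V = (1 / dim V) ∑ (∇_{E_α} E_α)^H` over an orthonormal basis `(E_α)` of `V`. The vertical
vector `v` is extended to a vertical vector field by projecting an arbitrary extension to `V`. -/
def meanCurvatureVertical (φ : M → N) (x : M) : TangentSpace I x :=
  ((Module.finrank ℝ (vertical I I' φ x) : ℝ)⁻¹) •
    ∑ a, (horizontal I I' φ x).starProjection
      (leviCivita I (fun q => (vertical I I' φ q).starProjection
          (extend E (stdOrthonormalBasis ℝ (vertical I I' φ x) a : TangentSpace I x) q)) x
        (stdOrthonormalBasis ℝ (vertical I I' φ x) a : TangentSpace I x))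

/-- The divergence along the horizontal distribution of a field of endomorphisms,
`div^H A = ∑ (∇_{e_a} A) e_a` over an orthonormal basis `(e_a)` of `H`. -/
def divHorizontal (φ : M → N) (A : ∀ q : M, TangentSpace I q →ₗ[ℝ] TangentSpace I q) (x : M) :
    TangentSpace I x :=
  ∑ a, covDerivEnd I A x (stdOrthonormalBasis ℝ (horizontal I I' φ x) a : TangentSpace I x)
    (stdOrthonormalBasis ℝ (horizontal I I' φ x) a : TangentSpace I x)

/-- The adjoint `dφ_x^t : T_{φ x} N → T_x M`. -/
def tangentAdjoint (φ : M → N) (x : M) : TangentSpace I' (φ x) →ₗ[ℝ] TangentSpace I x :=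
  LinearMap.adjoint (tangentMap I I' φ x)

variable {I'}

/-- `φ` is pseudo horizontally weakly conformal: `[dφ ∘ dφ^t, J] = 0`. -/
def IsPHWC (𝒥 : AlmostHermitian I' N) (φ : M → N) : Prop :=
  ∀ (x : M) (w : TangentSpace I' (φ x)),
    tangentMap I I' φ x (tangentAdjoint I I' φ x (𝒥.J (φ x) w))
      = 𝒥.J (φ x) (tangentMap I I' φ x (tangentAdjoint I I' φ x w))

/-- The `f`-structure `F` on `M` induced by `φ`, at regular points: it is the pull-back of `J` to
`H` by the isomorphism `dφ : H → TN` and vanishes on `V`. As `dφ^t ∘ (dφ ∘ dφ^t)⁻¹` is the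
inverse `TN → H` of that isomorphism, `F = dφ^t ∘ (dφ ∘ dφ^t)⁻¹ ∘ J ∘ dφ`. -/
def fStructure (𝒥 : AlmostHermitian I' N) (φ : M → N) (x : M) :
    TangentSpace I x →ₗ[ℝ] TangentSpace I x :=
  tangentAdjoint I I' φ x ∘ₗ
    Ring.inverse (tangentMap I I' φ x ∘ₗ tangentAdjoint I I' φ x) ∘ₗ
      (𝒥.J (φ x)).toLinearMap ∘ₗ tangentMap I I' φ x

/-- At regular points `φ` is `(F, J)`-holomorphic: `dφ ∘ F = J ∘ dφ`. -/
theorem tangentMap_fStructure (𝒥 : AlmostHermitian I' N) {φ : M → N} {x : M}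
    (hx : x ∈ regularSet I I' φ) (v : TangentSpace I x) :
    tangentMap I I' φ x (fStructure I 𝒥 φ x v) = 𝒥.J (φ x) (tangentMap I I' φ x v) := by
  have hinj : Function.Injective (tangentMap I I' φ x ∘ₗ tangentAdjoint I I' φ x) := by
    rw [injective_iff_map_eq_zero]
    intro w hw
    have h0 : tangentAdjoint I I' φ x w = 0 := by
      rw [← inner_self_eq_zero (𝕜 := ℝ)]
      nth_rewrite 1 [tangentAdjoint]
      rw [LinearMap.adjoint_inner_left]
      rw [LinearMap.comp_apply] at hw
      rw [hw, inner_zero_right]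
    obtain ⟨u, rfl⟩ := hx w
    rw [← inner_self_eq_zero (𝕜 := ℝ)]
    rw [← LinearMap.adjoint_inner_right]
    change inner ℝ u (tangentAdjoint I I' φ x _) = 0
    rw [h0, inner_zero_right]
  have hu : IsUnit (tangentMap I I' φ x ∘ₗ tangentAdjoint I I' φ x) :=
    (LinearMap.isUnit_iff_ker_eq_bot _).2 (LinearMap.ker_eq_bot.2 hinj)
  have h := LinearMap.congr_fun (Ring.mul_inverse_cancel _ hu) (𝒥.J (φ x) (tangentMap I I' φ x v))
  exact h

/-- At regular points `F` is an `f`-structure: `F³ + F = 0`. -/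
theorem fStructure_cube (𝒥 : AlmostHermitian I' N) {φ : M → N} {x : M}
    (hx : x ∈ regularSet I I' φ) (v : TangentSpace I x) :
    fStructure I 𝒥 φ x (fStructure I 𝒥 φ x (fStructure I 𝒥 φ x v)) + fStructure I 𝒥 φ x v = 0 := by
  have key : ∀ a c : TangentSpace I x, tangentMap I I' φ x a = -tangentMap I I' φ x c →
      fStructure I 𝒥 φ x a = -fStructure I 𝒥 φ x c := by
    intro a c hac
    simp [fStructure, hac]
  rw [key _ v, neg_add_cancel]
  rw [tangentMap_fStructure I 𝒥 hx, tangentMap_fStructure I 𝒥 hx, 𝒥.sq]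

/-- The pull-back `φ^*Ω` of the fundamental `2`-form `Ω(X, Y) = h(X, JY)`. -/
def pullbackOmega (𝒥 : AlmostHermitian I' N) (φ : M → N) (x : M) (u v : TangentSpace I x) : ℝ :=
  inner ℝ (tangentMap I I' φ x u) (𝒥.J (φ x) (tangentMap I I' φ x v))

/-- The `2`-form `Φ(X, Y) = g(X, FY)`. -/
def phiForm (𝒥 : AlmostHermitian I' N) (φ : M → N) (x : M) (u v : TangentSpace I x) : ℝ :=
  inner ℝ u (fStructure I 𝒥 φ x v)

/-- An adapted frame at `x`: horizontal vectors `E_1, …, E_n` such that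
`E_1, …, E_n, FE_1, …, FE_n` is orthonormal and `E_i`, `FE_i` are eigenvectors of `φ^*h` for the
eigenvalue `λ_i²`. -/
structure AdaptedFrame (n : ℕ) (𝒥 : AlmostHermitian I' N) (φ : M → N) (x : M) where
  vec : Fin n → TangentSpace I x
  lam : Fin n → ℝ
  vec_mem : ∀ i, vec i ∈ horizontal I I' φ x
  orthonormal : Orthonormal ℝ (Sum.elim vec (fun i => fStructure I 𝒥 φ x (vec i)))
  eigen : ∀ i (w : TangentSpace I x),
    inner ℝ (tangentMap I I' φ x (vec i)) (tangentMap I I' φ x w)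
      = lam i ^ 2 * inner ℝ (vec i) w
  eigen_F : ∀ i (w : TangentSpace I x),
    inner ℝ (tangentMap I I' φ x (fStructure I 𝒥 φ x (vec i))) (tangentMap I I' φ x w)
      = lam i ^ 2 * inner ℝ (fStructure I 𝒥 φ x (vec i)) w

/-- The left-hand side of the first form of the harmonicity equations, in the direction `w`:
`3 ∑ d(φ^*Ω)(E_i, FE_i, w) - λ² g(F div^H F + (dim V) μ^V, w)`. -/
def equationDivF {n : ℕ} (m : ℕ) (𝒥 : AlmostHermitian I' N) (φ : M → N) {x : M}
    (b : AdaptedFrame I n 𝒥 φ x) (lam : ℝ) (w : TangentSpace I x) : ℝ :=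
  3 * ∑ i, extDerivTwo I (pullbackOmega I 𝒥 φ) x (b.vec i) (fStructure I 𝒥 φ x (b.vec i)) w
    - lam ^ 2 * inner ℝ
        (fStructure I 𝒥 φ x (divHorizontal I I' φ (fStructure I 𝒥 φ) x)
          + ((m : ℝ) - 2 * n) • meanCurvatureVertical I I' φ x) w

/-- The left-hand side of the second form of the harmonicity equations, in the direction `w`:
`3 ∑ [d(φ^*Ω)(E_i, FE_i, w) - λ² dΦ(E_i, FE_i, w)] - λ² (dim V) g(μ^V, w)`. -/
def equationDPhi {n : ℕ} (m : ℕ) (𝒥 : AlmostHermitian I' N) (φ : M → N) {x : M}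
    (b : AdaptedFrame I n 𝒥 φ x) (lam : ℝ) (w : TangentSpace I x) : ℝ :=
  3 * ∑ i, (extDerivTwo I (pullbackOmega I 𝒥 φ) x (b.vec i) (fStructure I 𝒥 φ x (b.vec i)) w
      - lam ^ 2 * extDerivTwo I (phiForm I 𝒥 φ) x (b.vec i) (fStructure I 𝒥 φ x (b.vec i)) w)
    - lam ^ 2 * ((m : ℝ) - 2 * n) * inner ℝ (meanCurvatureVertical I I' φ x) w

end Maps

end PHWC

end

/-!
Write `A = dφ`, `B = ∇dφ`, and let `F` be the induced `f`-structure. Everything rests on one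
pointwise identity (`equationDivF_eq_inner_tensionField`, `equationDPhi_eq_inner_tensionField`):
if `w` is a vector at a regular point with `h(Aw, A ·) = λ² g(w, ·)`, then the left-hand side of
either system of equations, in the direction `w`, is `h(Aw, τ(φ))`, where for the system with `dΦ`
the vector `w` has to be horizontal. The images under `A` of the vectors `E_k, FE_k` of an adapted
frame span the tangent space of `N`, so each system says at a regular point that the tension field
vanishes there; and the tension field is continuous, so it vanishes everywhere if it vanishes on a
dense set (`isHarmonic_of_dense`).

The identity has two parts. Near a regular point `φ^*Ω = h(A ·, A F ·)`, and the Levi-Civita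
connection has no torsion, so `3 d(φ^*Ω)` and `3 dΦ` are cyclic sums of covariant derivatives
(`three_mul_extDerivTwo`). On `(e, Fe, w)`, with `e` an eigenvector of `φ^*h`, the symmetry of `B`
and the derivative of `F³ + F = 0` reduce `3 d(φ^*Ω)` to `h(Aw, B(e, e) + B(Fe, Fe) + A F ((∇_e F)
e + (∇_{Fe} F) Fe))`, and `3 dΦ` to the terms in `∇F`
(`three_mul_extDerivTwo_pullbackOmega_eigen`, `three_mul_extDerivTwo_phiForm_eigen`). Summed over
the frame this is the horizontal part of the trace of `B` and `A F div^H F`. The vertical part of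
the trace of `B` is `-(m - 2n) A μ^V`, because a vertical field `Y` satisfies `A Y = 0` near a
regular point and hence `B(Y, Y) = -A (∇_Y Y)` (`tangentMap_meanCurvatureVertical`).

That `F` is differentiable at regular points follows from a form of the Riesz representation
theorem with a parameter (`mdifferentiableAt_of_inner_extend`) and the smoothness of inversion.
The continuity of the tension field follows by expanding it in a chart, where its coefficients are
the inverse of the metric and Koszul expressions of smooth fields. An adapted frame exists because
`dφᵗ ∘ dφ` is symmetric and commutes with `F` (`exists_unitary_eigenframe`).
-/

noncomputable section

set_option linter.unusedSectionVars false

namespace PHWC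

open VectorField Set Filter
open scoped Topology

/-! ### The Koszul formula for vector fields -/

section LeviCivita

variable {E : Type*} [NormedAddCommGroup E] [NormedSpace ℝ E] [FiniteDimensional ℝ E]
  {H : Type*} [TopologicalSpace H] {I : ModelWithCorners ℝ E H}
  {M : Type*} [TopologicalSpace M] [ChartedSpace H M] [IsManifold I ∞ M]

theorem mvfderiv_congr {F : Type*} [NormedAddCommGroup F] [NormedSpace ℝ F] {f g : M → F} {x : M}
    (h : f =ᶠ[𝓝 x] g) : mvfderiv I f x = mvfderiv I g x := by
  ext u
  simp only [mvfderiv, h.mfderiv_eq]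
  rfl

variable [RiemannianBundle (fun x : M => TangentSpace I x)]

variable (I) in
/-- The right-hand side of the Koszul formula for `⟨∇_X Y, Z⟩`, for vector fields `X`, `Y`, `Z`. -/
def koszulForm (X Y Z : ∀ q : M, TangentSpace I q) (x : M) : ℝ :=
  (1 / 2 : ℝ) *
    (mvfderiv I (fun q => inner ℝ (Y q) (Z q)) x (X x)
      + mvfderiv I (fun q => inner ℝ (X q) (Z q)) x (Y x)
      - mvfderiv I (fun q => inner ℝ (X q) (Y q)) x (Z x)
      + inner ℝ (mlieBracket I X Y x) (Z x)
      - inner ℝ (mlieBracket I X Z x) (Y x)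
      - inner ℝ (mlieBracket I Y Z x) (X x))

theorem koszul_eq_koszulForm (Y : ∀ q : M, TangentSpace I q) (x : M) (u w : TangentSpace I x) :
    koszul I Y x u w = koszulForm I (extend E u) Y (extend E w) x := by
  simp [koszul, koszulForm]

variable [IsContMDiffRiemannianBundle I ∞ E (fun x : M => TangentSpace I x)]

/-- The inner product of two differentiable vector fields along a map is differentiable. -/
theorem mdifferentiableAt_inner
    {EP : Type*} [NormedAddCommGroup EP] [NormedSpace ℝ EP] {HP : Type*} [TopologicalSpace HP]
    {IP : ModelWithCorners ℝ EP HP} {P : Type*} [TopologicalSpace P] [ChartedSpace HP P]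
    {f : P → M} {V W : ∀ p : P, TangentSpace I (f p)} {p : P}
    (hV : MDifferentiableAt IP I.tangent (fun p => (⟨f p, V p⟩ : TangentBundle I M)) p)
    (hW : MDifferentiableAt IP I.tangent (fun p => (⟨f p, W p⟩ : TangentBundle I M)) p) :
    MDifferentiableAt IP 𝓘(ℝ, ℝ) (fun p => inner ℝ (V p) (W p)) p :=
  MDifferentiableAt.inner_bundle (IB := I) (F := E) (E := fun x : M => TangentSpace I x)
    (b := f) (v := V) (w := W) hV hW

/-- The Koszul expression is linear over the functions in `X`, so that its value at `x` depends only
on `X x`. -/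
theorem tensorialAt_koszulForm_left {x : M} {Y Z : ∀ q : M, TangentSpace I q}
    (hY : MDiffAt (T% Y) x) (hZ : MDiffAt (T% Z) x) :
    TensorialAt I E (fun X : ∀ q : M, TangentSpace I q => koszulForm I X Y Z x) x where
  smul {f X} hf hX := by
    simp [koszulForm, inner_smul_left, mvfderiv_fun_mul hf (mdifferentiableAt_inner hX hZ),
      mvfderiv_fun_mul hf (mdifferentiableAt_inner hX hY),
      mlieBracket_smul_left hf hX, inner_add_left, inner_smul_right]
    ring
  add {X X'} hX hX' := by
    simp [koszulForm, inner_add_left,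
      mvfderiv_fun_add (mdifferentiableAt_inner hX hZ) (mdifferentiableAt_inner hX' hZ),
      mvfderiv_fun_add (mdifferentiableAt_inner hX hY) (mdifferentiableAt_inner hX' hY),
      mlieBracket_add_left hX hX', inner_add_right]
    ring

theorem tensorialAt_koszulForm_right {x : M} {X Y : ∀ q : M, TangentSpace I q}
    (hX : MDiffAt (T% X) x) (hY : MDiffAt (T% Y) x) :
    TensorialAt I E (fun Z : ∀ q : M, TangentSpace I q => koszulForm I X Y Z x) x where
  smul {f Z} hf hZ := by
    simp [koszulForm, inner_smul_right, mvfderiv_fun_mul hf (mdifferentiableAt_inner hX hZ),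
      mvfderiv_fun_mul hf (mdifferentiableAt_inner hY hZ),
      mlieBracket_smul_right hf hZ, inner_add_left, inner_smul_left]
    rw [real_inner_comm (X x) (Z x), real_inner_comm (Y x) (Z x)]
    ring
  add {Z Z'} hZ hZ' := by
    simp [koszulForm, inner_add_left,
      mvfderiv_fun_add (mdifferentiableAt_inner hX hZ) (mdifferentiableAt_inner hX hZ'),
      mvfderiv_fun_add (mdifferentiableAt_inner hY hZ) (mdifferentiableAt_inner hY hZ'),
      mlieBracket_add_right hZ hZ', inner_add_right]
    ring

end LeviCivita

/-! ### The Levi-Civita connection -/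

section LeviCivitaProperties

variable {E : Type*} [NormedAddCommGroup E] [NormedSpace ℝ E] [FiniteDimensional ℝ E]
  {H : Type*} [TopologicalSpace H] {I : ModelWithCorners ℝ E H}
  {M : Type*} [TopologicalSpace M] [ChartedSpace H M] [IsManifold I ∞ M]
  [RiemannianBundle (fun x : M => TangentSpace I x)]
  [IsContMDiffRiemannianBundle I ∞ E (fun x : M => TangentSpace I x)]

/-- The Koszul formula, for arbitrary vector fields that are differentiable at the point. -/
theorem inner_leviCivita {x : M} {X Y Z : ∀ q : M, TangentSpace I q}
    (hX : MDiffAt (T% X) x) (hY : MDiffAt (T% Y) x) (hZ : MDiffAt (T% Z) x) :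
    inner ℝ (leviCivita I Y x (X x)) (Z x) = koszulForm I X Y Z x := by
  set L := TensorialAt.mkHom _ x
    (tensorialAt_koszulForm_right (mdifferentiableAt_extend I E (X x)) hY) with hL
  have h1 : ∀ w : TangentSpace I x, koszul I Y x (X x) w = L w := fun w => by
    rw [koszul_eq_koszulForm, hL, TensorialAt.mkHom_apply_eq_extend]
  have h2 : inner ℝ (leviCivita I Y x (X x)) (Z x) = L (Z x) := by
    conv_rhs => rw [← (stdOrthonormalBasis ℝ (TangentSpace I x)).sum_repr' (Z x)]
    simp only [leviCivita, sum_inner, map_sum, map_smul, smul_eq_mul, h1, inner_smul_left]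
    exact Finset.sum_congr rfl fun a _ => by simp [mul_comm]
  rw [h2, hL, TensorialAt.mkHom_apply _ hZ]
  exact (tensorialAt_koszulForm_left hY hZ).pointwise (mdifferentiableAt_extend I E (X x)) hX
    (by simp)

theorem inner_leviCivita_extend {x : M} {Y : ∀ q : M, TangentSpace I q}
    (hY : MDiffAt (T% Y) x) (u w : TangentSpace I x) :
    inner ℝ (leviCivita I Y x u) w = koszulForm I (extend E u) Y (extend E w) x := by
  simpa using inner_leviCivita (mdifferentiableAt_extend I E u) hY (mdifferentiableAt_extend I E w)

/-- The Levi-Civita connection is compatible with the metric. -/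
theorem mvfderiv_inner {x : M} {Y Z : ∀ q : M, TangentSpace I q}
    (hY : MDiffAt (T% Y) x) (hZ : MDiffAt (T% Z) x) (u : TangentSpace I x) :
    mvfderiv I (fun q => inner ℝ (Y q) (Z q)) x u
      = inner ℝ (leviCivita I Y x u) (Z x) + inner ℝ (Y x) (leviCivita I Z x u) := by
  have hu := mdifferentiableAt_extend I E u
  have h1 := inner_leviCivita hu hY hZ
  have h2 := inner_leviCivita hu hZ hY
  rw [extend_apply_self] at h1 h2
  rw [real_inner_comm _ (Y x), h1, h2]
  simp only [koszulForm, extend_apply_self]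
  have h3 : (fun q => inner ℝ (Z q) (Y q)) = fun q => inner ℝ (Y q) (Z q) := by
    funext q; exact real_inner_comm _ _
  rw [h3, mlieBracket_swap_apply (V := Z) (W := Y), inner_neg_left]
  ring

/-- The Levi-Civita connection is torsion-free. -/
theorem leviCivita_sub_leviCivita {x : M} {X Y : ∀ q : M, TangentSpace I q}
    (hX : MDiffAt (T% X) x) (hY : MDiffAt (T% Y) x) :
    leviCivita I Y x (X x) - leviCivita I X x (Y x) = mlieBracket I X Y x := by
  refine ext_inner_right ℝ fun w => ?_
  have hw := mdifferentiableAt_extend I E w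
  have h1 := inner_leviCivita hX hY hw
  have h2 := inner_leviCivita hY hX hw
  rw [extend_apply_self] at h1 h2
  rw [inner_sub_left, h1, h2]
  simp only [koszulForm, extend_apply_self]
  have h3 : (fun q => inner ℝ (Y q) (X q)) = fun q => inner ℝ (X q) (Y q) := by
    funext q; exact real_inner_comm _ _
  rw [h3, mlieBracket_swap_apply (V := Y) (W := X), inner_neg_left]
  ring

theorem leviCivita_congr {x : M} {Y Y' : ∀ q : M, TangentSpace I q} (h : ∀ᶠ q in 𝓝 x, Y q = Y' q)
    (u : TangentSpace I x) : leviCivita I Y x u = leviCivita I Y' x u := by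
  have h' : Y =ᶠ[𝓝 x] Y' := h
  have hk : ∀ w, koszul I Y x u w = koszul I Y' x u w := fun w => by
    rw [koszul_eq_koszulForm, koszul_eq_koszulForm]
    generalize (extend E w : ∀ q : M, TangentSpace I q) = Z
    generalize (extend E u : ∀ q : M, TangentSpace I q) = X
    simp only [koszulForm]
    rw [mvfderiv_congr (h.mono fun q hq => by simp only [hq] :
        (fun q => inner ℝ (Y q) (Z q)) =ᶠ[𝓝 x] fun q => inner ℝ (Y' q) (Z q)),
      mvfderiv_congr (h.mono fun q hq => by simp only [hq] :
        (fun q => inner ℝ (X q) (Y q)) =ᶠ[𝓝 x] fun q => inner ℝ (X q) (Y' q)),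
      h'.mlieBracket_vectorField_eq (EventuallyEq.refl (𝓝 x) Z),
      (EventuallyEq.refl (𝓝 x) X).mlieBracket_vectorField_eq h', h.self_of_nhds]
  simp only [leviCivita, hk]

theorem leviCivita_add {x : M} {Y Y' : ∀ q : M, TangentSpace I q}
    (hY : MDiffAt (T% Y) x) (hY' : MDiffAt (T% Y') x) (u : TangentSpace I x) :
    leviCivita I (fun q => Y q + Y' q) x u = leviCivita I Y x u + leviCivita I Y' x u := by
  refine ext_inner_right ℝ fun w => ?_
  have hu := mdifferentiableAt_extend I E u
  have hw := mdifferentiableAt_extend I E w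
  rw [inner_add_left, inner_leviCivita_extend hY, inner_leviCivita_extend hY',
    inner_leviCivita_extend (Y := fun q => Y q + Y' q) (mdifferentiableAt_add_section hY hY')]
  have e1 : mlieBracket I (extend E u) (fun q => Y q + Y' q) x = _ :=
    mlieBracket_add_right hY hY' (V := extend E u) (I := I)
  have e2 : mlieBracket I (fun q => Y q + Y' q) (extend E w) x = _ :=
    mlieBracket_add_left hY hY' (W := extend E w) (I := I)
  simp only [koszulForm, inner_add_left, inner_add_right, extend_apply_self, e1, e2,
    mvfderiv_fun_add (mdifferentiableAt_inner hY hw) (mdifferentiableAt_inner hY' hw),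
    mvfderiv_fun_add (mdifferentiableAt_inner hu hY) (mdifferentiableAt_inner hu hY'),
    add_apply, map_add]
  ring

theorem leviCivita_smul {x : M} {f : M → ℝ} {Y : ∀ q : M, TangentSpace I q}
    (hf : MDiffAt f x) (hY : MDiffAt (T% Y) x) (u : TangentSpace I x) :
    leviCivita I (fun q => f q • Y q) x u
      = mvfderiv I f x u • Y x + f x • leviCivita I Y x u := by
  refine ext_inner_right ℝ fun w => ?_
  have hu := mdifferentiableAt_extend I E u
  have hw := mdifferentiableAt_extend I E w
  rw [inner_add_left, real_inner_smul_left, real_inner_smul_left, inner_leviCivita_extend hY,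
    inner_leviCivita_extend (Y := fun q => f q • Y q) (hf.smul_section hY)]
  have e1 : mlieBracket I (extend E u) (fun q => f q • Y q) x = _ :=
    mlieBracket_smul_right hf hY (V := extend E u) (I := I)
  have e2 : mlieBracket I (fun q => f q • Y q) (extend E w) x = _ :=
    mlieBracket_smul_left hf hY (W := extend E w) (I := I)
  simp only [koszulForm, inner_add_left, real_inner_smul_left, real_inner_smul_right,
    extend_apply_self, e1, e2,
    mvfderiv_fun_mul hf (mdifferentiableAt_inner hY hw),
    mvfderiv_fun_mul hf (mdifferentiableAt_inner hu hY),
    add_apply, map_smul, smul_apply, smul_eq_mul]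
  simp
  rw [real_inner_comm (Y x) u]
  ring

theorem leviCivita_add_left {x : M} {Y : ∀ q : M, TangentSpace I q} (hY : MDiffAt (T% Y) x)
    (u u' : TangentSpace I x) :
    leviCivita I Y x (u + u') = leviCivita I Y x u + leviCivita I Y x u' := by
  refine ext_inner_right ℝ fun w => ?_
  have h := tensorialAt_koszulForm_left hY (mdifferentiableAt_extend I E w)
  rw [inner_add_left, inner_leviCivita_extend hY, inner_leviCivita_extend hY,
    inner_leviCivita_extend hY]
  exact (TensorialAt.mkHom _ x h).map_add u u'

theorem leviCivita_smul_left {x : M} {Y : ∀ q : M, TangentSpace I q} (hY : MDiffAt (T% Y) x)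
    (c : ℝ) (u : TangentSpace I x) :
    leviCivita I Y x (c • u) = c • leviCivita I Y x u := by
  refine ext_inner_right ℝ fun w => ?_
  have h := tensorialAt_koszulForm_left hY (mdifferentiableAt_extend I E w)
  rw [inner_smul_left, inner_leviCivita_extend hY, inner_leviCivita_extend hY]
  exact (TensorialAt.mkHom _ x h).map_smul c u

end LeviCivitaProperties

/-! ### Vector fields along a map -/

section Along

variable {E : Type*} [NormedAddCommGroup E] [NormedSpace ℝ E] [FiniteDimensional ℝ E]
  {H : Type*} [TopologicalSpace H] {I : ModelWithCorners ℝ E H}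
  {M : Type*} [TopologicalSpace M] [ChartedSpace H M] [IsManifold I ∞ M]
  {E' : Type*} [NormedAddCommGroup E'] [NormedSpace ℝ E'] [FiniteDimensional ℝ E']
  {H' : Type*} [TopologicalSpace H'] {I' : ModelWithCorners ℝ E' H'}
  {N : Type*} [TopologicalSpace N] [ChartedSpace H' N] [IsManifold I' ∞ N]

variable (I I') in
/-- Differentiability at `x` of a vector field `W` along a map `φ : M → N`, that is, of a section of
`φ⁻¹ TN`. -/
abbrev MDiffAlong (φ : M → N) (W : ∀ q : M, TangentSpace I' (φ q)) (x : M) : Prop :=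
  MDifferentiableAt I I'.tangent (fun q => (⟨φ q, W q⟩ : TangentBundle I' N)) x

/-- On the base set of the trivialization centred at `x`, outside of which `extend E v` has a junk
value, `extend E v` is the constant field with value `v`. -/
theorem extend_eq_symmL {x q : M} (v : TangentSpace I x)
    (hq : q ∈ (trivializationAt E (TangentSpace I : M → Type _) x).baseSet) :
    (extend E v q : TangentSpace I q)
      = (trivializationAt E (TangentSpace I : M → Type _) x).symmL ℝ q
          ((trivializationAt E (TangentSpace I : M → Type _) x).continuousLinearMapAt ℝ x v) := by
  rw [Trivialization.continuousLinearMapAt_apply, Trivialization.linearMapAt_apply,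
    if_pos (mem_baseSet_trivializationAt' x), Trivialization.symmL_apply _ hq]
  rfl

theorem symmL_continuousLinearMapAt_self (x : M) (v : TangentSpace I x) :
    (trivializationAt E (TangentSpace I : M → Type _) x).symmL ℝ x
      ((trivializationAt E (TangentSpace I : M → Type _) x).continuousLinearMapAt ℝ x v) = v :=
  Trivialization.symmL_continuousLinearMapAt _ (mem_baseSet_trivializationAt' x) v

theorem continuousLinearMapAt_extend {x q : M} (v : TangentSpace I x)
    (hq : q ∈ (trivializationAt E (TangentSpace I : M → Type _) x).baseSet) :
    (trivializationAt E (TangentSpace I : M → Type _) x).continuousLinearMapAt ℝ q (extend E v q)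
      = (trivializationAt E (TangentSpace I : M → Type _) x).continuousLinearMapAt ℝ x v := by
  rw [extend_eq_symmL v hq, Trivialization.continuousLinearMapAt_symmL _ hq]

theorem eventually_mem_baseSet {φ : M → N} {x : M} (hφ : ContinuousAt φ x) :
    ∀ᶠ q in 𝓝 x, φ q ∈ (trivializationAt E' (TangentSpace I' : N → Type _) (φ x)).baseSet :=
  hφ.eventually_mem ((trivializationAt E' (TangentSpace I' : N → Type _)
    (φ x)).open_baseSet.mem_nhds (mem_baseSet_trivializationAt' (φ x)))

theorem eventually_extend_add {x : M} (v w : TangentSpace I x) :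
    ∀ᶠ q in 𝓝 x, (extend E (v + w) q : TangentSpace I q) = extend E v q + extend E w q := by
  filter_upwards [eventually_mem_baseSet (I' := I) (φ := fun q : M => q) continuousAt_id] with q hq
  rw [extend_eq_symmL _ hq, extend_eq_symmL _ hq, extend_eq_symmL _ hq, map_add, map_add]

theorem eventually_extend_smul {x : M} (c : ℝ) (v : TangentSpace I x) :
    ∀ᶠ q in 𝓝 x, (extend E (c • v) q : TangentSpace I q) = c • extend E v q := by
  filter_upwards [eventually_mem_baseSet (I' := I) (φ := fun q : M => q) continuousAt_id] with q hq
  rw [extend_eq_symmL _ hq, extend_eq_symmL _ hq, map_smul, map_smul]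

theorem mdiffAlong_iff {φ : M → N} {W : ∀ q : M, TangentSpace I' (φ q)} {x : M} :
    MDiffAlong I I' φ W x ↔ MDiffAt φ x ∧ MDiffAt (fun q => (trivializationAt E'
      (TangentSpace I' : N → Type _) (φ x)).continuousLinearMapAt ℝ (φ q) (W q)) x := by
  rw [MDiffAlong, mdifferentiableAt_totalSpace]
  refine and_congr_right fun hφ => ?_
  have hφ' : MDiffAt φ x := hφ
  have h : (fun q => (trivializationAt E' (TangentSpace I' : N → Type _) (φ x)
        (⟨φ q, W q⟩ : TangentBundle I' N)).2) =ᶠ[𝓝 x] fun q =>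
      (trivializationAt E' (TangentSpace I' : N → Type _) (φ x)).continuousLinearMapAt ℝ (φ q)
        (W q) := by
    filter_upwards [eventually_mem_baseSet (I' := I') hφ'.continuousAt] with q hq
    rw [Trivialization.continuousLinearMapAt_apply, Trivialization.linearMapAt_apply, if_pos hq]
  exact h.mdifferentiableAt_iff

theorem MDiffAlong.add {φ : M → N} {V W : ∀ q : M, TangentSpace I' (φ q)} {x : M}
    (hV : MDiffAlong I I' φ V x) (hW : MDiffAlong I I' φ W x) :
    MDiffAlong I I' φ (fun q => V q + W q) x := by
  rw [mdiffAlong_iff] at *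
  refine ⟨hV.1, ?_⟩
  simp only [map_add]
  exact hV.2.add hW.2

theorem MDiffAlong.smul {φ : M → N} {g : M → ℝ} {W : ∀ q : M, TangentSpace I' (φ q)} {x : M}
    (hg : MDiffAt g x) (hW : MDiffAlong I I' φ W x) :
    MDiffAlong I I' φ (fun q => g q • W q) x := by
  rw [mdiffAlong_iff] at *
  refine ⟨hW.1, ?_⟩
  simp only [map_smul]
  exact hg.smul hW.2

theorem MDiffAlong.congr {φ : M → N} {V W : ∀ q : M, TangentSpace I' (φ q)} {x : M}
    (h : ∀ᶠ q in 𝓝 x, V q = W q) (hV : MDiffAlong I I' φ V x) : MDiffAlong I I' φ W x :=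
  MDifferentiableAt.congr_of_eventuallyEq hV (h.mono fun q hq => by simp only [hq])

theorem mdiffAlong_comp {φ : M → N} {Y : ∀ y : N, TangentSpace I' y} {x : M}
    (hY : MDiffAt (T% Y) (φ x)) (hφ : MDiffAt φ x) : MDiffAlong I I' φ (fun q => Y (φ q)) x :=
  MDifferentiableAt.comp x hY hφ

/-- A property of vector fields along `φ` that is local, additive, stable under multiplication with
functions, and true of the fields `extend E' v ∘ φ`, is true of all fields that are differentiable
at `x`: these are combinations of a local frame with differentiable coefficients. -/
theorem MDiffAlong.induction {φ : M → N} {x : M} (hφ : MDiffAt φ x)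
    {Q : (∀ q : M, TangentSpace I' (φ q)) → Prop}
    (hext : ∀ v : TangentSpace I' (φ x), Q (fun q => extend E' v (φ q)))
    (hadd : ∀ V W, MDiffAlong I I' φ V x → MDiffAlong I I' φ W x → Q V → Q W →
      Q (fun q => V q + W q))
    (hsmul : ∀ (g : M → ℝ) W, MDiffAt g x → MDiffAlong I I' φ W x → Q W → Q (fun q => g q • W q))
    (hcongr : ∀ V W, (∀ᶠ q in 𝓝 x, V q = W q) → Q V → Q W)
    {W : ∀ q : M, TangentSpace I' (φ q)} (hW : MDiffAlong I I' φ W x) : Q W := by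
  set e := trivializationAt E' (TangentSpace I' : N → Type _) (φ x) with he
  have hx : φ x ∈ e.baseSet := mem_baseSet_trivializationAt' (φ x)
  set b := Module.finBasis ℝ E' with hb
  have hc : ∀ i, MDiffAt (fun q => b.coord i (e.continuousLinearMapAt ℝ (φ q) (W q))) x := fun i =>
    ((LinearMap.toContinuousLinearMap (b.coord i)).differentiableAt.mdifferentiableAt).comp x
      (mdiffAlong_iff.1 hW).2
  have hb' : ∀ i, MDiffAlong I I' φ (fun q => extend E' (e.symmL ℝ (φ x) (b i)) (φ q)) x :=
    fun i => mdiffAlong_comp (mdifferentiableAt_extend I' E' _) hφ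
  have hsum : ∀ s : Finset (Fin (Module.finrank ℝ E')),
      MDiffAlong I I' φ (fun q => ∑ i ∈ s, b.coord i (e.continuousLinearMapAt ℝ (φ q) (W q)) •
          extend E' (e.symmL ℝ (φ x) (b i)) (φ q)) x ∧
      Q (fun q => ∑ i ∈ s, b.coord i (e.continuousLinearMapAt ℝ (φ q) (W q)) •
        extend E' (e.symmL ℝ (φ x) (b i)) (φ q)) := by
    intro s
    induction s using Finset.induction_on with
    | empty =>
      have h0 : ∀ᶠ q in 𝓝 x, (0 : ℝ) • (extend E' (0 : TangentSpace I' (φ x)) (φ q) :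
          TangentSpace I' (φ q)) = ∑ i ∈ (∅ : Finset (Fin (Module.finrank ℝ E'))),
          b.coord i (e.continuousLinearMapAt ℝ (φ q) (W q)) •
            extend E' (e.symmL ℝ (φ x) (b i)) (φ q) := Eventually.of_forall fun q => by simp
      have h1 := mdiffAlong_comp (mdifferentiableAt_extend I' E' (0 : TangentSpace I' (φ x))) hφ
      exact ⟨(MDiffAlong.smul mdifferentiableAt_const h1).congr h0,
        hcongr _ _ h0 (hsmul (fun _ => 0) _ mdifferentiableAt_const h1 (hext 0))⟩
    | insert i s hi ih =>
      simp only [Finset.sum_insert hi]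
      exact ⟨(MDiffAlong.smul (hc i) (hb' i)).add ih.1,
        hadd _ _ (MDiffAlong.smul (hc i) (hb' i)) ih.1 (hsmul _ _ (hc i) (hb' i) (hext _)) ih.2⟩
  refine hcongr _ _ ?_ (hsum Finset.univ).2
  filter_upwards [eventually_mem_baseSet (I' := I') hφ.continuousAt] with q hq
  have h1 : ∀ i, (extend E' (e.symmL ℝ (φ x) (b i)) (φ q) : TangentSpace I' (φ q))
      = e.symmL ℝ (φ q) (b i) := fun i => by
    rw [extend_eq_symmL _ hq]
    exact congrArg (fun z => e.symmL ℝ (φ q) z)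
      (Trivialization.continuousLinearMapAt_symmL e hx (b i))
  simp only [h1, ← map_smul, ← map_sum, Module.Basis.coord_apply, b.sum_repr]
  exact Trivialization.symmL_continuousLinearMapAt _ hq _

theorem mvfderiv_comp_apply {F : Type*} [NormedAddCommGroup F] [NormedSpace ℝ F] {φ : M → N}
    {g : N → F} {x : M} (hg : MDiffAt g (φ x)) (hφ : MDiffAt φ x) (u : TangentSpace I x) :
    mvfderiv I (fun q => g (φ q)) x u = mvfderiv I' g (φ x) (tangentMap I I' φ x u) := by
  have h := mfderiv_comp x hg hφ
  change (mfderiv I 𝓘(ℝ, F) (g ∘ φ) x) u = _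
  rw [h]
  rfl

/-- The Lie bracket of two of the fields `extend E u` vanishes at the base point, as these fields
are constant in the chart. -/
theorem mlieBracket_extend {x : M} (u v : TangentSpace I x) :
    mlieBracket I (extend E u) (extend E v) x = 0 := by
  -- near `x` the field `extend E u` is the pull-back of a constant field by the chart
  have key : ∀ u : TangentSpace I x, (extend E u : ∀ q : M, TangentSpace I q) =ᶠ[𝓝 x]
      mpullback I 𝓘(ℝ, E) (extChartAt I x) (fun _ => (trivializationAt E
        (TangentSpace I : M → Type _) x).continuousLinearMapAt ℝ x u) := by
    intro u
    filter_upwards [eventually_mem_baseSet (I' := I) (φ := fun q : M => q) continuousAt_id]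
      with q hq
    have hq' : q ∈ (chartAt H x).source := hq
    refine (extend_eq_symmL u hq).trans ?_
    have h1 : (mfderiv I 𝓘(ℝ, E) (extChartAt I x) q).inverse
        = (trivializationAt E (TangentSpace I : M → Type _) x).symmL ℝ q := by
      rw [← TangentBundle.continuousLinearMapAt_trivializationAt hq',
        ← Trivialization.symm_continuousLinearEquivAt_eq' _ hq]
      refine Eq.trans (congrArg _ ?_) (ContinuousLinearMap.inverse_equiv
        ((trivializationAt E (TangentSpace I : M → Type _) x).continuousLinearEquivAt ℝ q hq))
      ext z
      exact (congrFun (Trivialization.coe_continuousLinearEquivAt_eq _ hq) z).symm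
    exact (congrArg (fun L : E →L[ℝ] TangentSpace I q => L _) h1).symm
  have : IsManifold I (minSmoothness ℝ 2) M := by
    rw [minSmoothness_of_isRCLikeNormedField]; infer_instance
  have : IsManifold 𝓘(ℝ, E) (minSmoothness ℝ 2) E := by
    rw [minSmoothness_of_isRCLikeNormedField]; infer_instance
  have hc : ∀ w : E, MDifferentiableAt 𝓘(ℝ, E) 𝓘(ℝ, E).tangent
      (fun z : E => (⟨z, w⟩ : TangentBundle 𝓘(ℝ, E) E)) (extChartAt I x x) := fun w =>
    (contMDiffAt_vectorSpace_iff_contDiffAt (n := 1).2 contDiffAt_const).mdifferentiableAt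
      one_ne_zero
  refine ((key u).mlieBracket_vectorField_eq (key v)).trans ?_
  refine (mpullback_mlieBracket (n := ∞) (hc _) (hc _) contMDiffAt_extChartAt ?_).symm.trans ?_
  · rw [minSmoothness_of_isRCLikeNormedField]; exact ENat.LEInfty.out
  · have h0 : ∀ a b z : E, mlieBracket 𝓘(ℝ, E) (M := E) (fun _ => a) (fun _ => b) z = 0 := by
      intro a b z
      refine (congrFun (mlieBracketWithin_univ (I := 𝓘(ℝ, E))) z).symm.trans ?_
      refine (congrFun (mlieBracketWithin_eq_lieBracketWithin (𝕜 := ℝ)) z).trans ?_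
      simp [lieBracketWithin]
      rfl
    exact (congrArg _ (h0 _ _ _)).trans (map_zero _)

end Along

/-! ### The pull-back of the Levi-Civita connection -/

section Pullback

variable {E : Type*} [NormedAddCommGroup E] [NormedSpace ℝ E] [FiniteDimensional ℝ E]
  {H : Type*} [TopologicalSpace H] {I : ModelWithCorners ℝ E H}
  {M : Type*} [TopologicalSpace M] [ChartedSpace H M] [IsManifold I ∞ M]
  {E' : Type*} [NormedAddCommGroup E'] [NormedSpace ℝ E'] [FiniteDimensional ℝ E']
  {H' : Type*} [TopologicalSpace H'] {I' : ModelWithCorners ℝ E' H'}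
  {N : Type*} [TopologicalSpace N] [ChartedSpace H' N] [IsManifold I' ∞ N]

variable [RiemannianBundle (fun x : N => TangentSpace I' x)]
  [IsContMDiffRiemannianBundle I' ∞ E' (fun x : N => TangentSpace I' x)]

theorem leviCivita_extend_add {y : N} (v w u : TangentSpace I' y) :
    leviCivita I' (extend E' (v + w)) y u
      = leviCivita I' (extend E' v) y u + leviCivita I' (extend E' w) y u := by
  rw [leviCivita_congr (eventually_extend_add v w), leviCivita_add
    (mdifferentiableAt_extend I' E' v) (mdifferentiableAt_extend I' E' w)]

theorem leviCivita_extend_smul {y : N} (c : ℝ) (v u : TangentSpace I' y) :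
    leviCivita I' (extend E' (c • v)) y u = c • leviCivita I' (extend E' v) y u := by
  rw [leviCivita_congr (eventually_extend_smul c v), leviCivita_smul (f := fun _ => c)
    mdifferentiableAt_const (mdifferentiableAt_extend I' E' v), mvfderiv_const]
  simp

theorem leviCivita_extend_symm {y : N} (u v : TangentSpace I' y) :
    leviCivita I' (extend E' v) y u = leviCivita I' (extend E' u) y v := by
  have h := leviCivita_sub_leviCivita (mdifferentiableAt_extend I' E' u)
    (mdifferentiableAt_extend I' E' v)
  rw [mlieBracket_extend, extend_apply_self, extend_apply_self] at h
  exact sub_eq_zero.1 h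

theorem pullbackConnection_congr {φ : M → N} {x : M} {V W : ∀ q : M, TangentSpace I' (φ q)}
    (h : ∀ᶠ q in 𝓝 x, V q = W q) (u : TangentSpace I x) :
    pullbackConnection I I' φ V x u = pullbackConnection I I' φ W x u := by
  have h1 : (fun q => (trivializationAt E' (TangentSpace I' : N → Type _)
      (φ x)).continuousLinearMapAt ℝ (φ q) (V q)) =ᶠ[𝓝 x] fun q => (trivializationAt E'
        (TangentSpace I' : N → Type _) (φ x)).continuousLinearMapAt ℝ (φ q) (W q) :=
    h.mono fun q hq => by simp only [hq]
  simp only [pullbackConnection, mvfderiv_congr h1, h.self_of_nhds]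

theorem pullbackConnection_add {φ : M → N} {x : M} {V W : ∀ q : M, TangentSpace I' (φ q)}
    (hV : MDiffAlong I I' φ V x) (hW : MDiffAlong I I' φ W x) (u : TangentSpace I x) :
    pullbackConnection I I' φ (fun q => V q + W q) x u
      = pullbackConnection I I' φ V x u + pullbackConnection I I' φ W x u := by
  simp only [pullbackConnection, map_add, leviCivita_extend_add,
    mvfderiv_fun_add (mdiffAlong_iff.1 hV).2 (mdiffAlong_iff.1 hW).2, add_apply]
  abel

theorem pullbackConnection_smul {φ : M → N} {x : M} {g : M → ℝ}
    {W : ∀ q : M, TangentSpace I' (φ q)} (hg : MDiffAt g x) (hW : MDiffAlong I I' φ W x)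
    (u : TangentSpace I x) :
    pullbackConnection I I' φ (fun q => g q • W q) x u
      = mvfderiv I g x u • W x + g x • pullbackConnection I I' φ W x u := by
  simp only [pullbackConnection, map_smul, leviCivita_extend_smul,
    mvfderiv_fun_smul hg (mdiffAlong_iff.1 hW).2, add_apply, smul_apply, map_add, smul_add,
    ContinuousLinearMap.smulRight_apply, symmL_continuousLinearMapAt_self]
  abel

theorem pullbackConnection_extend {φ : M → N} {x : M} (hφ : MDiffAt φ x)
    (v : TangentSpace I' (φ x)) (u : TangentSpace I x) :
    pullbackConnection I I' φ (fun q => extend E' v (φ q)) x u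
      = leviCivita I' (extend E' v) (φ x) (tangentMap I I' φ x u) := by
  have h : (fun q => (trivializationAt E' (TangentSpace I' : N → Type _)
      (φ x)).continuousLinearMapAt ℝ (φ q) (extend E' v (φ q))) =ᶠ[𝓝 x] fun _ =>
        (trivializationAt E' (TangentSpace I' : N → Type _)
          (φ x)).continuousLinearMapAt ℝ (φ x) v := by
    filter_upwards [eventually_mem_baseSet (I' := I') hφ.continuousAt] with q hq
    exact continuousLinearMapAt_extend v hq
  simp only [pullbackConnection, mvfderiv_congr h, mvfderiv_const, extend_apply_self]
  simp

/-- On fields of the form `Y ∘ φ` the pull-back connection is given by the connection of `N`. -/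
theorem pullbackConnection_comp {φ : M → N} {x : M} (hφ : MDiffAt φ x)
    {Y : ∀ y : N, TangentSpace I' y} (hY : MDiffAt (T% Y) (φ x)) (u : TangentSpace I x) :
    pullbackConnection I I' φ (fun q => Y (φ q)) x u
      = leviCivita I' Y (φ x) (tangentMap I I' φ x u) := by
  refine MDiffAlong.induction (I := I') (φ := fun y : N => y) (x := φ x)
    (Q := fun Y => pullbackConnection I I' φ (fun q => Y (φ q)) x u
      = leviCivita I' Y (φ x) (tangentMap I I' φ x u)) mdifferentiableAt_id ?_ ?_ ?_ ?_ hY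
  · exact fun v => pullbackConnection_extend hφ v u
  · intro V W hV hW hQV hQW
    rw [leviCivita_add hV hW, pullbackConnection_add (mdiffAlong_comp hV hφ)
      (mdiffAlong_comp hW hφ), hQV, hQW]
  · intro g W hg hW hQ
    rw [leviCivita_smul hg hW, pullbackConnection_smul (g := fun q => g (φ q))
      (MDifferentiableAt.comp x hg hφ) (mdiffAlong_comp hW hφ), hQ, mvfderiv_comp_apply hg hφ]
  · intro V W h hQ
    rw [← leviCivita_congr h, ← hQ]
    exact (pullbackConnection_congr (hφ.continuousAt.eventually (p := fun y => V y = W y) h) u).symm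

/-- The pull-back connection is compatible with the metric. -/
theorem mvfderiv_inner_along {φ : M → N} {x : M} {V W : ∀ q : M, TangentSpace I' (φ q)}
    (hV : MDiffAlong I I' φ V x) (hW : MDiffAlong I I' φ W x) (u : TangentSpace I x) :
    mvfderiv I (fun q => inner ℝ (V q) (W q)) x u
      = inner ℝ (pullbackConnection I I' φ V x u) (W x)
        + inner ℝ (V x) (pullbackConnection I I' φ W x u) := by
  have hφ : MDiffAt φ x := (mdiffAlong_iff.1 hV).1
  -- the defect of the identity is local and linear over the functions in both arguments, which
  -- reduces the claim to the metric property of the connection of `N`.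
  have step : ∀ {A B : ∀ q : M, TangentSpace I' (φ q)}, MDiffAlong I I' φ A x →
      MDiffAlong I I' φ B x → (∀ w, mvfderiv I (fun q => inner ℝ (A q) (extend E' w (φ q))) x u
        = inner ℝ (pullbackConnection I I' φ A x u) w + inner ℝ (A x)
          (pullbackConnection I I' φ (fun q => extend E' w (φ q)) x u)) →
      mvfderiv I (fun q => inner ℝ (A q) (B q)) x u
        = inner ℝ (pullbackConnection I I' φ A x u) (B x)
          + inner ℝ (A x) (pullbackConnection I I' φ B x u) := by
    intro A B hA hB h
    refine MDiffAlong.induction (I := I) hφ (Q := fun B =>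
      mvfderiv I (fun q => inner ℝ (A q) (B q)) x u
        = inner ℝ (pullbackConnection I I' φ A x u) (B x)
          + inner ℝ (A x) (pullbackConnection I I' φ B x u)) ?_ ?_ ?_ ?_ hB
    · intro v
      simpa using h v
    · intro V W hV hW hQV hQW
      simp only [inner_add_right, mvfderiv_fun_add (mdifferentiableAt_inner hA hV)
        (mdifferentiableAt_inner hA hW), pullbackConnection_add hV hW, add_apply, hQV, hQW]
      ring
    · intro g W hg hW hQ
      simp only [real_inner_smul_right, mvfderiv_fun_mul hg (mdifferentiableAt_inner hA hW),
        pullbackConnection_smul hg hW, add_apply, smul_apply, hQ, inner_add_right, smul_eq_mul]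
      ring
    · intro V W h hQ
      rw [← pullbackConnection_congr h, ← h.self_of_nhds, ← hQ]
      have h1 : mvfderiv I (fun q => inner ℝ (A q) (V q)) x
          = mvfderiv I (fun q => inner ℝ (A q) (W q)) x :=
        mvfderiv_congr (h.mono fun q hq => by simp only [hq])
      rw [h1]
  refine step hV hW fun w => ?_
  have hw := mdiffAlong_comp (mdifferentiableAt_extend I' E' w) hφ
  have := step hw hV fun v => ?_
  · have h3 : (fun q => inner ℝ (V q) (extend E' w (φ q)))
        = fun q => inner ℝ (extend E' w (φ q)) (V q) := by
      funext q; exact real_inner_comm _ _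
    rw [h3, this, extend_apply_self, real_inner_comm, real_inner_comm w]
    ring
  · have hw' := mdifferentiableAt_extend I' E' w
    have hv' := mdifferentiableAt_extend I' E' v
    have := mvfderiv_comp_apply (I := I) (mdifferentiableAt_inner hw' hv') hφ u
    rw [this, mvfderiv_inner hw' hv', pullbackConnection_comp hφ hw',
      pullbackConnection_comp hφ hv', extend_apply_self]

theorem pullbackConnection_add_left {φ : M → N} {x : M} {W : ∀ q : M, TangentSpace I' (φ q)}
    (u u' : TangentSpace I x) : pullbackConnection I I' φ W x (u + u')
      = pullbackConnection I I' φ W x u + pullbackConnection I I' φ W x u' := by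
  simp only [pullbackConnection, map_add, leviCivita_add_left (mdifferentiableAt_extend I' E' _)]
  abel

theorem pullbackConnection_smul_left {φ : M → N} {x : M} {W : ∀ q : M, TangentSpace I' (φ q)}
    (c : ℝ) (u : TangentSpace I x) : pullbackConnection I I' φ W x (c • u)
      = c • pullbackConnection I I' φ W x u := by
  simp only [pullbackConnection, map_smul, leviCivita_smul_left (mdifferentiableAt_extend I' E' _),
    smul_add]

end Pullback

/-! ### The second fundamental form of a map -/

section Hessian

variable {E : Type*} [NormedAddCommGroup E] [NormedSpace ℝ E] [FiniteDimensional ℝ E]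
  {H : Type*} [TopologicalSpace H] {I : ModelWithCorners ℝ E H}
  {M : Type*} [TopologicalSpace M] [ChartedSpace H M] [IsManifold I ∞ M]
  {E' : Type*} [NormedAddCommGroup E'] [NormedSpace ℝ E'] [FiniteDimensional ℝ E']
  {H' : Type*} [TopologicalSpace H'] {I' : ModelWithCorners ℝ E' H'}
  {N : Type*} [TopologicalSpace N] [ChartedSpace H' N] [IsManifold I' ∞ N]

theorem MDiffAlong.tangentMap {φ : M → N} (hφ : ContMDiff I I' ∞ φ) {x : M}
    {Y : ∀ q : M, TangentSpace I q} (hY : MDiffAt (T% Y) x) :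
    MDiffAlong I I' φ (fun q => PHWC.tangentMap I I' φ q (Y q)) x :=
  ((hφ.contMDiff_tangentMap (m := 1) (by norm_cast)).mdifferentiable one_ne_zero _).comp x hY

/-- In the trivializations centred at `x` and `φ x`, the first derivatives of the differential of
`φ` are symmetric, as they are the second derivatives of a coordinate expression of `φ`. -/
theorem mvfderiv_tangentMap_extend_symm [I.Boundaryless] {φ : M → N} (hφ : ContMDiff I I' ∞ φ)
    {x : M} (u v : TangentSpace I x) :
    mvfderiv I (fun q => (trivializationAt E' (TangentSpace I' : N → Type _)
        (φ x)).continuousLinearMapAt ℝ (φ q) (tangentMap I I' φ q (extend E v q))) x u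
      = mvfderiv I (fun q => (trivializationAt E' (TangentSpace I' : N → Type _)
        (φ x)).continuousLinearMapAt ℝ (φ q) (tangentMap I I' φ q (extend E u q))) x v := by
  set c := extChartAt I x with hc
  set c' := extChartAt I' (φ x) with hc'
  set f : E → E' := c' ∘ φ ∘ c.symm with hf
  have hfx : ContDiffAt ℝ ∞ f (c x) := by
    have := (contMDiffAt_iff.1 (hφ x)).2
    rwa [I.range_eq_univ, contDiffWithinAt_univ] at this
  -- `dφ` of a constant field is a directional derivative of the coordinate expression `f`
  have key : ∀ w : TangentSpace I x, (fun q => (trivializationAt E' (TangentSpace I' : N → Type _)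
      (φ x)).continuousLinearMapAt ℝ (φ q) (tangentMap I I' φ q (extend E w q))) =ᶠ[𝓝 x]
      fun q => fderiv ℝ f (c q) ((trivializationAt E (TangentSpace I : M → Type _)
        x).continuousLinearMapAt ℝ x w) := by
    intro w
    set w₀ : E := (trivializationAt E (TangentSpace I : M → Type _) x).continuousLinearMapAt ℝ x w
    filter_upwards [eventually_mem_baseSet (I' := I) (φ := fun q : M => q) continuousAt_id,
      eventually_mem_baseSet (I' := I') hφ.continuous.continuousAt] with q hq hq'
    have hqs : q ∈ (chartAt H x).source := hq
    have hqs' : φ q ∈ (chartAt H' (φ x)).source := hq'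
    have hz : c q ∈ c.target := c.map_source (by rwa [hc, extChartAt_source])
    have hzq : c.symm (c q) = q := c.left_inv (by rwa [hc, extChartAt_source])
    have h1 : MDifferentiableAt 𝓘(ℝ, E) I c.symm (c q) := by
      have := mdifferentiableWithinAt_extChartAt_symm (I := I) hz
      rwa [I.range_eq_univ, mdifferentiableWithinAt_univ] at this
    have h2 : MDifferentiableAt I I' φ (c.symm (c q)) := hφ.mdifferentiable (by simp) _
    have h3 : MDifferentiableAt I' 𝓘(ℝ, E') c' (φ (c.symm (c q))) := by
      rw [hzq]; exact mdifferentiableAt_extChartAt hqs'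
    have h4 : fderiv ℝ f (c q) w₀ = (mfderiv I' 𝓘(ℝ, E') c' (φ (c.symm (c q))))
        (mfderiv I I' φ (c.symm (c q)) (mfderiv 𝓘(ℝ, E) I c.symm (c q) w₀)) := by
      rw [← mfderiv_eq_fderiv, hf, mfderiv_comp (I' := I') (c q) h3 (h2.comp _ h1),
        mfderiv_comp (I' := I) (c q) h2 h1]
      rfl
    set D : E := mfderiv 𝓘(ℝ, E) I c.symm (c q) w₀ with hD
    let G : M → E' := fun p => (mfderiv I' 𝓘(ℝ, E') c' (φ p)) (mfderiv I I' φ p D)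
    have h5 : fderiv ℝ f (c q) w₀ = G q := h4.trans (congrArg G hzq)
    have h6 : (extend E w q : TangentSpace I q) = D := by
      refine (extend_eq_symmL w hq).trans ?_
      rw [TangentBundle.symmL_trivializationAt hqs, I.range_eq_univ, mfderivWithin_univ]
      rfl
    rw [h5, h6, TangentBundle.continuousLinearMapAt_trivializationAt hqs']
    rfl
  have hcx : MDifferentiableAt I 𝓘(ℝ, E) c x := mdifferentiableAt_extChartAt (mem_chart_source H x)
  have hf2 : ∀ w : E, DifferentiableAt ℝ (fun z => fderiv ℝ f z w) (c x) := fun w =>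
    ((hfx.fderiv_right (m := 1) (by norm_cast)).differentiableAt one_ne_zero).clm_apply
      (differentiableAt_const _)
  have hder : ∀ u w : TangentSpace I x, mvfderiv I (fun q => fderiv ℝ f (c q)
      ((trivializationAt E (TangentSpace I : M → Type _) x).continuousLinearMapAt ℝ x w)) x u
      = fderiv ℝ (fderiv ℝ f) (c x)
        ((trivializationAt E (TangentSpace I : M → Type _) x).continuousLinearMapAt ℝ x u)
        ((trivializationAt E (TangentSpace I : M → Type _) x).continuousLinearMapAt ℝ x w) := by
    intro u w
    rw [mvfderiv_comp_apply (I' := 𝓘(ℝ, E)) (φ := c) (hf2 _).mdifferentiableAt hcx]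
    have h7 : tangentMap I 𝓘(ℝ, E) c x u
        = (trivializationAt E (TangentSpace I : M → Type _) x).continuousLinearMapAt ℝ x u := by
      rw [TangentBundle.continuousLinearMapAt_trivializationAt (mem_chart_source H x)]
      rfl
    set w₀ := (trivializationAt E (TangentSpace I : M → Type _) x).continuousLinearMapAt ℝ x w
    have h8 : mvfderiv 𝓘(ℝ, E) (fun z => fderiv ℝ f z w₀) (c x)
        = fderiv ℝ (fun z => fderiv ℝ f z w₀) (c x) := by
      simp only [mvfderiv, mfderiv_eq_fderiv]; rfl
    rw [h7, h8, fderiv_clm_apply ((hfx.fderiv_right (m := 1) (by norm_cast)).differentiableAt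
      one_ne_zero) (differentiableAt_const _)]
    simp
    rfl
  rw [mvfderiv_congr (key v), mvfderiv_congr (key u), hder, hder]
  exact (hfx.isSymmSndFDerivAt (by rw [minSmoothness_of_isRCLikeNormedField]; norm_cast)) _ _

variable [RiemannianBundle (fun x : M => TangentSpace I x)]
  [IsContMDiffRiemannianBundle I ∞ E (fun x : M => TangentSpace I x)]
  [RiemannianBundle (fun x : N => TangentSpace I' x)]
  [IsContMDiffRiemannianBundle I' ∞ E' (fun x : N => TangentSpace I' x)]

/-- The second fundamental form is symmetric, since both connections are torsion-free. -/
theorem secondFundamentalForm_symm [I.Boundaryless] {φ : M → N} (hφ : ContMDiff I I' ∞ φ)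
    {x : M} (u v : TangentSpace I x) :
    secondFundamentalForm I I' φ x u v = secondFundamentalForm I I' φ x v u := by
  simp only [secondFundamentalForm, pullbackConnection, extend_apply_self]
  rw [mvfderiv_tangentMap_extend_symm hφ u v, leviCivita_extend_symm u v,
    leviCivita_extend_symm (tangentMap I I' φ x u)]

/-- `∇^φ_u (dφ Y) = ∇dφ(u, Y) + dφ (∇_u Y)`: the value of `∇dφ` does not depend on the extension of
its second argument. -/
theorem pullbackConnection_tangentMap {φ : M → N} (hφ : ContMDiff I I' ∞ φ) {x : M}
    {Y : ∀ q : M, TangentSpace I q} (hY : MDiffAt (T% Y) x) (u : TangentSpace I x) :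
    pullbackConnection I I' φ (fun q => tangentMap I I' φ q (Y q)) x u
      = secondFundamentalForm I I' φ x u (Y x) + tangentMap I I' φ x (leviCivita I Y x u) := by
  have ht : TensorialAt I E (fun Y : ∀ q : M, TangentSpace I q =>
      pullbackConnection I I' φ (fun q => tangentMap I I' φ q (Y q)) x u
        - tangentMap I I' φ x (leviCivita I Y x u)) x :=
    { smul := by
        intro f Y hf hY
        have h1 : leviCivita I (f • Y) x u = _ := leviCivita_smul hf hY u
        simp only [h1, Pi.smul_apply', map_smul, map_add,
          pullbackConnection_smul hf (MDiffAlong.tangentMap hφ hY)]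
        module
      add := by
        intro Y Y' hY hY'
        have h1 : leviCivita I (Y + Y') x u = _ := leviCivita_add hY hY' u
        simp only [h1, Pi.add_apply, map_add, pullbackConnection_add
          (MDiffAlong.tangentMap hφ hY) (MDiffAlong.tangentMap hφ hY')]
        module }
  have h := ht.pointwise hY (mdifferentiableAt_extend I E (Y x)) (by simp)
  rw [secondFundamentalForm, ← h]
  abel

theorem secondFundamentalForm_add_right {φ : M → N} (hφ : ContMDiff I I' ∞ φ) {x : M}
    (u v w : TangentSpace I x) : secondFundamentalForm I I' φ x u (v + w)
      = secondFundamentalForm I I' φ x u v + secondFundamentalForm I I' φ x u w := by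
  have hv := mdifferentiableAt_extend I E v
  have hw := mdifferentiableAt_extend I E w
  have h := pullbackConnection_tangentMap hφ (mdifferentiableAt_add_section hv hw) u
  have h1 : leviCivita I (extend E v + extend E w) x u = _ := leviCivita_add hv hw u
  simp only [Pi.add_apply, map_add, h1, extend_apply_self, pullbackConnection_add
    (MDiffAlong.tangentMap hφ hv) (MDiffAlong.tangentMap hφ hw)] at h
  rw [pullbackConnection_tangentMap hφ hv, pullbackConnection_tangentMap hφ hw] at h
  simp only [extend_apply_self] at h
  rw [← sub_eq_zero] at h ⊢
  rw [← neg_eq_zero, ← h]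
  abel

theorem secondFundamentalForm_smul_right {φ : M → N} (hφ : ContMDiff I I' ∞ φ) {x : M} (c : ℝ)
    (u v : TangentSpace I x) : secondFundamentalForm I I' φ x u (c • v)
      = c • secondFundamentalForm I I' φ x u v := by
  have hv := mdifferentiableAt_extend I E v
  have hc : MDiffAt (fun _ : M => c) x := mdifferentiableAt_const
  have h := pullbackConnection_tangentMap hφ (hc.smul_section hv) u
  have h1 : leviCivita I ((fun _ : M => c) • extend E v) x u = _ := leviCivita_smul hc hv u
  simp only [Pi.smul_apply', map_smul, h1, extend_apply_self, pullbackConnection_smul hc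
    (MDiffAlong.tangentMap hφ hv), map_add] at h
  rw [pullbackConnection_tangentMap hφ hv] at h
  simp only [extend_apply_self, smul_add, mvfderiv_const] at h
  simpa using h.symm

theorem secondFundamentalForm_add_left {φ : M → N} {x : M} (u v w : TangentSpace I x) :
    secondFundamentalForm I I' φ x (u + v) w
      = secondFundamentalForm I I' φ x u w + secondFundamentalForm I I' φ x v w := by
  simp only [secondFundamentalForm, pullbackConnection_add_left,
    leviCivita_add_left (mdifferentiableAt_extend I E w), map_add]
  abel

theorem secondFundamentalForm_smul_left {φ : M → N} {x : M} (c : ℝ) (u w : TangentSpace I x) :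
    secondFundamentalForm I I' φ x (c • u) w = c • secondFundamentalForm I I' φ x u w := by
  simp only [secondFundamentalForm, pullbackConnection_smul_left,
    leviCivita_smul_left (mdifferentiableAt_extend I E w), map_smul, smul_sub]

/-- The second fundamental form of a smooth map at a point, as a bilinear map. -/
def hessian {φ : M → N} (hφ : ContMDiff I I' ∞ φ) (x : M) :
    TangentSpace I x →ₗ[ℝ] TangentSpace I x →ₗ[ℝ] TangentSpace I' (φ x) :=
  LinearMap.mk₂ ℝ (secondFundamentalForm I I' φ x)
    (fun u v w => secondFundamentalForm_add_left u v w)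
    (fun c u w => secondFundamentalForm_smul_left c u w)
    (fun u v w => secondFundamentalForm_add_right hφ u v w)
    (fun c u v => secondFundamentalForm_smul_right hφ c u v)

end Hessian

/-! ### The metric in a chart -/

section Metric

variable {E : Type*} [NormedAddCommGroup E] [NormedSpace ℝ E] [FiniteDimensional ℝ E]
  {H : Type*} [TopologicalSpace H] {I : ModelWithCorners ℝ E H}
  {M : Type*} [TopologicalSpace M] [ChartedSpace H M] [IsManifold I ∞ M]
  [RiemannianBundle (fun x : M => TangentSpace I x)]
  [IsContMDiffRiemannianBundle I ∞ E (fun x : M => TangentSpace I x)]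

/-- The metric in the trivialization of the tangent bundle centred at `x`, as a map to the dual. -/
def metricInChart (I : ModelWithCorners ℝ E H) {M : Type*} [TopologicalSpace M] [ChartedSpace H M]
    [IsManifold I ∞ M] [RiemannianBundle (fun x : M => TangentSpace I x)] (x q : M) :
    E →L[ℝ] E →L[ℝ] ℝ :=
  letI e := trivializationAt E (TangentSpace I : M → Type _) x
  LinearMap.toContinuousLinearMap
    { toFun := fun a => LinearMap.toContinuousLinearMap
        { toFun := fun b => inner ℝ (e.symmL ℝ q a) (e.symmL ℝ q b)
          map_add' := fun b b' => by rw [map_add, inner_add_right]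
          map_smul' := fun c b => by rw [map_smul, real_inner_smul_right]; rfl }
      map_add' := fun a a' => by ext b; simp [inner_add_left]
      map_smul' := fun c a => by ext b; simp [inner_smul_left] }

theorem metricInChart_apply (x q : M) (a b : E) :
    metricInChart I x q a b
      = inner ℝ ((trivializationAt E (TangentSpace I : M → Type _) x).symmL ℝ q a)
          ((trivializationAt E (TangentSpace I : M → Type _) x).symmL ℝ q b) := rfl

/-- A function with values in the linear maps on a finite-dimensional space is differentiable if
its values at all vectors are. -/
theorem mdifferentiableAt_clm_of_apply {F G : Type*} [NormedAddCommGroup F] [NormedSpace ℝ F]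
    [FiniteDimensional ℝ F] [NormedAddCommGroup G] [NormedSpace ℝ G] {f : M → F →L[ℝ] G} {x : M}
    (h : ∀ v, MDiffAt (fun q => f q v) x) : MDiffAt f x := by
  set b := Module.finBasis ℝ F
  have h1 : f = ∑ i, fun q => ContinuousLinearMap.smulRightL ℝ F G
      (LinearMap.toContinuousLinearMap (b.coord i)) (f q (b i)) := by
    funext q
    ext v
    rw [Finset.sum_apply, sum_apply]
    nth_rewrite 1 [← b.sum_repr v]
    rw [map_sum]
    exact Finset.sum_congr rfl fun i _ => by simp
  rw [h1]
  refine MDifferentiableAt.sum fun i _ => ?_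
  exact (ContinuousLinearMap.differentiableAt _).mdifferentiableAt.comp x (h (b i))

theorem mdifferentiableAt_inverse {F G : Type*} [NormedAddCommGroup F] [NormedSpace ℝ F]
    [CompleteSpace F] [NormedAddCommGroup G] [NormedSpace ℝ G] {f : M → F →L[ℝ] G} {x : M}
    (h : MDiffAt f x) (hx : (f x).IsInvertible) : MDiffAt (fun q => (f q).inverse) x := by
  obtain ⟨e, he⟩ := hx
  have h1 : DifferentiableAt ℝ (ContinuousLinearMap.inverse : (F →L[ℝ] G) → G →L[ℝ] F) (f x) := by
    rw [← he]
    exact (contDiffAt_map_inverse (n := 1) e).differentiableAt one_ne_zero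
  exact h1.mdifferentiableAt.comp x h

theorem eventually_isInvertible {F G : Type*} [NormedAddCommGroup F] [NormedSpace ℝ F]
    [CompleteSpace F] [NormedAddCommGroup G] [NormedSpace ℝ G] {f : M → F →L[ℝ] G} {x : M}
    (h : ContinuousAt f x) (hx : (f x).IsInvertible) : ∀ᶠ q in 𝓝 x, (f q).IsInvertible := by
  obtain ⟨e, he⟩ := hx
  refine h.eventually_mem (s := Set.range ((↑) : (F ≃L[ℝ] G) → F →L[ℝ] G)) ?_
  rw [← he]
  exact e.nhds

theorem isInvertible_of_injective {F G : Type*} [NormedAddCommGroup F] [NormedSpace ℝ F]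
    [FiniteDimensional ℝ F] [NormedAddCommGroup G] [NormedSpace ℝ G] [FiniteDimensional ℝ G]
    (hd : Module.finrank ℝ F = Module.finrank ℝ G) (f : F →L[ℝ] G) (hf : Function.Injective f) :
    f.IsInvertible :=
  ⟨(LinearEquiv.ofInjectiveOfFinrankEq f.toLinearMap hf hd).toContinuousLinearEquiv, by ext; rfl⟩

theorem isInvertible_metricInChart {x q : M}
    (hq : q ∈ (trivializationAt E (TangentSpace I : M → Type _) x).baseSet) :
    (metricInChart I x q).IsInvertible := by
  refine isInvertible_of_injective ?_ _ ?_
  · rw [← (LinearMap.toContinuousLinearMap (𝕜 := ℝ) (E := E) (F' := ℝ)).finrank_eq]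
    exact (Subspace.dual_finrank_eq (K := ℝ) (V := E)).symm
  · rw [injective_iff_map_eq_zero]
    intro a ha
    have h1 : metricInChart I x q a a = 0 := by rw [ha]; rfl
    rw [metricInChart_apply, inner_self_eq_zero] at h1
    rw [← Trivialization.continuousLinearMapAt_symmL (R := ℝ) _ hq a, h1, map_zero]

theorem eventually_symmL_eq_extend (x : M) (a : E) :
    ∀ᶠ q in 𝓝 x, (trivializationAt E (TangentSpace I : M → Type _) x).symmL ℝ q a
      = extend E ((trivializationAt E (TangentSpace I : M → Type _) x).symmL ℝ x a) q := by
  filter_upwards [eventually_mem_baseSet (I' := I) (φ := fun q : M => q) continuousAt_id] with q hq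
  rw [extend_eq_symmL _ hq, Trivialization.continuousLinearMapAt_symmL _
    (mem_baseSet_trivializationAt' x)]

theorem mdifferentiableAt_metricInChart (x : M) : MDiffAt (metricInChart I x) x := by
  refine mdifferentiableAt_clm_of_apply fun a => mdifferentiableAt_clm_of_apply fun b => ?_
  have h := fun c : E => mdifferentiableAt_extend I E
    ((trivializationAt E (TangentSpace I : M → Type _) x).symmL ℝ x c)
  refine (mdifferentiableAt_inner (I := I) (h a) (h b)).congr_of_eventuallyEq ?_
  filter_upwards [eventually_symmL_eq_extend (I := I) x a,
    eventually_symmL_eq_extend (I := I) x b] with q ha hb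
  rw [metricInChart_apply, ha, hb]

theorem mdifferentiableAt_metricInChart_inverse (x : M) :
    MDiffAt (fun q => (metricInChart I x q).inverse) x :=
  mdifferentiableAt_inverse (mdifferentiableAt_metricInChart x)
    (isInvertible_metricInChart (mem_baseSet_trivializationAt' x))

/-- A tangent vector at `q`, in the trivialization centred at `x`, from its inner products. -/
theorem continuousLinearMapAt_eq_inverse {x q : M}
    (hq : q ∈ (trivializationAt E (TangentSpace I : M → Type _) x).baseSet) (v : TangentSpace I q)
    (l : E →L[ℝ] ℝ) (hl : ∀ b, l b
      = inner ℝ v ((trivializationAt E (TangentSpace I : M → Type _) x).symmL ℝ q b)) :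
    (trivializationAt E (TangentSpace I : M → Type _) x).continuousLinearMapAt ℝ q v
      = (metricInChart I x q).inverse l := by
  obtain ⟨e, he⟩ := isInvertible_metricInChart (I := I) hq
  rw [← he, ContinuousLinearMap.inverse_equiv]
  refine (ContinuousLinearEquiv.eq_symm_apply e).2 ?_
  ext b
  have : (e : E →L[ℝ] E →L[ℝ] ℝ) ((trivializationAt E (TangentSpace I : M → Type _)
      x).continuousLinearMapAt ℝ q v) b = inner ℝ v
        ((trivializationAt E (TangentSpace I : M → Type _) x).symmL ℝ q b) := by
    rw [he, metricInChart_apply, Trivialization.symmL_continuousLinearMapAt _ hq]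
  exact this.trans (hl b).symm

/-- A vector field whose inner products with the fields `extend E w` are differentiable at `x` is
differentiable at `x`: in the chart it is obtained from these inner products by the inverse of the
metric. -/
theorem mdifferentiableAt_of_inner_extend {x : M} {V : ∀ q : M, TangentSpace I q}
    (h : ∀ w : TangentSpace I x, MDiffAt (fun q => inner ℝ (V q) (extend E w q)) x) :
    MDiffAt (T% V) x := by
  set e := trivializationAt E (TangentSpace I : M → Type _) x with he
  let l : M → E →L[ℝ] ℝ := fun q => LinearMap.toContinuousLinearMap
    { toFun := fun b => inner ℝ (V q) (e.symmL ℝ q b)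
      map_add' := fun b b' => by rw [map_add, inner_add_right]
      map_smul' := fun c b => by rw [map_smul, real_inner_smul_right]; rfl }
  have hl : MDiffAt l x := mdifferentiableAt_clm_of_apply fun b =>
    (h (e.symmL ℝ x b)).congr_of_eventuallyEq <| by
      filter_upwards [eventually_symmL_eq_extend (I := I) x b] with q hq
      exact congrArg (inner ℝ (V q)) hq
  refine (mdiffAlong_iff (φ := fun q : M => q)).2 ⟨mdifferentiableAt_id, ?_⟩
  refine ((mdifferentiableAt_metricInChart_inverse (I := I)
    x).clm_apply hl).congr_of_eventuallyEq ?_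
  filter_upwards [eventually_mem_baseSet (I' := I) (φ := fun q : M => q) continuousAt_id] with q hq
  exact continuousLinearMapAt_eq_inverse (I := I) hq _ _ fun b => rfl

end Metric

/-! ### The induced f-structure -/

section FStructure

variable {E : Type*} [NormedAddCommGroup E] [NormedSpace ℝ E] [FiniteDimensional ℝ E]
  {H : Type*} [TopologicalSpace H] {I : ModelWithCorners ℝ E H}
  {M : Type*} [TopologicalSpace M] [ChartedSpace H M] [IsManifold I ∞ M]
  {E' : Type*} [NormedAddCommGroup E'] [NormedSpace ℝ E'] [FiniteDimensional ℝ E']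
  {H' : Type*} [TopologicalSpace H'] {I' : ModelWithCorners ℝ E' H'}
  {N : Type*} [TopologicalSpace N] [ChartedSpace H' N] [IsManifold I' ∞ N]
  [RiemannianBundle (fun x : M => TangentSpace I x)]
  [RiemannianBundle (fun y : N => TangentSpace I' y)]

theorem inner_tangentAdjoint {φ : M → N} {x : M} (w : TangentSpace I' (φ x))
    (v : TangentSpace I x) :
    inner ℝ (tangentAdjoint I I' φ x w) v = inner ℝ w (tangentMap I I' φ x v) :=
  LinearMap.adjoint_inner_left _ _ _

theorem tangentAdjoint_mem_horizontal {φ : M → N} {x : M} (w : TangentSpace I' (φ x)) :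
    tangentAdjoint I I' φ x w ∈ horizontal I I' φ x := by
  rw [horizontal, Submodule.mem_orthogonal']
  intro v hv
  rw [inner_tangentAdjoint, show tangentMap I I' φ x v = 0 from hv, inner_zero_right]

theorem fStructure_mem_horizontal (𝒥 : AlmostHermitian I' N) {φ : M → N} {x : M}
    (v : TangentSpace I x) : fStructure I 𝒥 φ x v ∈ horizontal I I' φ x :=
  tangentAdjoint_mem_horizontal _

theorem fStructure_congr (𝒥 : AlmostHermitian I' N) {φ : M → N} {x : M} {v w : TangentSpace I x}
    (h : tangentMap I I' φ x v = tangentMap I I' φ x w) :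
    fStructure I 𝒥 φ x v = fStructure I 𝒥 φ x w := by
  simp only [fStructure, LinearMap.comp_apply, h]

theorem fStructure_eq_zero (𝒥 : AlmostHermitian I' N) {φ : M → N} {x : M} {v : TangentSpace I x}
    (h : tangentMap I I' φ x v = 0) : fStructure I 𝒥 φ x v = 0 := by
  rw [fStructure_congr 𝒥 (h.trans (map_zero (tangentMap I I' φ x)).symm), map_zero]

theorem injective_tangentMap_comp_tangentAdjoint {φ : M → N} {x : M}
    (hx : x ∈ regularSet I I' φ) :
    Function.Injective (tangentMap I I' φ x ∘ₗ tangentAdjoint I I' φ x) := by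
  rw [injective_iff_map_eq_zero]
  intro w hw
  have h0 : tangentAdjoint I I' φ x w = 0 := by
    rw [← inner_self_eq_zero (𝕜 := ℝ), inner_tangentAdjoint, ← LinearMap.comp_apply, hw,
      inner_zero_right]
  obtain ⟨u, rfl⟩ := hx w
  rw [← inner_self_eq_zero (𝕜 := ℝ), ← inner_tangentAdjoint, h0, inner_zero_left]

theorem eq_zero_of_mem_horizontal {φ : M → N} {x : M} {v : TangentSpace I x}
    (hv : v ∈ horizontal I I' φ x) (h : tangentMap I I' φ x v = 0) : v = 0 :=
  inner_self_eq_zero (𝕜 := ℝ).1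
    (Submodule.inner_right_of_mem_orthogonal (K := vertical I I' φ x) h hv)

theorem fStructure_fStructure (𝒥 : AlmostHermitian I' N) {φ : M → N} {x : M}
    (hx : x ∈ regularSet I I' φ) {v : TangentSpace I x} (hv : v ∈ horizontal I I' φ x) :
    fStructure I 𝒥 φ x (fStructure I 𝒥 φ x v) = -v := by
  rw [eq_neg_iff_add_eq_zero]
  refine eq_zero_of_mem_horizontal (add_mem (fStructure_mem_horizontal 𝒥 _) hv) ?_
  rw [map_add, tangentMap_fStructure I 𝒥 hx, tangentMap_fStructure I 𝒥 hx, 𝒥.sq, neg_add_cancel]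

/-- The projection to the vertical space, in terms of `F`; its differentiability follows from that
of `F`. -/
theorem starProjection_vertical (𝒥 : AlmostHermitian I' N) {φ : M → N} {x : M}
    (hx : x ∈ regularSet I I' φ) (v : TangentSpace I x) :
    (vertical I I' φ x).starProjection v = v + fStructure I 𝒥 φ x (fStructure I 𝒥 φ x v) := by
  refine Submodule.eq_starProjection_of_mem_orthogonal ?_ ?_
  · change tangentMap I I' φ x _ = 0
    rw [map_add, tangentMap_fStructure I 𝒥 hx, tangentMap_fStructure I 𝒥 hx, 𝒥.sq, add_neg_cancel]
  · rw [sub_add_cancel_left]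
    exact neg_mem (fStructure_mem_horizontal 𝒥 _)

theorem inner_J_left (𝒥 : AlmostHermitian I' N) {y : N} (v w : TangentSpace I' y) :
    inner ℝ (𝒥.J y v) w = -inner ℝ v (𝒥.J y w) := by
  rw [← 𝒥.isometry y v, 𝒥.sq, inner_neg_right, neg_neg]

/-- The place where pseudo horizontal weak conformality enters: `F ∘ dφᵗ = dφᵗ ∘ J`. -/
theorem fStructure_tangentAdjoint {𝒥 : AlmostHermitian I' N} {φ : M → N} (hJ : IsPHWC I 𝒥 φ)
    {x : M} (hx : x ∈ regularSet I I' φ) (w : TangentSpace I' (φ x)) :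
    fStructure I 𝒥 φ x (tangentAdjoint I I' φ x w) = tangentAdjoint I I' φ x (𝒥.J (φ x) w) := by
  rw [← sub_eq_zero]
  refine eq_zero_of_mem_horizontal (sub_mem (fStructure_mem_horizontal 𝒥 _)
    (tangentAdjoint_mem_horizontal _)) ?_
  rw [map_sub, tangentMap_fStructure I 𝒥 hx, hJ, sub_self]

/-- The induced `f`-structure of a pseudo horizontally weakly conformal map is skew-symmetric. -/
theorem inner_fStructure_left {𝒥 : AlmostHermitian I' N} {φ : M → N} (hJ : IsPHWC I 𝒥 φ) {x : M}
    (hx : x ∈ regularSet I I' φ) (v w : TangentSpace I x) :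
    inner ℝ (fStructure I 𝒥 φ x v) w = -inner ℝ v (fStructure I 𝒥 φ x w) := by
  have hs : ∀ v : TangentSpace I x, ∃ a, tangentMap I I' φ x v
      = tangentMap I I' φ x (tangentAdjoint I I' φ x a) := fun v => by
    obtain ⟨a, ha⟩ := (LinearMap.injective_iff_surjective.1
      (injective_tangentMap_comp_tangentAdjoint hx)) (tangentMap I I' φ x v)
    exact ⟨a, ha.symm⟩
  -- modulo vertical vectors, `v = dφᵗ a` and `w = dφᵗ b`
  obtain ⟨a, ha⟩ := hs v
  obtain ⟨b, hb⟩ := hs w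
  rw [fStructure_congr 𝒥 ha, fStructure_congr 𝒥 hb, fStructure_tangentAdjoint hJ hx,
    fStructure_tangentAdjoint hJ hx, inner_tangentAdjoint, hb, real_inner_comm _ v,
    inner_tangentAdjoint, ha, ← inner_tangentAdjoint, real_inner_comm, inner_tangentAdjoint,
    ← neg_eq_iff_eq_neg, real_inner_comm, ← inner_neg_left]
  rw [hJ, inner_neg_left, inner_J_left, neg_neg, real_inner_comm, inner_J_left, ← hJ]

end FStructure

/-! ### Regularity of the induced f-structure -/

section Smoothness

variable {E : Type*} [NormedAddCommGroup E] [NormedSpace ℝ E] [FiniteDimensional ℝ E]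
  {H : Type*} [TopologicalSpace H] {I : ModelWithCorners ℝ E H}
  {M : Type*} [TopologicalSpace M] [ChartedSpace H M] [IsManifold I ∞ M]
  {E' : Type*} [NormedAddCommGroup E'] [NormedSpace ℝ E'] [FiniteDimensional ℝ E']
  {H' : Type*} [TopologicalSpace H'] {I' : ModelWithCorners ℝ E' H'}
  {N : Type*} [TopologicalSpace N] [ChartedSpace H' N] [IsManifold I' ∞ N]
  [RiemannianBundle (fun x : M => TangentSpace I x)]
  [IsContMDiffRiemannianBundle I ∞ E (fun x : M => TangentSpace I x)]
  [RiemannianBundle (fun y : N => TangentSpace I' y)]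
  [IsContMDiffRiemannianBundle I' ∞ E' (fun y : N => TangentSpace I' y)]

theorem MDiffAlong.tangentAdjoint {φ : M → N} (hφ : ContMDiff I I' ∞ φ) {x : M}
    {Z : ∀ q : M, TangentSpace I' (φ q)} (hZ : MDiffAlong I I' φ Z x) :
    MDiffAt (T% fun q => PHWC.tangentAdjoint I I' φ q (Z q)) x := by
  refine mdifferentiableAt_of_inner_extend fun w => ?_
  have h := mdifferentiableAt_inner (I := I') hZ
    (MDiffAlong.tangentMap hφ (mdifferentiableAt_extend I E w))
  refine h.congr_of_eventuallyEq (Eventually.of_forall fun q => ?_)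
  exact inner_tangentAdjoint _ _

theorem MDiffAlong.almostComplex (𝒥 : AlmostHermitian I' N) {φ : M → N} {x : M}
    {W : ∀ q : M, TangentSpace I' (φ q)} (hW : MDiffAlong I I' φ W x) :
    MDiffAlong I I' φ (fun q => 𝒥.J (φ q) (W q)) x := by
  have hφ : MDiffAt φ x := (mdiffAlong_iff.1 hW).1
  have hJ := ((𝒥.smooth.contMDiffAt (x := φ x)).mdifferentiableAt (by simp)).comp x hφ
  exact MDifferentiableAt.clm_bundle_apply (F₁ := E') (F₂ := E') hJ hW

variable (I I') in
/-- The endomorphism `dφ_q ∘ dφ_qᵗ` of `T_{φ q} N`, in the trivialization of `TN` centred at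
`φ x`. -/
def adjointSquareInChart (φ : M → N) (x q : M) : E' →L[ℝ] E' :=
  letI e := trivializationAt E' (TangentSpace I' : N → Type _) (φ x)
  e.continuousLinearMapAt ℝ (φ q) ∘L
    LinearMap.toContinuousLinearMap (tangentMap I I' φ q ∘ₗ PHWC.tangentAdjoint I I' φ q) ∘L
      e.symmL ℝ (φ q)

theorem adjointSquareInChart_apply {φ : M → N} {x q : M} (a : E') :
    adjointSquareInChart I I' φ x q a
      = (trivializationAt E' (TangentSpace I' : N → Type _) (φ x)).continuousLinearMapAt ℝ (φ q)
        (tangentMap I I' φ q (tangentAdjoint I I' φ q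
          ((trivializationAt E' (TangentSpace I' : N → Type _) (φ x)).symmL ℝ (φ q) a))) := rfl

theorem mdifferentiableAt_adjointSquareInChart {φ : M → N} (hφ : ContMDiff I I' ∞ φ) (x : M) :
    MDiffAt (adjointSquareInChart I I' φ x) x := by
  refine mdifferentiableAt_clm_of_apply fun a => ?_
  have hφx : MDiffAt φ x := hφ.mdifferentiableAt (by simp)
  have h := (mdiffAlong_iff.1 (MDiffAlong.tangentMap hφ (MDiffAlong.tangentAdjoint hφ
    (mdiffAlong_comp (mdifferentiableAt_extend I' E'
    ((trivializationAt E' (TangentSpace I' : N → Type _) (φ x)).symmL ℝ (φ x) a)) hφx)))).2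
  refine h.congr_of_eventuallyEq ?_
  filter_upwards [hφx.continuousAt.eventually (eventually_symmL_eq_extend (I := I') (φ x) a)]
    with q hq
  rw [adjointSquareInChart_apply, hq]

theorem isInvertible_adjointSquareInChart {φ : M → N} {x : M} (hx : x ∈ regularSet I I' φ) :
    (adjointSquareInChart I I' φ x x).IsInvertible := by
  refine isInvertible_of_injective rfl _ ?_
  rw [injective_iff_map_eq_zero]
  intro a ha
  set e := trivializationAt E' (TangentSpace I' : N → Type _) (φ x) with he
  have hb : φ x ∈ e.baseSet := mem_baseSet_trivializationAt' (φ x)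
  rw [adjointSquareInChart_apply] at ha
  have h1 := congrArg (e.symmL ℝ (φ x)) ha
  rw [Trivialization.symmL_continuousLinearMapAt _ hb, map_zero] at h1
  have h2 := (injective_iff_map_eq_zero _).1 (injective_tangentMap_comp_tangentAdjoint hx) _ h1
  rw [← Trivialization.continuousLinearMapAt_symmL (R := ℝ) e hb a, h2, map_zero]

/-- The regular set of a smooth map is open: `dφ ∘ dφᵗ` stays invertible nearby. -/
theorem eventually_mem_regularSet {φ : M → N} (hφ : ContMDiff I I' ∞ φ) {x : M}
    (hx : x ∈ regularSet I I' φ) : ∀ᶠ q in 𝓝 x, q ∈ regularSet I I' φ := by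
  have hφx : MDiffAt φ x := hφ.mdifferentiableAt (by simp)
  filter_upwards [eventually_isInvertible (mdifferentiableAt_adjointSquareInChart hφ x).continuousAt
    (isInvertible_adjointSquareInChart hx), eventually_mem_baseSet (I' := I') hφx.continuousAt]
    with q hq hb w
  obtain ⟨f, hf⟩ := hq
  set e := trivializationAt E' (TangentSpace I' : N → Type _) (φ x) with he
  obtain ⟨a, ha⟩ := f.surjective (e.continuousLinearMapAt ℝ (φ q) w)
  refine ⟨tangentAdjoint I I' φ q (e.symmL ℝ (φ q) a), ?_⟩
  have h1 : adjointSquareInChart I I' φ x q a = e.continuousLinearMapAt ℝ (φ q) w := by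
    rw [← hf]; exact ha
  rw [adjointSquareInChart_apply] at h1
  have h2 := congrArg (e.symmL ℝ (φ q)) h1
  rwa [Trivialization.symmL_continuousLinearMapAt _ hb,
    Trivialization.symmL_continuousLinearMapAt _ hb] at h2

/-- The inverse of `dφ ∘ dφᵗ` preserves differentiability at regular points. -/
theorem MDiffAlong.of_tangentMap_tangentAdjoint {φ : M → N} (hφ : ContMDiff I I' ∞ φ) {x : M}
    (hx : x ∈ regularSet I I' φ) {Z W : ∀ q : M, TangentSpace I' (φ q)}
    (hW : MDiffAlong I I' φ W x)
    (h : ∀ᶠ q in 𝓝 x, PHWC.tangentMap I I' φ q (PHWC.tangentAdjoint I I' φ q (Z q)) = W q) :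
    MDiffAlong I I' φ Z x := by
  have hφx : MDiffAt φ x := hφ.mdifferentiableAt (by simp)
  have hd := mdifferentiableAt_adjointSquareInChart hφ x
  refine mdiffAlong_iff.2 ⟨hφx, ((mdifferentiableAt_inverse hd
    (isInvertible_adjointSquareInChart hx)).clm_apply
      (mdiffAlong_iff.1 hW).2).congr_of_eventuallyEq ?_⟩
  filter_upwards [eventually_isInvertible hd.continuousAt (isInvertible_adjointSquareInChart hx),
    eventually_mem_baseSet (I' := I') hφx.continuousAt, h] with q hq hb hZ
  obtain ⟨f, hf⟩ := hq
  set e := trivializationAt E' (TangentSpace I' : N → Type _) (φ x) with he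
  rw [← hf, ContinuousLinearMap.inverse_equiv]
  refine (ContinuousLinearEquiv.eq_symm_apply f).2 ?_
  have h1 : adjointSquareInChart I I' φ x q (e.continuousLinearMapAt ℝ (φ q) (Z q))
      = e.continuousLinearMapAt ℝ (φ q) (W q) := by
    rw [adjointSquareInChart_apply, Trivialization.symmL_continuousLinearMapAt _ hb, hZ]
  rw [← hf] at h1
  exact h1

/-- The induced `f`-structure is differentiable at regular points. -/
theorem mdifferentiableAt_fStructure (𝒥 : AlmostHermitian I' N) {φ : M → N}
    (hφ : ContMDiff I I' ∞ φ) {x : M} (hx : x ∈ regularSet I I' φ)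
    {Y : ∀ q : M, TangentSpace I q} (hY : MDiffAt (T% Y) x) :
    MDiffAt (T% fun q => fStructure I 𝒥 φ q (Y q)) x := by
  refine MDiffAlong.tangentAdjoint (I' := I') hφ (MDiffAlong.of_tangentMap_tangentAdjoint hφ hx
    (MDiffAlong.almostComplex 𝒥 (MDiffAlong.tangentMap hφ hY)) ?_)
  filter_upwards [eventually_mem_regularSet hφ hx] with q hq
  exact tangentMap_fStructure I 𝒥 hq (Y q)

end Smoothness

/-! ### Derivatives of fields of endomorphisms and of 2-forms -/

section EndomorphismFields

variable {E : Type*} [NormedAddCommGroup E] [NormedSpace ℝ E] [FiniteDimensional ℝ E]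
  {H : Type*} [TopologicalSpace H] {I : ModelWithCorners ℝ E H}
  {M : Type*} [TopologicalSpace M] [ChartedSpace H M] [IsManifold I ∞ M]
  [RiemannianBundle (fun x : M => TangentSpace I x)]
  [IsContMDiffRiemannianBundle I ∞ E (fun x : M => TangentSpace I x)]

/-- `(∇_u A) (Y x) = ∇_u (A Y) - A (∇_u Y)` for every vector field `Y` differentiable at `x`. -/
theorem covDerivEnd_apply {A : ∀ q : M, TangentSpace I q →ₗ[ℝ] TangentSpace I q} {x : M}
    (hA : ∀ Y : ∀ q : M, TangentSpace I q, MDiffAt (T% Y) x → MDiffAt (T% fun q => A q (Y q)) x)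
    {Y : ∀ q : M, TangentSpace I q} (hY : MDiffAt (T% Y) x) (u : TangentSpace I x) :
    covDerivEnd I A x u (Y x)
      = leviCivita I (fun q => A q (Y q)) x u - A x (leviCivita I Y x u) := by
  have ht : TensorialAt I E (fun Y : ∀ q : M, TangentSpace I q =>
      leviCivita I (fun q => A q (Y q)) x u - A x (leviCivita I Y x u)) x :=
    { smul := by
        intro f Y hf hY
        have h1 : leviCivita I (f • Y) x u = _ := leviCivita_smul hf hY u
        have h2 := leviCivita_smul (u := u) hf (hA Y hY)
        simp only [Pi.smul_apply', map_smul, h1, h2, map_add]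
        rw [smul_sub]
        abel
      add := by
        intro Y Y' hY hY'
        have h1 : leviCivita I (Y + Y') x u = _ := leviCivita_add hY hY' u
        have h2 := leviCivita_add (u := u) (hA Y hY) (hA Y' hY')
        simp only [Pi.add_apply, map_add, h1, h2]
        abel }
  exact ht.pointwise (mdifferentiableAt_extend I E (Y x)) hY (extend_apply_self _ _)

section

variable {A : ∀ q : M, TangentSpace I q →ₗ[ℝ] TangentSpace I q} {x : M}
  (hA : ∀ Y : ∀ q : M, TangentSpace I q, MDiffAt (T% Y) x → MDiffAt (T% fun q => A q (Y q)) x)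
include hA

theorem covDerivEnd_add_left (u u' v : TangentSpace I x) :
    covDerivEnd I A x (u + u') v = covDerivEnd I A x u v + covDerivEnd I A x u' v := by
  have h := mdifferentiableAt_extend I E v
  simp only [covDerivEnd, leviCivita_add_left (hA _ h), leviCivita_add_left h, map_add]
  abel

theorem covDerivEnd_smul_left (c : ℝ) (u v : TangentSpace I x) :
    covDerivEnd I A x (c • u) v = c • covDerivEnd I A x u v := by
  have h := mdifferentiableAt_extend I E v
  simp only [covDerivEnd, leviCivita_smul_left (hA _ h), leviCivita_smul_left h, map_smul, smul_sub]

theorem covDerivEnd_add_right (u v v' : TangentSpace I x) :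
    covDerivEnd I A x u (v + v') = covDerivEnd I A x u v + covDerivEnd I A x u v' := by
  have hv := mdifferentiableAt_extend I E v
  have hv' := mdifferentiableAt_extend I E v'
  have h := covDerivEnd_apply hA (mdifferentiableAt_add_section hv hv') u
  have h2 : leviCivita I (extend E v + extend E v') x u = _ := leviCivita_add hv hv' u
  have h3 := leviCivita_add (u := u) (hA _ hv) (hA _ hv')
  simp only [Pi.add_apply, extend_apply_self, map_add] at h
  rw [h, h2, h3, map_add]
  simp only [covDerivEnd]
  abel

theorem covDerivEnd_smul_right (c : ℝ) (u v : TangentSpace I x) :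
    covDerivEnd I A x u (c • v) = c • covDerivEnd I A x u v := by
  have hv := mdifferentiableAt_extend I E v
  have hc : MDiffAt (fun _ : M => c) x := mdifferentiableAt_const
  have h := covDerivEnd_apply hA (hc.smul_section hv) u
  have h2 : leviCivita I ((fun _ : M => c) • extend E v) x u = _ := leviCivita_smul hc hv u
  have h3 := leviCivita_smul (u := u) hc (hA _ hv)
  simp only [Pi.smul_apply', extend_apply_self, map_smul] at h
  rw [h, h2, h3]
  simp [covDerivEnd, smul_sub]

/-- The covariant derivative of a field of endomorphisms at a point, as a bilinear map. -/
def covDerivEndBilin :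
    TangentSpace I x →ₗ[ℝ] TangentSpace I x →ₗ[ℝ] TangentSpace I x :=
  LinearMap.mk₂ ℝ (covDerivEnd I A x) (covDerivEnd_add_left hA) (covDerivEnd_smul_left hA)
    (covDerivEnd_add_right hA) (covDerivEnd_smul_right hA)

theorem mvfderiv_inner_endomorphism (u v w : TangentSpace I x) :
    mvfderiv I (fun q => inner ℝ (extend E v q : TangentSpace I q) (A q (extend E w q))) x u
      = inner ℝ v (covDerivEnd I A x u w) + inner ℝ (leviCivita I (extend E v) x u) (A x w)
        + inner ℝ v (A x (leviCivita I (extend E w) x u)) := by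
  have hv := mdifferentiableAt_extend I E v
  have hw := mdifferentiableAt_extend I E w
  rw [mvfderiv_inner hv (hA _ hw) u, covDerivEnd, extend_apply_self, extend_apply_self,
    inner_sub_right]
  ring

end

/-- If `(∇_u α)(v, w) = T u v w`, then `3 dα` is the cyclic sum of `T`: the Lie brackets of the
extensions vanish, and the terms with `∇` cancel because the connection has no torsion. -/
theorem three_mul_extDerivTwo {α : ∀ q : M, TangentSpace I q → TangentSpace I q → ℝ} {x : M}
    {T : TangentSpace I x → TangentSpace I x → TangentSpace I x → ℝ}
    (hzero : ∀ v, α x 0 v = 0) (hskew : ∀ v w, α x v w = -α x w v)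
    (h : ∀ u v w, mvfderiv I (fun q => α q (extend E v q) (extend E w q)) x u
      = T u v w + α x (leviCivita I (extend E v) x u) w + α x v (leviCivita I (extend E w) x u))
    (u v w : TangentSpace I x) :
    3 * extDerivTwo I α x u v w = T u v w + T v w u + T w u v := by
  simp only [extDerivTwo]
  rw [h, h, h, mlieBracket_extend, mlieBracket_extend, mlieBracket_extend, hzero, hzero, hzero,
    leviCivita_extend_symm u w, leviCivita_extend_symm u v, leviCivita_extend_symm v w]
  have h1 := hskew v (leviCivita I (extend E u) x w)
  have h2 := hskew w (leviCivita I (extend E u) x v)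
  have h3 := hskew u (leviCivita I (extend E v) x w)
  linarith

end EndomorphismFields

/-! ### The covariant derivative of the induced f-structure -/

section DerivativeOfF

variable {E : Type*} [NormedAddCommGroup E] [NormedSpace ℝ E] [FiniteDimensional ℝ E]
  {H : Type*} [TopologicalSpace H] {I : ModelWithCorners ℝ E H}
  {M : Type*} [TopologicalSpace M] [ChartedSpace H M] [IsManifold I ∞ M]
  {E' : Type*} [NormedAddCommGroup E'] [NormedSpace ℝ E'] [FiniteDimensional ℝ E']
  {H' : Type*} [TopologicalSpace H'] {I' : ModelWithCorners ℝ E' H'}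
  {N : Type*} [TopologicalSpace N] [ChartedSpace H' N] [IsManifold I' ∞ N]
  [RiemannianBundle (fun x : M => TangentSpace I x)]
  [IsContMDiffRiemannianBundle I ∞ E (fun x : M => TangentSpace I x)]
  [RiemannianBundle (fun y : N => TangentSpace I' y)]
  [IsContMDiffRiemannianBundle I' ∞ E' (fun y : N => TangentSpace I' y)]

theorem covDerivEnd_fStructure_apply (𝒥 : AlmostHermitian I' N) {φ : M → N}
    (hφ : ContMDiff I I' ∞ φ) {x : M} (hx : x ∈ regularSet I I' φ)
    {Y : ∀ q : M, TangentSpace I q} (hY : MDiffAt (T% Y) x) (u : TangentSpace I x) :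
    covDerivEnd I (fStructure I 𝒥 φ) x u (Y x)
      = leviCivita I (fun q => fStructure I 𝒥 φ q (Y q)) x u
        - fStructure I 𝒥 φ x (leviCivita I Y x u) :=
  covDerivEnd_apply (fun _ => mdifferentiableAt_fStructure 𝒥 hφ hx) hY u

/-- The covariant derivative of the induced `f`-structure at a regular point, as a bilinear map. -/
def nablaF (𝒥 : AlmostHermitian I' N) {φ : M → N}
    (hφ : ContMDiff I I' ∞ φ) {x : M} (hx : x ∈ regularSet I I' φ) :
    TangentSpace I x →ₗ[ℝ] TangentSpace I x →ₗ[ℝ] TangentSpace I x :=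
  covDerivEndBilin fun _ => mdifferentiableAt_fStructure 𝒥 hφ hx

theorem nablaF_apply (𝒥 : AlmostHermitian I' N) {φ : M → N}
    (hφ : ContMDiff I I' ∞ φ) {x : M} (hx : x ∈ regularSet I I' φ) (u v : TangentSpace I x) :
    nablaF 𝒥 hφ hx u v = covDerivEnd I (fStructure I 𝒥 φ) x u v := rfl

theorem phiForm_skew {𝒥 : AlmostHermitian I' N} {φ : M → N} (hJ : IsPHWC I 𝒥 φ) {x : M}
    (hx : x ∈ regularSet I I' φ) (v w : TangentSpace I x) :
    phiForm I 𝒥 φ x v w = -phiForm I 𝒥 φ x w v := by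
  rw [phiForm, phiForm, real_inner_comm, inner_fStructure_left hJ hx]

theorem pullbackOmega_skew (𝒥 : AlmostHermitian I' N) {φ : M → N} {x : M}
    (v w : TangentSpace I x) : pullbackOmega I 𝒥 φ x v w = -pullbackOmega I 𝒥 φ x w v := by
  rw [pullbackOmega, pullbackOmega, real_inner_comm, inner_J_left]

theorem mvfderiv_phiForm (𝒥 : AlmostHermitian I' N) {φ : M → N}
    (hφ : ContMDiff I I' ∞ φ) {x : M} (hx : x ∈ regularSet I I' φ) (u v w : TangentSpace I x) :
    mvfderiv I (fun q => phiForm I 𝒥 φ q (extend E v q) (extend E w q)) x u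
      = inner ℝ v (nablaF 𝒥 hφ hx u w) + phiForm I 𝒥 φ x (leviCivita I (extend E v) x u) w
        + phiForm I 𝒥 φ x v (leviCivita I (extend E w) x u) :=
  mvfderiv_inner_endomorphism (fun _ => mdifferentiableAt_fStructure 𝒥 hφ hx) u v w

theorem three_mul_extDerivTwo_phiForm {𝒥 : AlmostHermitian I' N} {φ : M → N}
    (hφ : ContMDiff I I' ∞ φ) (hJ : IsPHWC I 𝒥 φ) {x : M} (hx : x ∈ regularSet I I' φ)
    (u v w : TangentSpace I x) :
    3 * extDerivTwo I (phiForm I 𝒥 φ) x u v w = inner ℝ v (nablaF 𝒥 hφ hx u w)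
      + inner ℝ w (nablaF 𝒥 hφ hx v u) + inner ℝ u (nablaF 𝒥 hφ hx w v) :=
  three_mul_extDerivTwo (T := fun u v w => inner ℝ v (nablaF 𝒥 hφ hx u w))
    (fun _ => inner_zero_left _) (phiForm_skew hJ hx) (mvfderiv_phiForm 𝒥 hφ hx) u v w

/-- The covariant derivative of the induced `f`-structure is skew-symmetric. -/
theorem inner_nablaF_left {𝒥 : AlmostHermitian I' N} {φ : M → N}
    (hφ : ContMDiff I I' ∞ φ) (hJ : IsPHWC I 𝒥 φ) {x : M} (hx : x ∈ regularSet I I' φ)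
    (u v w : TangentSpace I x) :
    inner ℝ (nablaF 𝒥 hφ hx u v) w = -inner ℝ v (nablaF 𝒥 hφ hx u w) := by
  have h1 := mvfderiv_phiForm 𝒥 hφ hx u v w
  have h2 := mvfderiv_phiForm 𝒥 hφ hx u w v
  have h3 : mvfderiv I (fun q => phiForm I 𝒥 φ q (extend E v q) (extend E w q)) x
      = mvfderiv I (fun q => -phiForm I 𝒥 φ q (extend E w q) (extend E v q)) x := by
    refine mvfderiv_congr ?_
    filter_upwards [eventually_mem_regularSet hφ hx] with q hq
    exact phiForm_skew hJ hq _ _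
  have h4 : mvfderiv I (fun q => -phiForm I 𝒥 φ q (extend E w q) (extend E v q)) x
      = -mvfderiv I (fun q => phiForm I 𝒥 φ q (extend E w q) (extend E v q)) x := mvfderiv_fun_neg
  have h5 : -mvfderiv I (fun q => phiForm I 𝒥 φ q (extend E w q) (extend E v q)) x u = _ :=
    congrArg (fun f : TangentSpace I x →L[ℝ] ℝ => f u) (h3.trans h4).symm
  rw [h1, h2, phiForm_skew hJ hx v, phiForm_skew hJ hx (leviCivita I (extend E v) x u),
    real_inner_comm] at h5
  linarith

/-- `F³ + F = 0`, differentiated: `dφ` annihilates `(∇_u F) F + F (∇_u F)` on horizontal vectors. -/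
theorem tangentMap_nablaF_fStructure (𝒥 : AlmostHermitian I' N) {φ : M → N}
    (hφ : ContMDiff I I' ∞ φ) {x : M} (hx : x ∈ regularSet I I' φ) (u : TangentSpace I x)
    {v : TangentSpace I x} (hv : v ∈ horizontal I I' φ x) :
    tangentMap I I' φ x (nablaF 𝒥 hφ hx u (fStructure I 𝒥 φ x v))
      = -tangentMap I I' φ x (fStructure I 𝒥 φ x (nablaF 𝒥 hφ hx u v)) := by
  have d0 := mdifferentiableAt_extend I E v
  have d1 := mdifferentiableAt_fStructure 𝒥 hφ hx d0
  have d2 := mdifferentiableAt_fStructure 𝒥 hφ hx d1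
  have h0 := covDerivEnd_fStructure_apply 𝒥 hφ hx d0 u
  have h1 := covDerivEnd_fStructure_apply 𝒥 hφ hx d1 u
  have h2 := covDerivEnd_fStructure_apply 𝒥 hφ hx d2 u
  have h3 : leviCivita I (fun q => fStructure I 𝒥 φ q (fStructure I 𝒥 φ q (fStructure I 𝒥 φ q
      (extend E v q)))) x u = leviCivita I (fun q => (-1 : ℝ) • fStructure I 𝒥 φ q (extend E v q))
        x u := by
    refine leviCivita_congr ?_ u
    filter_upwards [eventually_mem_regularSet hφ hx] with q hq
    rw [neg_one_smul]
    exact eq_neg_of_add_eq_zero_left (fStructure_cube I 𝒥 hq _)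
  rw [leviCivita_smul (f := fun _ : M => (-1 : ℝ)) mdifferentiableAt_const d1, mvfderiv_const] at h3
  simp only [extend_apply_self, zero_apply, zero_smul, zero_add, neg_smul, one_smul] at h0 h1 h2 h3
  rw [fStructure_fStructure 𝒥 hx hv] at h2
  have h4 : covDerivEnd I (fStructure I 𝒥 φ) x u (-v) = -covDerivEnd I (fStructure I 𝒥 φ) x u v :=
    (nablaF 𝒥 hφ hx u).map_neg v
  have e0 := congrArg (fun z => fStructure I 𝒥 φ x (fStructure I 𝒥 φ x z)) h0
  have e1 := congrArg (fun z => fStructure I 𝒥 φ x z) h1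
  have e3 := fStructure_cube I 𝒥 hx (leviCivita I (extend E v) x u)
  simp only [map_sub] at e0 e1
  have key : fStructure I 𝒥 φ x (covDerivEnd I (fStructure I 𝒥 φ) x u (fStructure I 𝒥 φ x v)
      + fStructure I 𝒥 φ x (covDerivEnd I (fStructure I 𝒥 φ) x u v)) = 0 := by
    rw [map_add, e1, e0, eq_neg_of_add_eq_zero_left e3]
    rw [h4, h3, h0, eq_sub_iff_add_eq, neg_add_eq_iff_eq_add] at h2
    rw [h2]
    abel
  have h5 := congrArg (tangentMap I I' φ x) key
  rw [tangentMap_fStructure I 𝒥 hx, map_zero] at h5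
  have h6 := congrArg (𝒥.J (φ x)) h5
  rw [𝒥.sq, map_zero, neg_eq_zero, map_add] at h6
  exact eq_neg_of_add_eq_zero_left h6

end DerivativeOfF

/-! ### The derivative of the pulled-back fundamental form, and the mean curvature -/

section Omega

variable {E : Type*} [NormedAddCommGroup E] [NormedSpace ℝ E] [FiniteDimensional ℝ E]
  {H : Type*} [TopologicalSpace H] {I : ModelWithCorners ℝ E H}
  {M : Type*} [TopologicalSpace M] [ChartedSpace H M] [IsManifold I ∞ M]
  {E' : Type*} [NormedAddCommGroup E'] [NormedSpace ℝ E'] [FiniteDimensional ℝ E']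
  {H' : Type*} [TopologicalSpace H'] {I' : ModelWithCorners ℝ E' H'}
  {N : Type*} [TopologicalSpace N] [ChartedSpace H' N] [IsManifold I' ∞ N]
  [RiemannianBundle (fun x : M => TangentSpace I x)]
  [IsContMDiffRiemannianBundle I ∞ E (fun x : M => TangentSpace I x)]
  [RiemannianBundle (fun y : N => TangentSpace I' y)]
  [IsContMDiffRiemannianBundle I' ∞ E' (fun y : N => TangentSpace I' y)]

theorem hessian_apply {φ : M → N} (hφ : ContMDiff I I' ∞ φ) (x : M) (u v : TangentSpace I x) :
    hessian hφ x u v = secondFundamentalForm I I' φ x u v := rfl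

/-- The covariant derivative `(∇_u φ^*Ω)(v, w)` of the pull-back of the fundamental form at a
regular point, obtained from `φ^*Ω = h(dφ ·, dφ F ·)` by the product rule. -/
def nablaPullbackOmega (𝒥 : AlmostHermitian I' N) {φ : M → N}
    (hφ : ContMDiff I I' ∞ φ) {x : M} (hx : x ∈ regularSet I I' φ) (u v w : TangentSpace I x) : ℝ :=
  inner ℝ (hessian hφ x u v) (tangentMap I I' φ x (fStructure I 𝒥 φ x w))
    + inner ℝ (tangentMap I I' φ x v) (hessian hφ x u (fStructure I 𝒥 φ x w))
    + inner ℝ (tangentMap I I' φ x v) (tangentMap I I' φ x (nablaF 𝒥 hφ hx u w))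

theorem mvfderiv_pullbackOmega (𝒥 : AlmostHermitian I' N) {φ : M → N}
    (hφ : ContMDiff I I' ∞ φ) {x : M} (hx : x ∈ regularSet I I' φ) (u v w : TangentSpace I x) :
    mvfderiv I (fun q => pullbackOmega I 𝒥 φ q (extend E v q) (extend E w q)) x u
      = nablaPullbackOmega 𝒥 hφ hx u v w
        + pullbackOmega I 𝒥 φ x (leviCivita I (extend E v) x u) w
        + pullbackOmega I 𝒥 φ x v (leviCivita I (extend E w) x u) := by
  have hv := mdifferentiableAt_extend I E v
  have hw := mdifferentiableAt_extend I E w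
  have hFw := mdifferentiableAt_fStructure 𝒥 hφ hx hw
  have h1 : mvfderiv I (fun q => pullbackOmega I 𝒥 φ q (extend E v q) (extend E w q)) x
      = mvfderiv I (fun q => inner ℝ (tangentMap I I' φ q (extend E v q))
          (tangentMap I I' φ q (fStructure I 𝒥 φ q (extend E w q)))) x := by
    refine mvfderiv_congr ?_
    filter_upwards [eventually_mem_regularSet hφ hx] with q hq
    rw [pullbackOmega, tangentMap_fStructure I 𝒥 hq]
  have h2 := covDerivEnd_fStructure_apply 𝒥 hφ hx hw u
  rw [extend_apply_self, ← nablaF_apply 𝒥 hφ hx] at h2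
  rw [h1, mvfderiv_inner_along (MDiffAlong.tangentMap hφ hv) (MDiffAlong.tangentMap hφ hFw),
    pullbackConnection_tangentMap hφ hv, pullbackConnection_tangentMap hφ hFw,
    ← add_eq_of_eq_sub h2, nablaPullbackOmega, pullbackOmega, pullbackOmega, hessian_apply,
    hessian_apply]
  simp only [extend_apply_self, map_add, inner_add_left, inner_add_right,
    tangentMap_fStructure I 𝒥 hx]
  ring

theorem three_mul_extDerivTwo_pullbackOmega (𝒥 : AlmostHermitian I' N) {φ : M → N}
    (hφ : ContMDiff I I' ∞ φ) {x : M} (hx : x ∈ regularSet I I' φ) (u v w : TangentSpace I x) :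
    3 * extDerivTwo I (pullbackOmega I 𝒥 φ) x u v w = nablaPullbackOmega 𝒥 hφ hx u v w
      + nablaPullbackOmega 𝒥 hφ hx v w u + nablaPullbackOmega 𝒥 hφ hx w u v := by
  refine three_mul_extDerivTwo (T := nablaPullbackOmega 𝒥 hφ hx) (fun v => ?_)
    (pullbackOmega_skew 𝒥) (mvfderiv_pullbackOmega 𝒥 hφ hx) u v w
  rw [pullbackOmega, map_zero, inner_zero_left]

theorem nablaPullbackOmega_skew (𝒥 : AlmostHermitian I' N) {φ : M → N}
    (hφ : ContMDiff I I' ∞ φ) {x : M} (hx : x ∈ regularSet I I' φ) (u v w : TangentSpace I x) :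
    nablaPullbackOmega 𝒥 hφ hx u v w = -nablaPullbackOmega 𝒥 hφ hx u w v := by
  have h1 := mvfderiv_pullbackOmega 𝒥 hφ hx u v w
  have h2 := mvfderiv_pullbackOmega 𝒥 hφ hx u w v
  have h3 : mvfderiv I (fun q => pullbackOmega I 𝒥 φ q (extend E v q) (extend E w q)) x
      = mvfderiv I (fun q => -pullbackOmega I 𝒥 φ q (extend E w q) (extend E v q)) x :=
    mvfderiv_congr (Eventually.of_forall fun q => pullbackOmega_skew 𝒥 _ _)
  have h4 : mvfderiv I (fun q => -pullbackOmega I 𝒥 φ q (extend E w q) (extend E v q)) x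
      = -mvfderiv I (fun q => pullbackOmega I 𝒥 φ q (extend E w q) (extend E v q)) x :=
    mvfderiv_fun_neg
  have h5 : -mvfderiv I (fun q => pullbackOmega I 𝒥 φ q (extend E w q) (extend E v q)) x u = _ :=
    congrArg (fun f : TangentSpace I x →L[ℝ] ℝ => f u) (h3.trans h4).symm
  rw [h1, h2, pullbackOmega_skew 𝒥 v, pullbackOmega_skew 𝒥 (leviCivita I (extend E v) x u)] at h5
  linarith

theorem pullbackConnection_zero {φ : M → N} {x : M} (hφ : MDiffAt φ x) (u : TangentSpace I x) :
    pullbackConnection I I' φ (fun q => (0 : TangentSpace I' (φ q))) x u = 0 := by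
  have h := pullbackConnection_smul (g := fun _ : M => (0 : ℝ)) mdifferentiableAt_const
    (mdiffAlong_comp (mdifferentiableAt_extend I' E' (0 : TangentSpace I' (φ x))) hφ) u
  rw [mvfderiv_const] at h
  simpa using h

/-- A vertical vector field `Y` with `Y x = e` satisfies `dφ Y = 0` near a regular point `x`, and
hence `0 = ∇^φ_e (dφ Y) = ∇dφ(e, e) + dφ (∇_e Y)`. -/
theorem tangentMap_leviCivita_vertical (𝒥 : AlmostHermitian I' N) {φ : M → N}
    (hφ : ContMDiff I I' ∞ φ) {x : M} (hx : x ∈ regularSet I I' φ) {e : TangentSpace I x}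
    (he : e ∈ vertical I I' φ x) :
    tangentMap I I' φ x (leviCivita I (fun q => (vertical I I' φ q).starProjection
      (extend E e q)) x e) = -hessian hφ x e e := by
  have hd := mdifferentiableAt_extend I E e
  have hY := mdifferentiableAt_add_section hd (mdifferentiableAt_fStructure 𝒥 hφ hx
    (mdifferentiableAt_fStructure 𝒥 hφ hx hd))
  have h1 := pullbackConnection_tangentMap hφ hY e
  have hreg := eventually_mem_regularSet hφ hx
  rw [leviCivita_congr (hreg.mono fun q hq => starProjection_vertical 𝒥 hq (extend E e q)) e]
  have h2 : pullbackConnection I I' φ (fun q => tangentMap I I' φ q ((extend E e +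
      fun q => fStructure I 𝒥 φ q (fStructure I 𝒥 φ q (extend E e q))) q)) x e = 0 := by
    refine (pullbackConnection_congr (hreg.mono fun q hq => ?_) e).trans
      (pullbackConnection_zero (hφ.mdifferentiableAt (by simp)) e)
    rw [Pi.add_apply, map_add, tangentMap_fStructure I 𝒥 hq, tangentMap_fStructure I 𝒥 hq, 𝒥.sq,
      add_neg_cancel]
  rw [h2, Pi.add_apply, extend_apply_self,
    fStructure_eq_zero 𝒥 (show tangentMap I I' φ x e = 0 from he), map_zero, add_zero] at h1
  rw [hessian_apply]
  exact eq_neg_of_add_eq_zero_right h1.symm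

/-- `dφ` takes `(dim V) μ^V` to the negative of the vertical part of the trace of `∇dφ`. -/
theorem tangentMap_meanCurvatureVertical (𝒥 : AlmostHermitian I' N) {φ : M → N}
    (hφ : ContMDiff I I' ∞ φ) {x : M} (hx : x ∈ regularSet I I' φ) :
    (Module.finrank ℝ (vertical I I' φ x) : ℝ) •
        tangentMap I I' φ x (meanCurvatureVertical I I' φ x)
      = -∑ a, hessian hφ x (stdOrthonormalBasis ℝ (vertical I I' φ x) a : TangentSpace I x)
          (stdOrthonormalBasis ℝ (vertical I I' φ x) a : TangentSpace I x) := by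
  have hproj : ∀ z, tangentMap I I' φ x ((horizontal I I' φ x).starProjection z)
      = tangentMap I I' φ x z := fun z => by
    have h2 : tangentMap I I' φ x ((vertical I I' φ x).starProjection z) = 0 :=
      Submodule.starProjection_apply_mem (vertical I I' φ x) z
    rw [horizontal, Submodule.starProjection_orthogonal_val, map_sub, h2, sub_zero]
  rw [meanCurvatureVertical, map_smul, map_sum, ← Finset.sum_neg_distrib]
  simp only [hproj, tangentMap_leviCivita_vertical 𝒥 hφ hx (Subtype.mem _)]
  rcases Nat.eq_zero_or_pos (Module.finrank ℝ (vertical I I' φ x)) with h0 | h0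
  · have : IsEmpty (Fin (Module.finrank ℝ (vertical I I' φ x))) := by rw [h0]; infer_instance
    simp
  · rw [smul_smul, mul_inv_cancel₀ (by positivity), one_smul]

end Omega

/-! ### Traces and adapted frames -/

section Traces

variable {V W : Type*} [NormedAddCommGroup V] [InnerProductSpace ℝ V] [FiniteDimensional ℝ V]
  [AddCommGroup W] [Module ℝ W]

/-- The trace of a bilinear map with respect to the inner product does not depend on the
orthonormal basis. -/
theorem sum_orthonormalBasis_eq {ι κ : Type*} [Fintype ι] [Fintype κ] (b : OrthonormalBasis ι ℝ V)
    (c : OrthonormalBasis κ ℝ V) (B : V →ₗ[ℝ] V →ₗ[ℝ] W) :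
    ∑ i, B (b i) (b i) = ∑ k, B (c k) (c k) := by
  have h := (InnerProductSpace.canonicalCovariantTensor_eq_sum V b).symm.trans
    (InnerProductSpace.canonicalCovariantTensor_eq_sum V c)
  simpa using congrArg (TensorProduct.lift B) h

theorem orthonormal_sumElim {ι κ : Type*} {v : ι → V} {w : κ → V} (hv : Orthonormal ℝ v)
    (hw : Orthonormal ℝ w) (h : ∀ i k, inner ℝ (v i) (w k) = 0) : Orthonormal ℝ (Sum.elim v w) := by
  refine ⟨fun i => ?_, fun i j hij => ?_⟩
  · cases i with
    | inl i => exact hv.1 i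
    | inr i => exact hw.1 i
  · rcases i with i | i <;> rcases j with j | j
    · exact hv.2 fun e => hij (by rw [e])
    · exact h i j
    · exact (real_inner_comm _ _).trans (h j i)
    · exact hw.2 fun e => hij (by rw [e])

/-- An orthonormal family with as many members as the dimension, as an orthonormal basis. -/
def orthonormalBasisOfCard {ι : Type*} [Fintype ι] {v : ι → V} (hv : Orthonormal ℝ v)
    (hc : Fintype.card ι = Module.finrank ℝ V) : OrthonormalBasis ι ℝ V :=
  OrthonormalBasis.mk hv (hv.linearIndependent.span_eq_top_of_card_eq_finrank' hc).ge

theorem orthonormalBasisOfCard_apply {ι : Type*} [Fintype ι] {v : ι → V} (hv : Orthonormal ℝ v)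
    (hc : Fintype.card ι = Module.finrank ℝ V) (i : ι) : orthonormalBasisOfCard hv hc i = v i := by
  rw [orthonormalBasisOfCard, OrthonormalBasis.coe_mk]

end Traces

section Frames

variable {E : Type*} [NormedAddCommGroup E] [NormedSpace ℝ E] [FiniteDimensional ℝ E]
  {H : Type*} [TopologicalSpace H] {I : ModelWithCorners ℝ E H}
  {M : Type*} [TopologicalSpace M] [ChartedSpace H M] [IsManifold I ∞ M]
  {E' : Type*} [NormedAddCommGroup E'] [NormedSpace ℝ E'] [FiniteDimensional ℝ E']
  {H' : Type*} [TopologicalSpace H'] {I' : ModelWithCorners ℝ E' H'}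
  {N : Type*} [TopologicalSpace N] [ChartedSpace H' N] [IsManifold I' ∞ N]
  [RiemannianBundle (fun x : M => TangentSpace I x)]
  [RiemannianBundle (fun y : N => TangentSpace I' y)]

theorem finrank_vertical_add {φ : M → N} {x : M} (hx : x ∈ regularSet I I' φ) :
    Module.finrank ℝ (vertical I I' φ x) + Module.finrank ℝ E' = Module.finrank ℝ E := by
  have h := LinearMap.finrank_range_add_finrank_ker (tangentMap I I' φ x)
  rw [LinearMap.range_eq_top.2 hx, finrank_top, add_comm] at h
  exact h

theorem finrank_horizontal {φ : M → N} {x : M} (hx : x ∈ regularSet I I' φ) :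
    Module.finrank ℝ (horizontal I I' φ x) = Module.finrank ℝ E' := by
  have h := Submodule.finrank_add_finrank_orthogonal (vertical I I' φ x)
  have h1 := finrank_vertical_add hx
  have h2 : Module.finrank ℝ (TangentSpace I x) = Module.finrank ℝ E := rfl
  rw [horizontal]
  omega

variable {n : ℕ} {𝒥 : AlmostHermitian I' N} {φ : M → N} {x : M} (b : AdaptedFrame I n 𝒥 φ x)

namespace AdaptedFrame

/-- The `2n` vectors `E_1, …, E_n, FE_1, …, FE_n` of an adapted frame. -/
def all : Fin n ⊕ Fin n → TangentSpace I x :=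
  Sum.elim b.vec fun i => fStructure I 𝒥 φ x (b.vec i)

theorem all_mem (i : Fin n ⊕ Fin n) : b.all i ∈ horizontal I I' φ x := by
  rcases i with i | i
  · exact b.vec_mem i
  · exact fStructure_mem_horizontal 𝒥 _

theorem sum_all {W : Type*} [AddCommMonoid W] (f : TangentSpace I x → W) :
    ∑ i, f (b.all i) = ∑ i, (f (b.vec i) + f (fStructure I 𝒥 φ x (b.vec i))) := by
  rw [Fintype.sum_sum_type, Finset.sum_add_distrib]
  rfl

/-- An adapted frame is an orthonormal basis of the horizontal space. -/
def horizontalBasis (hd : Module.finrank ℝ E' = 2 * n) (hx : x ∈ regularSet I I' φ) :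
    OrthonormalBasis (Fin n ⊕ Fin n) ℝ (horizontal I I' φ x) :=
  orthonormalBasisOfCard (v := fun i => ⟨b.all i, b.all_mem i⟩)
    ((horizontal I I' φ x).subtypeₗᵢ.orthonormal_comp_iff.1 b.orthonormal)
    (by rw [finrank_horizontal hx, hd]; simp; ring)

/-- An adapted frame together with an orthonormal basis of the vertical space. -/
def fullBasis (hd : Module.finrank ℝ E' = 2 * n) (hx : x ∈ regularSet I I' φ) :
    OrthonormalBasis (Fin (Module.finrank ℝ (vertical I I' φ x)) ⊕ (Fin n ⊕ Fin n)) ℝ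
      (TangentSpace I x) :=
  orthonormalBasisOfCard (v := Sum.elim
      (fun a => (stdOrthonormalBasis ℝ (vertical I I' φ x) a : TangentSpace I x)) b.all)
    (orthonormal_sumElim ((vertical I I' φ x).subtypeₗᵢ.orthonormal_comp_iff.2
      (stdOrthonormalBasis ℝ (vertical I I' φ x)).orthonormal) b.orthonormal
      fun a i => Submodule.inner_right_of_mem_orthogonal (Subtype.mem _) (b.all_mem i))
    (by
      have h1 := finrank_vertical_add hx
      have h2 : Module.finrank ℝ (TangentSpace I x) = Module.finrank ℝ E := rfl
      simp
      omega)

theorem sum_horizontal (hd : Module.finrank ℝ E' = 2 * n) (hx : x ∈ regularSet I I' φ)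
    {W : Type*} [AddCommGroup W] [Module ℝ W]
    (B : TangentSpace I x →ₗ[ℝ] TangentSpace I x →ₗ[ℝ] W) :
    ∑ a, B (stdOrthonormalBasis ℝ (horizontal I I' φ x) a : TangentSpace I x)
        (stdOrthonormalBasis ℝ (horizontal I I' φ x) a : TangentSpace I x)
      = ∑ i, B (b.all i) (b.all i) := by
  have h := sum_orthonormalBasis_eq (stdOrthonormalBasis ℝ (horizontal I I' φ x))
    (b.horizontalBasis hd hx) (B.domRestrict₁₂ (horizontal I I' φ x) (horizontal I I' φ x))
  simpa only [LinearMap.domRestrict₁₂_apply, horizontalBasis, orthonormalBasisOfCard_apply] using h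

theorem sum_full (hd : Module.finrank ℝ E' = 2 * n) (hx : x ∈ regularSet I I' φ)
    {W : Type*} [AddCommGroup W] [Module ℝ W]
    (B : TangentSpace I x →ₗ[ℝ] TangentSpace I x →ₗ[ℝ] W) :
    ∑ a, B (stdOrthonormalBasis ℝ (TangentSpace I x) a) (stdOrthonormalBasis ℝ (TangentSpace I x) a)
      = ∑ a, B (stdOrthonormalBasis ℝ (vertical I I' φ x) a : TangentSpace I x)
          (stdOrthonormalBasis ℝ (vertical I I' φ x) a : TangentSpace I x)
        + ∑ i, B (b.all i) (b.all i) := by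
  have h := sum_orthonormalBasis_eq (stdOrthonormalBasis ℝ (TangentSpace I x))
    (b.fullBasis hd hx) B
  simpa only [fullBasis, orthonormalBasisOfCard_apply, Fintype.sum_sum_type, Sum.elim_inl,
    Sum.elim_inr] using h

/-- The images under `dφ` of the vectors of an adapted frame span the tangent space of `N`. -/
theorem eq_zero_of_inner_all (hd : Module.finrank ℝ E' = 2 * n) (hx : x ∈ regularSet I I' φ)
    {τ : TangentSpace I' (φ x)} (h : ∀ i, inner ℝ (tangentMap I I' φ x (b.all i)) τ = 0) :
    τ = 0 := by
  obtain ⟨z, hz⟩ := hx τ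
  rw [← inner_self_eq_zero (𝕜 := ℝ)]
  nth_rewrite 1 [← hz]
  rw [← (b.fullBasis hd hx).sum_repr' z, map_sum, sum_inner]
  refine Finset.sum_eq_zero fun i _ => ?_
  rw [map_smul, real_inner_smul_left, fullBasis, orthonormalBasisOfCard_apply]
  rcases i with a | i
  · have : tangentMap I I' φ x
        (stdOrthonormalBasis ℝ (vertical I I' φ x) a : TangentSpace I x) = 0 :=
      (stdOrthonormalBasis ℝ (vertical I I' φ x) a).2
    rw [Sum.elim_inl, this, inner_zero_left, mul_zero]
  · rw [Sum.elim_inr, h, mul_zero]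

end AdaptedFrame

end Frames

/-! ### The tension field in terms of exterior derivatives -/

section Identity

variable {E : Type*} [NormedAddCommGroup E] [NormedSpace ℝ E] [FiniteDimensional ℝ E]
  {H : Type*} [TopologicalSpace H] {I : ModelWithCorners ℝ E H}
  {M : Type*} [TopologicalSpace M] [ChartedSpace H M] [IsManifold I ∞ M]
  {E' : Type*} [NormedAddCommGroup E'] [NormedSpace ℝ E'] [FiniteDimensional ℝ E']
  {H' : Type*} [TopologicalSpace H'] {I' : ModelWithCorners ℝ E' H'}
  {N : Type*} [TopologicalSpace N] [ChartedSpace H' N] [IsManifold I' ∞ N]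
  [RiemannianBundle (fun x : M => TangentSpace I x)]
  [IsContMDiffRiemannianBundle I ∞ E (fun x : M => TangentSpace I x)]
  [RiemannianBundle (fun y : N => TangentSpace I' y)]
  [IsContMDiffRiemannianBundle I' ∞ E' (fun y : N => TangentSpace I' y)]

variable {𝒥 : AlmostHermitian I' N} {φ : M → N} (hφ : ContMDiff I I' ∞ φ) {x : M}
  (hx : x ∈ regularSet I I' φ)

/-- Inner products with a horizontal vector depend only on the image under `dφ`. -/
theorem inner_eq_of_tangentMap_eq {w z z' : TangentSpace I x} (hw : w ∈ horizontal I I' φ x)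
    (h : tangentMap I I' φ x z = tangentMap I I' φ x z') : inner ℝ z w = inner ℝ z' w := by
  rw [← sub_eq_zero, ← inner_sub_left]
  refine Submodule.inner_right_of_mem_orthogonal (K := vertical I I' φ x) ?_ hw
  change tangentMap I I' φ x _ = 0
  rw [map_sub, h, sub_self]

/-- `g((∇_w F) Fe, e)` is both symmetric and skew-symmetric under exchange of `e` and `Fe`, by
`(∇_w F) F = -F (∇_w F)` and by the skew-symmetry of `∇_w F`, and so vanishes. -/
theorem inner_nablaF_fStructure_self (hJ : IsPHWC I 𝒥 φ) {e : TangentSpace I x}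
    (he : e ∈ horizontal I I' φ x) (w : TangentSpace I x) :
    inner ℝ (nablaF 𝒥 hφ hx w (fStructure I 𝒥 φ x e)) e = 0 := by
  have h1 : inner ℝ (nablaF 𝒥 hφ hx w (fStructure I 𝒥 φ x e)) e
      = inner ℝ (-fStructure I 𝒥 φ x (nablaF 𝒥 hφ hx w e)) e :=
    inner_eq_of_tangentMap_eq he (by rw [map_neg, tangentMap_nablaF_fStructure 𝒥 hφ hx w he])
  rw [inner_neg_left, inner_fStructure_left hJ hx, neg_neg] at h1
  have h2 := inner_nablaF_left hφ hJ hx w e (fStructure I 𝒥 φ x e)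
  rw [real_inner_comm _ e] at h2
  linarith

/-- `(∇_{Fe} F) e - (∇_e F) Fe` and `F ((∇_e F) e + (∇_{Fe} F) Fe)` have the same image under
`dφ`. -/
theorem tangentMap_nablaF_sub {e : TangentSpace I x} (he : e ∈ horizontal I I' φ x) :
    tangentMap I I' φ x (nablaF 𝒥 hφ hx (fStructure I 𝒥 φ x e) e
        - nablaF 𝒥 hφ hx e (fStructure I 𝒥 φ x e))
      = tangentMap I I' φ x (fStructure I 𝒥 φ x (nablaF 𝒥 hφ hx e e
        + nablaF 𝒥 hφ hx (fStructure I 𝒥 φ x e) (fStructure I 𝒥 φ x e))) := by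
  have h1 := tangentMap_nablaF_fStructure 𝒥 hφ hx e he
  have h2 := tangentMap_nablaF_fStructure 𝒥 hφ hx (fStructure I 𝒥 φ x e)
    (fStructure_mem_horizontal 𝒥 e)
  rw [fStructure_fStructure 𝒥 hx he, map_neg, map_neg, neg_inj] at h2
  rw [map_sub, h1, h2, map_add, map_add, sub_neg_eq_add, add_comm]

/-- The exterior derivative of `φ^*Ω` on `e, Fe, w`, for eigenvectors `e`, `Fe` of `φ^*h` with the
same eigenvalue `c`. -/
theorem three_mul_extDerivTwo_pullbackOmega_eigen [I.Boundaryless] {e : TangentSpace I x}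
    (he : e ∈ horizontal I I' φ x) {c : ℝ}
    (h1 : ∀ w, inner ℝ (tangentMap I I' φ x e) (tangentMap I I' φ x w) = c * inner ℝ e w)
    (h2 : ∀ w, inner ℝ (tangentMap I I' φ x (fStructure I 𝒥 φ x e)) (tangentMap I I' φ x w)
      = c * inner ℝ (fStructure I 𝒥 φ x e) w) (hJ : IsPHWC I 𝒥 φ) (w : TangentSpace I x) :
    3 * extDerivTwo I (pullbackOmega I 𝒥 φ) x e (fStructure I 𝒥 φ x e) w
      = inner ℝ (tangentMap I I' φ x w) (hessian hφ x e e
          + hessian hφ x (fStructure I 𝒥 φ x e) (fStructure I 𝒥 φ x e)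
          + tangentMap I I' φ x (fStructure I 𝒥 φ x (nablaF 𝒥 hφ hx e e
            + nablaF 𝒥 hφ hx (fStructure I 𝒥 φ x e) (fStructure I 𝒥 φ x e)))) := by
  have hsymm : ∀ u v, hessian hφ x u v = hessian hφ x v u := fun u v =>
    secondFundamentalForm_symm hφ u v
  have hFF := fStructure_fStructure 𝒥 hx he
  -- the three terms of the cyclic sum, the first rewritten by skew-symmetry
  have t1 : nablaPullbackOmega 𝒥 hφ hx e (fStructure I 𝒥 φ x e) w
      = inner ℝ (tangentMap I I' φ x e) (hessian hφ x w e)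
        + inner ℝ (tangentMap I I' φ x w) (hessian hφ x e e)
        - inner ℝ (tangentMap I I' φ x w)
          (tangentMap I I' φ x (nablaF 𝒥 hφ hx e (fStructure I 𝒥 φ x e))) := by
    rw [nablaPullbackOmega_skew, nablaPullbackOmega, hFF, map_neg, map_neg, inner_neg_right,
      inner_neg_right, real_inner_comm, hsymm e w]
    ring
  have t2 : nablaPullbackOmega 𝒥 hφ hx (fStructure I 𝒥 φ x e) w e
      = inner ℝ (tangentMap I I' φ x (fStructure I 𝒥 φ x e))
          (hessian hφ x w (fStructure I 𝒥 φ x e))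
        + inner ℝ (tangentMap I I' φ x w)
          (hessian hφ x (fStructure I 𝒥 φ x e) (fStructure I 𝒥 φ x e))
        + inner ℝ (tangentMap I I' φ x w)
          (tangentMap I I' φ x (nablaF 𝒥 hφ hx (fStructure I 𝒥 φ x e) e)) := by
    rw [nablaPullbackOmega, real_inner_comm, hsymm _ w]
  have t3 : nablaPullbackOmega 𝒥 hφ hx w e (fStructure I 𝒥 φ x e)
      = -2 * inner ℝ (tangentMap I I' φ x e) (hessian hφ x w e) := by
    rw [nablaPullbackOmega, hFF, map_neg, map_neg, inner_neg_right, inner_neg_right, h1,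
      real_inner_comm _ e, inner_nablaF_fStructure_self hφ hx hJ he, real_inner_comm]
    ring
  have t4 : nablaPullbackOmega 𝒥 hφ hx w (fStructure I 𝒥 φ x e) e
      = 2 * inner ℝ (tangentMap I I' φ x (fStructure I 𝒥 φ x e))
          (hessian hφ x w (fStructure I 𝒥 φ x e)) := by
    have h3 := inner_nablaF_left hφ hJ hx w (fStructure I 𝒥 φ x e) e
    rw [inner_nablaF_fStructure_self hφ hx hJ he] at h3
    rw [nablaPullbackOmega, h2, neg_eq_zero.1 h3.symm, real_inner_comm _ (hessian hφ x w _)]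
    ring
  -- `(∇_w φ^*Ω)(e, Fe)` is half the difference of the last two values, which cancels the remaining
  -- terms with `∇dφ(w, ·)`
  have t5 := nablaPullbackOmega_skew 𝒥 hφ hx w e (fStructure I 𝒥 φ x e)
  have hsub := tangentMap_nablaF_sub (𝒥 := 𝒥) hφ hx he
  rw [three_mul_extDerivTwo_pullbackOmega 𝒥 hφ hx, t1, t2, ← hsub, map_sub, inner_add_right,
    inner_add_right, inner_sub_right]
  linarith

/-- The exterior derivative of `Φ` on `e, Fe, w`, for horizontal vectors `e`, `w`. -/
theorem three_mul_extDerivTwo_phiForm_eigen {e w : TangentSpace I x}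
    (he : e ∈ horizontal I I' φ x) (hw : w ∈ horizontal I I' φ x) (hJ : IsPHWC I 𝒥 φ) :
    3 * extDerivTwo I (phiForm I 𝒥 φ) x e (fStructure I 𝒥 φ x e) w
      = inner ℝ (fStructure I 𝒥 φ x (nablaF 𝒥 hφ hx e e
            + nablaF 𝒥 hφ hx (fStructure I 𝒥 φ x e) (fStructure I 𝒥 φ x e))) w := by
  rw [three_mul_extDerivTwo_phiForm hφ hJ hx,
    ← inner_eq_of_tangentMap_eq hw (tangentMap_nablaF_sub (𝒥 := 𝒥) hφ hx he), inner_sub_left,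
    real_inner_comm _ e, inner_nablaF_fStructure_self hφ hx hJ he,
    inner_nablaF_left hφ hJ hx e, real_inner_comm _ w]
  ring

variable {n : ℕ} (b : AdaptedFrame I n 𝒥 φ x) (hd : Module.finrank ℝ E' = 2 * n)

include hd hx

/-- `div^H F` in an adapted frame. -/
theorem divHorizontal_fStructure :
    divHorizontal I I' φ (fStructure I 𝒥 φ) x = ∑ i, (nablaF 𝒥 hφ hx (b.vec i) (b.vec i)
      + nablaF 𝒥 hφ hx (fStructure I 𝒥 φ x (b.vec i)) (fStructure I 𝒥 φ x (b.vec i))) :=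
  (b.sum_horizontal hd hx (nablaF 𝒥 hφ hx)).trans
    (b.sum_all fun v => nablaF 𝒥 hφ hx v v)

/-- The tension field is the horizontal trace of `∇dφ` minus the image of the mean curvature of
`V`. -/
theorem tensionField_eq {m : ℕ} (hm : Module.finrank ℝ E = m) :
    tensionField I I' φ x = ∑ i, (hessian hφ x (b.vec i) (b.vec i)
        + hessian hφ x (fStructure I 𝒥 φ x (b.vec i)) (fStructure I 𝒥 φ x (b.vec i)))
      - ((m : ℝ) - 2 * n) • tangentMap I I' φ x (meanCurvatureVertical I I' φ x) := by
  have h1 : tensionField I I' φ x = _ := b.sum_full hd hx (hessian hφ x)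
  have h2 := tangentMap_meanCurvatureVertical 𝒥 hφ hx
  have h3 := b.sum_all fun v => hessian hφ x v v
  have h4 : (Module.finrank ℝ (vertical I I' φ x) : ℝ) = (m : ℝ) - 2 * n := by
    have h5 := finrank_vertical_add hx
    rw [hd, hm] at h5
    rw [← h5]
    push_cast
    ring
  rw [h4] at h2
  rw [h1, h2, h3, sub_neg_eq_add, add_comm]

variable [I.Boundaryless] (hJ : IsPHWC I 𝒥 φ) {m : ℕ} (hm : Module.finrank ℝ E = m) {lam : ℝ}
  {w : TangentSpace I x}
  (hlam : ∀ v, inner ℝ (tangentMap I I' φ x w) (tangentMap I I' φ x v) = lam ^ 2 * inner ℝ w v)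
include hφ hJ hm hlam

theorem equationDivF_eq_inner_tensionField :
    equationDivF I m 𝒥 φ b lam w = inner ℝ (tangentMap I I' φ x w) (tensionField I I' φ x) := by
  rw [equationDivF, Finset.mul_sum, tensionField_eq hφ hx b hd hm, inner_sub_right,
    divHorizontal_fStructure hφ hx b hd, real_inner_comm w, ← hlam, map_add, map_smul, map_sum,
    map_sum, inner_add_right, inner_sum, inner_sum, ← sub_sub, ← Finset.sum_sub_distrib]
  congr 1
  refine Finset.sum_congr rfl fun i _ => ?_
  rw [three_mul_extDerivTwo_pullbackOmega_eigen hφ hx (b.vec_mem i) (b.eigen i) (b.eigen_F i) hJ,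
    inner_add_right]
  ring

theorem equationDPhi_eq_inner_tensionField (hw : w ∈ horizontal I I' φ x) :
    equationDPhi I m 𝒥 φ b lam w = inner ℝ (tangentMap I I' φ x w) (tensionField I I' φ x) := by
  have h1 : lam ^ 2 * ((m : ℝ) - 2 * n) * inner ℝ (meanCurvatureVertical I I' φ x) w
      = inner ℝ (tangentMap I I' φ x w)
        (((m : ℝ) - 2 * n) • tangentMap I I' φ x (meanCurvatureVertical I I' φ x)) := by
    rw [real_inner_smul_right, hlam, real_inner_comm w]
    ring
  rw [equationDPhi, Finset.mul_sum, tensionField_eq hφ hx b hd hm, inner_sub_right, h1, inner_sum]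
  congr 1
  refine Finset.sum_congr rfl fun i _ => ?_
  rw [mul_sub, three_mul_extDerivTwo_pullbackOmega_eigen hφ hx (b.vec_mem i) (b.eigen i)
    (b.eigen_F i) hJ, inner_add_right, hlam, mul_left_comm,
    three_mul_extDerivTwo_phiForm_eigen hφ hx (b.vec_mem i) hw hJ, real_inner_comm w]
  ring

end Identity

/-! ### Continuity of the Koszul expression -/

section Continuity

variable {E : Type*} [NormedAddCommGroup E] [NormedSpace ℝ E] [FiniteDimensional ℝ E]
  {H : Type*} [TopologicalSpace H] {I : ModelWithCorners ℝ E H}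
  {M : Type*} [TopologicalSpace M] [ChartedSpace H M] [IsManifold I ∞ M]
  [RiemannianBundle (fun x : M => TangentSpace I x)]
  [IsContMDiffRiemannianBundle I ∞ E (fun x : M => TangentSpace I x)]

theorem contMDiffAt_inner
    {EP : Type*} [NormedAddCommGroup EP] [NormedSpace ℝ EP] {HP : Type*} [TopologicalSpace HP]
    {IP : ModelWithCorners ℝ EP HP} {P : Type*} [TopologicalSpace P] [ChartedSpace HP P]
    {n : ℕ} {f : P → M} {V W : ∀ p : P, TangentSpace I (f p)} {p : P}
    (hV : ContMDiffAt IP I.tangent n (fun p => (⟨f p, V p⟩ : TangentBundle I M)) p)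
    (hW : ContMDiffAt IP I.tangent n (fun p => (⟨f p, W p⟩ : TangentBundle I M)) p) :
    ContMDiffAt IP 𝓘(ℝ, ℝ) n (fun p => inner ℝ (V p) (W p)) p := by
  have : IsContMDiffRiemannianBundle I n E (fun x : M => TangentSpace I x) :=
    IsContMDiffRiemannianBundle.of_le (n := ∞) (by exact_mod_cast le_top)
  exact ContMDiffAt.inner_bundle (IB := I) (F := E) (E := fun x : M => TangentSpace I x)
    (b := f) (v := V) (w := W) hV hW

theorem contMDiffAt_extend_nat (n : ℕ) {x : M} (v : TangentSpace I x) :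
    ContMDiffAt I I.tangent n (T% (extend E v : ∀ q : M, TangentSpace I q)) x := by
  have : IsManifold I ((n : ℕ∞ω) + 1) M :=
    IsManifold.of_le (n := ∞) (by exact_mod_cast le_top)
  exact contMDiffAt_extend I E v

omit [RiemannianBundle (fun x : M => TangentSpace I x)]
  [IsContMDiffRiemannianBundle I ∞ E (fun x : M => TangentSpace I x)] in
theorem continuousAt_mvfderiv_apply {g : M → ℝ} {x : M} (hg : ContMDiffAt I 𝓘(ℝ, ℝ) 1 g x)
    {X : ∀ q : M, TangentSpace I q}
    (hX : ContinuousAt (fun q => (⟨q, X q⟩ : TangentBundle I M)) x) :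
    ContinuousAt (fun q => mvfderiv I g q (X q)) x := by
  obtain ⟨u, hu, hxu, hgu⟩ : ∃ u, IsOpen u ∧ x ∈ u ∧ ContMDiffOn I 𝓘(ℝ, ℝ) 1 g u := by
    obtain ⟨u, hu, hgu⟩ := (contMDiffAt_iff_contMDiffOn_nhds (by simp)).1 hg
    obtain ⟨t, ht, hto, hxt⟩ := mem_nhds_iff.1 hu
    exact ⟨t, hto, hxt, hgu.mono ht⟩
  have h1 := hgu.continuousOn_tangentMapWithin le_rfl hu.uniqueMDiffOn
  have h2 : ContinuousAt (tangentMapWithin I 𝓘(ℝ, ℝ) g u) (⟨x, X x⟩ : TangentBundle I M) :=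
    h1.continuousAt ((hu.preimage (FiberBundle.continuous_proj E (TangentSpace I))).mem_nhds hxu)
  have h3 : ContinuousAt (fun q => (tangentMapWithin I 𝓘(ℝ, ℝ) g u ⟨q, X q⟩).2) x :=
    (contMDiff_snd_tangentBundle_modelSpace ℝ 𝓘(ℝ, ℝ) (n := 1)).continuous.continuousAt.comp
      (ContinuousAt.comp (f := fun q => (⟨q, X q⟩ : TangentBundle I M)) h2 hX)
  refine h3.congr ?_
  filter_upwards [hu.mem_nhds hxu] with q hq
  simp only [tangentMapWithin, mfderivWithin_of_isOpen hu hq]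
  rfl

theorem continuousAt_koszulForm {X Y Z : ∀ q : M, TangentSpace I q} {x : M}
    (hX : ContMDiffAt I I.tangent 2 (T% X) x) (hY : ContMDiffAt I I.tangent 2 (T% Y) x)
    (hZ : ContMDiffAt I I.tangent 2 (T% Z) x) : ContinuousAt (koszulForm I X Y Z) x := by
  have d : ∀ {V : ∀ q : M, TangentSpace I q}, ContMDiffAt I I.tangent 2 (T% V) x →
      ContMDiffAt I I.tangent ((1 : ℕ) : ℕ∞ω) (T% V) x := fun h => h.of_le (by norm_num)
  have : IsManifold I (minSmoothness ℝ 2) M := by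
    rw [minSmoothness_of_isRCLikeNormedField]; infer_instance
  have hb : ∀ {V W : ∀ q : M, TangentSpace I q}, ContMDiffAt I I.tangent 2 (T% V) x →
      ContMDiffAt I I.tangent 2 (T% W) x →
        ContMDiffAt I I.tangent ((1 : ℕ) : ℕ∞ω) (T% (mlieBracket I V W)) x := fun hV hW =>
    have : IsManifold I (((2 : ℕ∞) : ℕ∞ω) + 1) M :=
      IsManifold.of_le (n := ∞) (by exact_mod_cast le_top)
    ContMDiffAt.mlieBracket_vectorField (m := 1) (n := 2) hV hW (by
      rw [minSmoothness_of_isRCLikeNormedField]; norm_num)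
  have hm : ∀ {U V W : ∀ q : M, TangentSpace I q}, ContMDiffAt I I.tangent 2 (T% U) x →
      ContMDiffAt I I.tangent 2 (T% V) x → ContMDiffAt I I.tangent 2 (T% W) x →
      ContinuousAt (fun q => mvfderiv I (fun q => inner ℝ (V q) (W q)) q (U q)) x :=
    fun hU hV hW => continuousAt_mvfderiv_apply (contMDiffAt_inner (d hV) (d hW)) hU.continuousAt
  unfold koszulForm
  exact continuousAt_const.mul ((((((hm hX hY hZ).add (hm hY hX hZ)).sub (hm hZ hX hY)).add
    (contMDiffAt_inner (hb hX hY) (d hZ)).continuousAt).sub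
    (contMDiffAt_inner (hb hX hZ) (d hY)).continuousAt).sub
    (contMDiffAt_inner (hb hY hZ) (d hX)).continuousAt)

end Continuity

/-! ### The metric trace in coordinates -/

section DualBasis

variable {V W ι : Type*} [NormedAddCommGroup V] [InnerProductSpace ℝ V] [FiniteDimensional ℝ V]
  [AddCommGroup W] [Module ℝ W] [Fintype ι] [DecidableEq ι] (f : Module.Basis ι ℝ V) {s : ι → V}
  (h : ∀ i k, inner ℝ (s i) (f k) = if i = k then 1 else 0)
include h

theorem sum_inner_dual_smul (v : V) : ∑ i, inner ℝ (s i) v • f i = v := by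
  have : ∀ i, inner ℝ (s i) v = f.repr v i := fun i => by
    conv_lhs => rw [← f.sum_repr v, inner_sum]
    simp only [real_inner_smul_right, h, mul_ite, mul_one, mul_zero, Finset.sum_ite_eq,
      Finset.mem_univ, if_true]
  simp only [this, f.sum_repr]

theorem sum_inner_smul_dual (v : V) : ∑ i, inner ℝ v (f i) • s i = v := by
  refine ext_inner_right ℝ fun w => ?_
  conv_rhs => rw [← sum_inner_dual_smul f h w]
  simp only [inner_sum, sum_inner, real_inner_smul_left, real_inner_smul_right]
  exact Finset.sum_congr rfl fun i _ => mul_comm _ _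

/-- The trace of a bilinear map in terms of a basis `f` and the dual basis `s`. -/
theorem sum_orthonormalBasis_eq_sum_dual {κ : Type*} [Fintype κ] (o : OrthonormalBasis κ ℝ V)
    (B : V →ₗ[ℝ] V →ₗ[ℝ] W) : ∑ a, B (o a) (o a) = ∑ i, B (s i) (f i) := by
  have h1 : ∀ a, B (o a) (o a) = ∑ i, B (inner ℝ (s i) (o a) • o a) (f i) := fun a => by
    conv_lhs => enter [2]; rw [← sum_inner_dual_smul f h (o a)]
    simp
  have h2 : ∀ i, s i = ∑ a, inner ℝ (s i) (o a) • o a := fun i => by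
    simp only [real_inner_comm _ (s i)]
    exact (o.sum_repr' (s i)).symm
  simp only [h1]
  rw [Finset.sum_comm]
  refine Finset.sum_congr rfl fun i _ => ?_
  conv_rhs => rw [h2 i]
  simp

end DualBasis

section Frame

variable {E : Type*} [NormedAddCommGroup E] [NormedSpace ℝ E] [FiniteDimensional ℝ E]
  {H : Type*} [TopologicalSpace H] {I : ModelWithCorners ℝ E H}
  {M : Type*} [TopologicalSpace M] [ChartedSpace H M] [IsManifold I ∞ M]
  [RiemannianBundle (fun x : M => TangentSpace I x)]
  [IsContMDiffRiemannianBundle I ∞ E (fun x : M => TangentSpace I x)]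

variable (I) in
/-- The coordinate vector fields of the chart centred at `x`; away from the domain of the chart they
have the junk value of `extend`. -/
def coordField (x : M) (i : Fin (Module.finrank ℝ E)) : ∀ q : M, TangentSpace I q :=
  extend E ((trivializationAt E (TangentSpace I : M → Type _) x).symmL ℝ x
    (Module.finBasis ℝ E i))

variable (I) in
/-- The coefficients of the inverse of the metric in the chart centred at `x`. -/
def invMetric (x : M) (i j : Fin (Module.finrank ℝ E)) (q : M) : ℝ :=
  (Module.finBasis ℝ E).coord j ((metricInChart I x q).inverse
    (LinearMap.toContinuousLinearMap ((Module.finBasis ℝ E).coord i)))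

theorem continuousAt_invMetric (x : M) (i j : Fin (Module.finrank ℝ E)) :
    ContinuousAt (invMetric I x i j) x := by
  have h := (mdifferentiableAt_metricInChart_inverse (I := I) x).continuousAt
  exact (LinearMap.continuous_of_finiteDimensional _).continuousAt.comp
    (h.clm_apply continuousAt_const)

/-- Near `x` the coordinate fields form a basis, with the dual basis given by the inverse of the
metric. -/
theorem eventually_exists_basis (x : M) : ∀ᶠ q in 𝓝 x,
    ∃ f : Module.Basis (Fin (Module.finrank ℝ E)) ℝ (TangentSpace I q),
      (∀ i, f i = coordField I x i q) ∧
      ∀ i k, inner ℝ (∑ j, invMetric I x i j q • f j) (f k) = if i = k then 1 else 0 := by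
  have h1 : ∀ᶠ q in 𝓝 x, ∀ i, (trivializationAt E (TangentSpace I : M → Type _) x).symmL ℝ q
      (Module.finBasis ℝ E i) = coordField I x i q :=
    eventually_all.2 fun i => eventually_symmL_eq_extend (I := I) x _
  filter_upwards [h1, eventually_mem_baseSet (I' := I) (φ := fun q : M => q) continuousAt_id]
    with q hq hb
  set e := trivializationAt E (TangentSpace I : M → Type _) x with he
  have hf : ∀ i, ((Module.finBasis ℝ E).map
      (e.continuousLinearEquivAt ℝ q hb).symm.toLinearEquiv) i
        = e.symmL ℝ q (Module.finBasis ℝ E i) := fun i => by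
    rw [Module.Basis.map_apply]
    exact congrArg (fun L : E → TangentSpace I q => L (Module.finBasis ℝ E i))
      (Trivialization.symm_continuousLinearEquivAt_eq (R := ℝ) e hb)
  refine ⟨(Module.finBasis ℝ E).map (e.continuousLinearEquivAt ℝ q hb).symm.toLinearEquiv,
    fun i => (hf i).trans (hq i), fun i k => ?_⟩
  set l := LinearMap.toContinuousLinearMap ((Module.finBasis ℝ E).coord i)
  have h2 : ∑ j, invMetric I x i j q • ((Module.finBasis ℝ E).map
      (e.continuousLinearEquivAt ℝ q hb).symm.toLinearEquiv) j
        = e.symmL ℝ q ((metricInChart I x q).inverse l) := by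
    simp only [hf, ← map_smul, ← map_sum]
    exact congrArg _ ((Module.finBasis ℝ E).sum_repr _)
  rw [h2, hf, ← metricInChart_apply]
  obtain ⟨g, hg⟩ := isInvertible_metricInChart (I := I) hb
  rw [← hg, ContinuousLinearMap.inverse_equiv]
  have h3 : (g : E →L[ℝ] E →L[ℝ] ℝ) ((g.symm : (E →L[ℝ] ℝ) →L[ℝ] E) l) = l := g.apply_symm_apply l
  rw [h3]
  simp [l, Finsupp.single_apply, eq_comm]

theorem eventually_eq_sum_coordField (x : M) : ∀ᶠ q in 𝓝 x, ∀ v : TangentSpace I q,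
    v = ∑ i, ∑ j, (inner ℝ v (coordField I x i q) * invMetric I x i j q) • coordField I x j q := by
  filter_upwards [eventually_exists_basis (I := I) x] with q ⟨f, hf, h⟩ v
  conv_lhs => rw [← sum_inner_smul_dual f h v]
  simp only [Finset.smul_sum, smul_smul, hf]

theorem eventually_trace_eq (x : M) : ∀ᶠ q in 𝓝 x,
    ∀ B : TangentSpace I q →ₗ[ℝ] TangentSpace I q →ₗ[ℝ] ℝ,
    ∑ a, B (stdOrthonormalBasis ℝ (TangentSpace I q) a) (stdOrthonormalBasis ℝ (TangentSpace I q) a)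
      = ∑ i, ∑ j, invMetric I x i j q • B (coordField I x j q) (coordField I x i q) := by
  filter_upwards [eventually_exists_basis (I := I) x] with q ⟨f, hf, h⟩ B
  rw [sum_orthonormalBasis_eq_sum_dual f h]
  simp only [map_sum, map_smul, LinearMap.sum_apply, LinearMap.smul_apply, hf]

theorem contMDiffAt_coordField (n : ℕ) (x : M) (i : Fin (Module.finrank ℝ E)) :
    ContMDiffAt I I.tangent n (T% (coordField I x i)) x :=
  contMDiffAt_extend_nat n _

end Frame

/-! ### Continuity of the tension field -/

section TensionContinuity

variable {E : Type*} [NormedAddCommGroup E] [NormedSpace ℝ E] [FiniteDimensional ℝ E]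
  {H : Type*} [TopologicalSpace H] {I : ModelWithCorners ℝ E H}
  {M : Type*} [TopologicalSpace M] [ChartedSpace H M] [IsManifold I ∞ M]
  {E' : Type*} [NormedAddCommGroup E'] [NormedSpace ℝ E'] [FiniteDimensional ℝ E']
  {H' : Type*} [TopologicalSpace H'] {I' : ModelWithCorners ℝ E' H'}
  {N : Type*} [TopologicalSpace N] [ChartedSpace H' N] [IsManifold I' ∞ N]
  [RiemannianBundle (fun y : N => TangentSpace I' y)]
  [IsContMDiffRiemannianBundle I' ∞ E' (fun y : N => TangentSpace I' y)]

theorem leviCivita_sum_left {ι : Type*} (s : Finset ι) {y : N} {Y : ∀ y : N, TangentSpace I' y}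
    (hY : MDiffAt (T% Y) y) (u : ι → TangentSpace I' y) :
    leviCivita I' Y y (∑ i ∈ s, u i) = ∑ i ∈ s, leviCivita I' Y y (u i) :=
  map_sum (⟨⟨leviCivita I' Y y, leviCivita_add_left hY⟩, leviCivita_smul_left hY⟩ :
    TangentSpace I' y →ₗ[ℝ] TangentSpace I' y) u s

theorem eventually_mdifferentiableAt {Y : ∀ y : N, TangentSpace I' y} {y : N} {n : ℕ}
    (hY : ContMDiffAt I' I'.tangent (n + 1 : ℕ) (T% Y) y) : ∀ᶠ z in 𝓝 y, MDiffAt (T% Y) z := by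
  have h : ContMDiffAt I' I'.tangent ((1 : ℕ) : ℕ∞ω) (T% Y) y :=
    hY.of_le (by exact_mod_cast Nat.le_add_left 1 n)
  filter_upwards [(contMDiffAt_iff_contMDiffAt_nhds (by simp)).1 h] with z hz
  exact hz.mdifferentiableAt (by simp)

/-- For a vector field `Y` of class `C²` and vector fields `U`, `V` along `φ` of class `C¹`, the
function `⟨∇_U Y, V⟩` is continuous: near `φ x` it is a combination of Koszul expressions of
coordinate fields. -/
theorem continuousAt_inner_leviCivita {φ : M → N} {x : M} {Y : ∀ y : N, TangentSpace I' y}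
    {U V : ∀ q : M, TangentSpace I' (φ q)} (hφ : ContMDiffAt I I' 1 φ x)
    (hY : ContMDiffAt I' I'.tangent (2 : ℕ) (T% Y) (φ x))
    (hU : ContMDiffAt I I'.tangent (1 : ℕ) (fun q => (⟨φ q, U q⟩ : TangentBundle I' N)) x)
    (hV : ContMDiffAt I I'.tangent (1 : ℕ) (fun q => (⟨φ q, V q⟩ : TangentBundle I' N)) x) :
    ContinuousAt (fun q => inner ℝ (leviCivita I' Y (φ q) (U q)) (V q)) x := by
  have hcoord : ∀ i, ContMDiffAt I I'.tangent (1 : ℕ)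
      (fun q => (⟨φ q, coordField I' (φ x) i (φ q)⟩ : TangentBundle I' N)) x := fun i =>
    ContMDiffAt.comp x (contMDiffAt_coordField 1 (φ x) i) hφ
  have hi : ∀ i, ContinuousAt (fun q => inner ℝ (U q) (coordField I' (φ x) i (φ q))) x := fun i =>
    (contMDiffAt_inner hU (hcoord i)).continuousAt
  have hk : ∀ k, ContinuousAt (fun q => inner ℝ (V q) (coordField I' (φ x) k (φ q))) x := fun k =>
    (contMDiffAt_inner hV (hcoord k)).continuousAt
  have hg : ∀ i j, ContinuousAt (fun q => invMetric I' (φ x) i j (φ q)) x := fun i j =>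
    ContinuousAt.comp (f := φ) (continuousAt_invMetric (φ x) i j) hφ.continuousAt
  have hK : ∀ j l, ContinuousAt (fun q => koszulForm I' (coordField I' (φ x) j) Y
      (coordField I' (φ x) l) (φ q)) x := fun j l =>
    ContinuousAt.comp (f := φ) (continuousAt_koszulForm (contMDiffAt_coordField 2 (φ x) j) hY
      (contMDiffAt_coordField 2 (φ x) l)) hφ.continuousAt
  have hsum : ContinuousAt (fun q => ∑ k, ∑ l, ∑ i, ∑ j,
      (inner ℝ (V q) (coordField I' (φ x) k (φ q)) * invMetric I' (φ x) k l (φ q))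
        * ((inner ℝ (U q) (coordField I' (φ x) i (φ q)) * invMetric I' (φ x) i j (φ q))
          * koszulForm I' (coordField I' (φ x) j) Y (coordField I' (φ x) l) (φ q))) x :=
    tendsto_finsetSum _ fun k _ => tendsto_finsetSum _ fun l _ => tendsto_finsetSum _ fun i _ =>
      tendsto_finsetSum _ fun j _ => ((hk k).mul (hg k l)).mul (((hi i).mul (hg i j)).mul (hK j l))
  refine hsum.congr ?_
  have hd : ∀ i, ∀ᶠ y in 𝓝 (φ x), MDiffAt (T% (coordField I' (φ x) i)) y := fun i =>
    eventually_mdifferentiableAt (n := 0) (contMDiffAt_coordField 1 (φ x) i)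
  filter_upwards [hφ.continuousAt.eventually (eventually_eq_sum_coordField (I := I') (φ x)),
    hφ.continuousAt.eventually (eventually_mdifferentiableAt (n := 1) hY),
    hφ.continuousAt.eventually (eventually_all.2 hd)] with q hq hYq hdq
  conv_rhs => rw [hq (V q), hq (U q)]
  simp only [leviCivita_sum_left _ hYq, leviCivita_smul_left hYq, inner_sum, sum_inner,
    real_inner_smul_left, real_inner_smul_right, inner_leviCivita (hdq _) hYq (hdq _)]

variable [RiemannianBundle (fun x : M => TangentSpace I x)]
  [IsContMDiffRiemannianBundle I ∞ E (fun x : M => TangentSpace I x)]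

theorem contMDiffAt_tangentMap {φ : M → N} (hφ : ContMDiff I I' ∞ φ) {x : M} {n : ℕ}
    {Y : ∀ q : M, TangentSpace I q} (hY : ContMDiffAt I I.tangent n (T% Y) x) :
    ContMDiffAt I I'.tangent n
      (fun q => (⟨φ q, tangentMap I I' φ q (Y q)⟩ : TangentBundle I' N)) x :=
  ContMDiffAt.comp x (hφ.contMDiff_tangentMap (m := n) (by exact_mod_cast le_top)).contMDiffAt hY

/-- The second fundamental form is continuous, in the weak sense that its inner product with a field
of `N` is, on vector fields of class `C²`: the compatibility of the pull-back connection with the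
metric moves the derivatives of `φ` to the field of `N`. -/
theorem continuousAt_inner_secondFundamentalForm {φ : M → N} (hφ : ContMDiff I I' ∞ φ) {x : M}
    {X Y : ∀ q : M, TangentSpace I q} {Z : ∀ y : N, TangentSpace I' y}
    (hX : ContMDiffAt I I.tangent (2 : ℕ) (T% X) x) (hY : ContMDiffAt I I.tangent (2 : ℕ) (T% Y) x)
    (hZ : ContMDiffAt I' I'.tangent (2 : ℕ) (T% Z) (φ x)) :
    ContinuousAt (fun q => inner ℝ (secondFundamentalForm I I' φ q (X q) (Y q)) (Z (φ q))) x := by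
  have one : ((1 : ℕ) : ℕ∞ω) ≤ ((2 : ℕ) : ℕ∞ω) := by norm_cast
  have hφ1 : ContMDiffAt I I' 1 φ x := (hφ x).of_le (by exact_mod_cast le_top)
  have hAX := contMDiffAt_tangentMap hφ (hX.of_le one)
  have hAY := contMDiffAt_tangentMap hφ (hY.of_le one)
  have hZφ : ContMDiffAt I I'.tangent (1 : ℕ) (fun q => (⟨φ q, Z (φ q)⟩ : TangentBundle I' N)) x :=
    ContMDiffAt.comp x (hZ.of_le one) hφ1
  have h1 : ContinuousAt (fun q => mvfderiv I (fun q => inner ℝ (tangentMap I I' φ q (Y q))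
      (Z (φ q))) q (X q)) x :=
    continuousAt_mvfderiv_apply (contMDiffAt_inner hAY hZφ) hX.continuousAt
  have h2 : ContinuousAt (fun q => inner ℝ (leviCivita I' Z (φ q) (tangentMap I I' φ q (X q)))
      (tangentMap I I' φ q (Y q))) x := continuousAt_inner_leviCivita hφ1 hZ hAX hAY
  have hc := fun i => contMDiffAt_coordField (I := I) 1 x i
  have h3 : ContinuousAt (fun q => ∑ i, ∑ j, (inner ℝ (leviCivita I Y q (X q)) (coordField I x i q)
      * invMetric I x i j q) * inner ℝ (tangentMap I I' φ q (coordField I x j q)) (Z (φ q))) x :=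
    tendsto_finsetSum _ fun i _ => tendsto_finsetSum _ fun j _ =>
      ((continuousAt_inner_leviCivita (φ := fun q : M => q) contMDiffAt_id hY (hX.of_le one)
        (hc i)).mul (continuousAt_invMetric x i j)).mul
        (contMDiffAt_inner (contMDiffAt_tangentMap hφ (hc j)) hZφ).continuousAt
  refine ((h1.sub h2).sub h3).congr ?_
  filter_upwards [eventually_eq_sum_coordField (I := I) x, eventually_mdifferentiableAt (n := 1) hY,
    hφ1.continuousAt.eventually (eventually_mdifferentiableAt (n := 1) hZ)] with q hq hYq hZq
  have hφq : MDiffAt φ q := hφ.mdifferentiableAt (by simp)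
  have h4 : inner ℝ (tangentMap I I' φ q (leviCivita I Y q (X q))) (Z (φ q))
      = ∑ i, ∑ j, (inner ℝ (leviCivita I Y q (X q)) (coordField I x i q)
      * invMetric I x i j q) * inner ℝ (tangentMap I I' φ q (coordField I x j q)) (Z (φ q)) := by
    conv_lhs => rw [hq (leviCivita I Y q (X q))]
    simp only [map_sum, map_smul, sum_inner, real_inner_smul_left]
  simp only [Pi.sub_apply]
  rw [← h4, mvfderiv_inner_along (MDiffAlong.tangentMap hφ hYq) (mdiffAlong_comp hZq hφq),
    pullbackConnection_comp hφq hZq, pullbackConnection_tangentMap hφ hYq, inner_add_left,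
    real_inner_comm _ (leviCivita I' Z (φ q) _)]
  ring

/-- The inner product of the tension field with a smooth vector field of `N` is continuous. -/
theorem continuousAt_inner_tensionField {φ : M → N} (hφ : ContMDiff I I' ∞ φ) (x : M)
    {Z : ∀ y : N, TangentSpace I' y} (hZ : ContMDiffAt I' I'.tangent (2 : ℕ) (T% Z) (φ x)) :
    ContinuousAt (fun q => inner ℝ (tensionField I I' φ q) (Z (φ q))) x := by
  have h : ContinuousAt (fun q => ∑ i, ∑ j, invMetric I x i j q
      * inner ℝ (secondFundamentalForm I I' φ q (coordField I x j q) (coordField I x i q))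
        (Z (φ q))) x :=
    tendsto_finsetSum _ fun i _ => tendsto_finsetSum _ fun j _ => (continuousAt_invMetric x i j).mul
      (continuousAt_inner_secondFundamentalForm hφ (contMDiffAt_coordField 2 x j)
        (contMDiffAt_coordField 2 x i) hZ)
  refine h.congr ?_
  filter_upwards [eventually_trace_eq (I := I) x] with q hq
  have h1 := hq ((hessian hφ q).compr₂ (innerₗ _ (Z (φ q))))
  simp only [LinearMap.compr₂_apply, innerₗ_apply_apply, hessian_apply] at h1
  rw [tensionField, sum_inner]
  simp only [real_inner_comm (Z (φ q))]
  exact h1.symm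

/-- A tension field that vanishes on a dense set vanishes. -/
theorem isHarmonic_of_dense {φ : M → N} (hφ : ContMDiff I I' ∞ φ) {D : Set M} (hD : Dense D)
    (h : ∀ x ∈ D, tensionField I I' φ x = 0) : IsHarmonic I I' φ := by
  intro x
  have hc := continuousAt_inner_tensionField hφ x (contMDiffAt_extend_nat 2 (tensionField I I' φ x))
  have h0 := tendsto_nhds_unique_of_frequently_eq hc tendsto_const_nhds
    ((mem_closure_iff_frequently.1 (hD x)).mono fun q hq => by rw [h q hq, inner_zero_left])
  simp only [extend_apply_self] at h0
  exact inner_self_eq_zero.1 h0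

end TensionContinuity

/-! ### Existence of adapted frames, and the equivalence with harmonicity -/

section EigenFrames

variable {V : Type*} [NormedAddCommGroup V] [InnerProductSpace ℝ V] [FiniteDimensional ℝ V]

/-- A symmetric operator `S` that commutes with an orthogonal complex structure `F` on a subspace
`U` of dimension `2n` has a unitary frame `v_1, Fv_1, …, v_n, Fv_n` of eigenvectors on `U`. -/
theorem exists_unitary_eigenframe {S F : V →ₗ[ℝ] V} (hS : S.IsSymmetric)
    (hF : ∀ v w, inner ℝ (F v) w = -inner ℝ v (F w)) (hSF : ∀ v, S (F v) = F (S v)) (n : ℕ) :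
    ∀ U : Submodule ℝ V, (∀ v ∈ U, S v ∈ U) → (∀ v ∈ U, F v ∈ U) → (∀ v ∈ U, F (F v) = -v) →
      Module.finrank ℝ U = 2 * n → ∃ (v : Fin n → V) (μ : Fin n → ℝ), (∀ i, v i ∈ U) ∧
        Orthonormal ℝ v ∧ (∀ i k, inner ℝ (v i) (F (v k)) = 0) ∧ ∀ i, S (v i) = μ i • v i := by
  have hFself : ∀ v, inner ℝ v (F v) = 0 := fun v => by
    have h := hF v v
    rw [real_inner_comm] at h
    linarith
  induction n with
  | zero =>
    intro U _ _ _ _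
    exact ⟨Fin.elim0, Fin.elim0, fun i => i.elim0, ⟨fun i => i.elim0, fun i => i.elim0⟩,
      fun i => i.elim0, fun i => i.elim0⟩
  | succ n ih =>
    intro U hSU hFU hFF hU
    -- a unit eigenvector `e` of `S` in `U`; then `F e` is a unit eigenvector orthogonal to `e`
    obtain ⟨e, c, heU, he1, hec⟩ : ∃ (e : V) (c : ℝ), e ∈ U ∧ ‖e‖ = 1 ∧ S e = c • e := by
      have hT : (S.restrict hSU).IsSymmetric := hS.restrict_invariant hSU
      have hi : 0 < 2 * (n + 1) := by omega
      refine ⟨hT.eigenvectorBasis hU ⟨0, hi⟩, hT.eigenvalues hU ⟨0, hi⟩, Subtype.mem _,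
        (hT.eigenvectorBasis hU).orthonormal.1 _, ?_⟩
      exact congrArg Subtype.val (hT.apply_eigenvectorBasis hU ⟨0, hi⟩)
    have hFe : ‖F e‖ = 1 := by
      have h : inner ℝ (F e) (F e) = (1 : ℝ) := by
        rw [hF, hFF e heU, inner_neg_right, neg_neg, real_inner_self_eq_norm_sq, he1, one_pow]
      rw [real_inner_self_eq_norm_sq] at h
      exact (pow_eq_one_iff_of_nonneg (norm_nonneg _) two_ne_zero).1 h
    have ho : Orthonormal ℝ ![e, F e] :=
      orthonormal_vecCons_iff.2 ⟨he1, fun i => by fin_cases i; exact hFself e,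
        orthonormal_vecCons_iff.2 ⟨hFe, fun i => i.elim0, ⟨fun i => i.elim0, fun i => i.elim0⟩⟩⟩
    set K : Submodule ℝ V := Submodule.span ℝ (Set.range ![e, F e]) with hK
    have hKU : K ≤ U := by
      rw [hK, Submodule.span_le]
      rintro _ ⟨i, rfl⟩
      fin_cases i
      · exact heU
      · exact hFU e heU
    have hmem : ∀ v, v ∈ Kᗮ ↔ inner ℝ e v = 0 ∧ inner ℝ (F e) v = 0 := by
      intro v
      rw [hK, Submodule.mem_orthogonal]
      constructor
      · intro h
        exact ⟨h _ (Submodule.subset_span ⟨0, rfl⟩), h _ (Submodule.subset_span ⟨1, rfl⟩)⟩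
      · rintro ⟨h0, h1⟩ u hu
        induction hu using Submodule.span_induction with
        | mem u hu =>
          obtain ⟨i, rfl⟩ := hu
          fin_cases i
          · exact h0
          · exact h1
        | zero => exact inner_zero_left _
        | add a b _ _ ha hb => rw [inner_add_left, ha, hb, add_zero]
        | smul a b _ hb => rw [real_inner_smul_left, hb, mul_zero]
    have hKd : Module.finrank ℝ (Kᗮ ⊓ U : Submodule ℝ V) = 2 * n := by
      refine Submodule.finrank_add_inf_finrank_orthogonal' hKU ?_
      rw [hK, finrank_span_eq_card ho.linearIndependent, hU, Fintype.card_fin]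
      ring
    obtain ⟨v, μ, hvU, hv, hvF, hvS⟩ := ih (Kᗮ ⊓ U) (fun v hv => by
        obtain ⟨h1, h2⟩ := (hmem v).1 hv.1
        refine ⟨(hmem _).2 ⟨?_, ?_⟩, hSU v hv.2⟩
        · rw [← hS, hec, real_inner_smul_left, h1, mul_zero]
        · rw [← hS, hSF, hec, map_smul, real_inner_smul_left, h2, mul_zero])
      (fun v hv => by
        obtain ⟨h1, h2⟩ := (hmem v).1 hv.1
        refine ⟨(hmem _).2 ⟨?_, ?_⟩, hFU v hv.2⟩
        · rw [← neg_eq_zero, ← hF, h2]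
        · rw [← neg_eq_zero, ← hF, hFF e heU, inner_neg_left, h1, neg_zero])
      (fun v hv => hFF v hv.2) hKd
    have hvK := fun i => (hmem _).1 (hvU i).1
    refine ⟨Matrix.vecCons e v, Matrix.vecCons c μ, fun i => ?_,
      orthonormal_vecCons_iff.2 ⟨he1, fun i => (hvK i).1, hv⟩, fun i k => ?_, fun i => ?_⟩
    · exact Fin.cases heU (fun i => (hvU i).2) i
    · refine Fin.cases ?_ (fun i => ?_) i <;> refine Fin.cases ?_ (fun k => ?_) k
      · exact hFself e
      · change inner ℝ e (F (v k)) = 0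
        rw [← neg_eq_zero, ← hF, (hvK k).2]
      · change inner ℝ (v i) (F e) = 0
        rw [real_inner_comm, (hvK i).2]
      · exact hvF i k
    · exact Fin.cases hec hvS i

end EigenFrames

section AdaptedFrameExistence

variable {E : Type*} [NormedAddCommGroup E] [NormedSpace ℝ E] [FiniteDimensional ℝ E]
  {H : Type*} [TopologicalSpace H] {I : ModelWithCorners ℝ E H}
  {M : Type*} [TopologicalSpace M] [ChartedSpace H M] [IsManifold I ∞ M]
  {E' : Type*} [NormedAddCommGroup E'] [NormedSpace ℝ E'] [FiniteDimensional ℝ E']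
  {H' : Type*} [TopologicalSpace H'] {I' : ModelWithCorners ℝ E' H'}
  {N : Type*} [TopologicalSpace N] [ChartedSpace H' N] [IsManifold I' ∞ N]
  [RiemannianBundle (fun x : M => TangentSpace I x)]
  [RiemannianBundle (fun y : N => TangentSpace I' y)]

/-- There is an adapted frame at every regular point: `dφᵗ ∘ dφ` is symmetric and commutes
with `F`. -/
theorem nonempty_adaptedFrame {n : ℕ} {𝒥 : AlmostHermitian I' N} {φ : M → N} (hJ : IsPHWC I 𝒥 φ)
    (hd : Module.finrank ℝ E' = 2 * n) {x : M} (hx : x ∈ regularSet I I' φ) :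
    Nonempty (AdaptedFrame I n 𝒥 φ x) := by
  obtain ⟨S, hSdef⟩ : ∃ S : TangentSpace I x →ₗ[ℝ] TangentSpace I x,
      S = tangentAdjoint I I' φ x ∘ₗ tangentMap I I' φ x := ⟨_, rfl⟩
  have hSi : ∀ v w, inner ℝ (S v) w = inner ℝ (tangentMap I I' φ x v) (tangentMap I I' φ x w) :=
    fun v w => by rw [hSdef, LinearMap.comp_apply, inner_tangentAdjoint]
  have hS : S.IsSymmetric := fun v w => by
    rw [hSi, real_inner_comm _ v, hSi, real_inner_comm]
  have hSF : ∀ v, S (fStructure I 𝒥 φ x v) = fStructure I 𝒥 φ x (S v) := fun v => by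
    rw [hSdef, LinearMap.comp_apply, LinearMap.comp_apply, tangentMap_fStructure I 𝒥 hx,
      fStructure_tangentAdjoint hJ hx]
  obtain ⟨v, μ, hv, ho, hF, hμ⟩ := exists_unitary_eigenframe hS (inner_fStructure_left hJ hx) hSF n
    (horizontal I I' φ x) (fun v _ => by rw [hSdef]; exact tangentAdjoint_mem_horizontal _)
    (fun v _ => fStructure_mem_horizontal 𝒥 v) (fun v hv => fStructure_fStructure 𝒥 hx hv)
    ((finrank_horizontal hx).trans hd)
  have hFo : Orthonormal ℝ fun i => fStructure I 𝒥 φ x (v i) := by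
    have h : ∀ i k, inner ℝ (fStructure I 𝒥 φ x (v i)) (fStructure I 𝒥 φ x (v k))
        = inner ℝ (v i) (v k) := fun i k => by
      rw [inner_fStructure_left hJ hx, fStructure_fStructure 𝒥 hx (hv k), inner_neg_right, neg_neg]
    rw [orthonormal_iff_ite] at ho ⊢
    exact fun i k => (h i k).trans (ho i k)
  have hμ0 : ∀ i, √(μ i) ^ 2 = μ i := fun i => by
    refine Real.sq_sqrt ?_
    have h := hSi (v i) (v i)
    rw [hμ, real_inner_smul_left, real_inner_self_eq_norm_sq, ho.1 i, one_pow, mul_one] at h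
    rw [h]
    exact real_inner_self_nonneg
  refine ⟨⟨v, fun i => √(μ i), hv, orthonormal_sumElim ho hFo hF, fun i w => ?_, fun i w => ?_⟩⟩
  · rw [hμ0, ← hSi, hμ, real_inner_smul_left]
  · rw [hμ0, ← hSi, hSF, hμ, map_smul, real_inner_smul_left]

end AdaptedFrameExistence

section Equivalence

variable {E : Type*} [NormedAddCommGroup E] [NormedSpace ℝ E] [FiniteDimensional ℝ E]
  {H : Type*} [TopologicalSpace H] {I : ModelWithCorners ℝ E H}
  {M : Type*} [TopologicalSpace M] [ChartedSpace H M] [IsManifold I ∞ M]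
  {E' : Type*} [NormedAddCommGroup E'] [NormedSpace ℝ E'] [FiniteDimensional ℝ E']
  {H' : Type*} [TopologicalSpace H'] {I' : ModelWithCorners ℝ E' H'}
  {N : Type*} [TopologicalSpace N] [ChartedSpace H' N] [IsManifold I' ∞ N]
  [RiemannianBundle (fun x : M => TangentSpace I x)]
  [IsContMDiffRiemannianBundle I ∞ E (fun x : M => TangentSpace I x)]
  [RiemannianBundle (fun y : N => TangentSpace I' y)]
  [IsContMDiffRiemannianBundle I' ∞ E' (fun y : N => TangentSpace I' y)]

/-- An expression in a frame vector that is everywhere the inner product of its image under `dφ`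
with the tension field vanishes on a dense set of regular points exactly for harmonic maps. -/
theorem isHarmonic_iff_of_eq_inner {n : ℕ} {𝒥 : AlmostHermitian I' N} {φ : M → N}
    (hφ : ContMDiff I I' ∞ φ) (hd : Module.finrank ℝ E' = 2 * n) {D : Set M}
    (hD : D ⊆ regularSet I I' φ) (hdense : Dense D) (b : ∀ x ∈ D, AdaptedFrame I n 𝒥 φ x)
    (eq : ∀ x ∈ D, ℝ → TangentSpace I x → ℝ)
    (h : ∀ (x : M) (hx : x ∈ D) (lam : ℝ) (w : TangentSpace I x), w ∈ horizontal I I' φ x →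
      (∀ v, inner ℝ (tangentMap I I' φ x w) (tangentMap I I' φ x v) = lam ^ 2 * inner ℝ w v) →
      eq x hx lam w = inner ℝ (tangentMap I I' φ x w) (tensionField I I' φ x)) :
    IsHarmonic I I' φ ↔ ∀ (x : M) (hx : x ∈ D) (k : Fin n),
      eq x hx ((b x hx).lam k) ((b x hx).vec k) = 0 ∧
      eq x hx ((b x hx).lam k) (fStructure I 𝒥 φ x ((b x hx).vec k)) = 0 := by
  have h1 : ∀ (x : M) (hx : x ∈ D) (k : Fin n), eq x hx ((b x hx).lam k) ((b x hx).vec k)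
      = inner ℝ (tangentMap I I' φ x ((b x hx).vec k)) (tensionField I I' φ x) := fun x hx k =>
    h x hx _ _ ((b x hx).vec_mem k) ((b x hx).eigen k)
  have h2 : ∀ (x : M) (hx : x ∈ D) (k : Fin n),
      eq x hx ((b x hx).lam k) (fStructure I 𝒥 φ x ((b x hx).vec k))
      = inner ℝ (tangentMap I I' φ x (fStructure I 𝒥 φ x ((b x hx).vec k)))
        (tensionField I I' φ x) := fun x hx k =>
    h x hx _ _ (fStructure_mem_horizontal 𝒥 _) ((b x hx).eigen_F k)
  refine ⟨fun hh x hx k => ?_, fun hh => isHarmonic_of_dense hφ hdense fun x hx => ?_⟩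
  · rw [h1, h2, hh x, inner_zero_right, inner_zero_right]
    exact ⟨rfl, rfl⟩
  · refine (b x hx).eq_zero_of_inner_all hd (hD hx) ?_
    rintro (k | k)
    · exact (h1 x hx k).symm.trans (hh x hx k).1
    · exact (h2 x hx k).symm.trans (hh x hx k).2

end Equivalence
end PHWC

end

theorem mainTheorem6 (m n : ℕ)
    {M : Type*} [TopologicalSpace M] [ChartedSpace (EuclideanSpace ℝ (Fin m)) M]
    [IsManifold (𝓡 m) ∞ M]
    [RiemannianBundle (fun x : M => TangentSpace (𝓡 m) x)]
    [IsContMDiffRiemannianBundle (𝓡 m) ∞ (EuclideanSpace ℝ (Fin m))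
      (fun x : M => TangentSpace (𝓡 m) x)]
    {N : Type*} [TopologicalSpace N] [ChartedSpace (EuclideanSpace ℝ (Fin (2 * n))) N]
    [IsManifold (𝓡 (2 * n)) ∞ N]
    [RiemannianBundle (fun y : N => TangentSpace (𝓡 (2 * n)) y)]
    [IsContMDiffRiemannianBundle (𝓡 (2 * n)) ∞ (EuclideanSpace ℝ (Fin (2 * n)))
      (fun y : N => TangentSpace (𝓡 (2 * n)) y)]
    (𝒥 : PHWC.AlmostHermitian (𝓡 (2 * n)) N) (φ : M → N)
    (hsub : PHWC.IsAlmostSubmersion (𝓡 m) (𝓡 (2 * n)) φ)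
    (hphwc : PHWC.IsPHWC (𝓡 m) 𝒥 φ) :
    (∀ x ∈ PHWC.regularSet (𝓡 m) (𝓡 (2 * n)) φ,
        Nonempty (PHWC.AdaptedFrame (𝓡 m) n 𝒥 φ x)) ∧
    ∀ D : Set M, D ⊆ PHWC.regularSet (𝓡 m) (𝓡 (2 * n)) φ → Dense D →
      ∀ b : ∀ x ∈ D, PHWC.AdaptedFrame (𝓡 m) n 𝒥 φ x,
        (PHWC.IsHarmonic (𝓡 m) (𝓡 (2 * n)) φ ↔
          ∀ (x : M) (hx : x ∈ D) (k : Fin n),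
            PHWC.equationDivF (𝓡 m) m 𝒥 φ (b x hx) ((b x hx).lam k) ((b x hx).vec k) = 0 ∧
            PHWC.equationDivF (𝓡 m) m 𝒥 φ (b x hx) ((b x hx).lam k)
              (PHWC.fStructure (𝓡 m) 𝒥 φ x ((b x hx).vec k)) = 0) ∧
        (PHWC.IsHarmonic (𝓡 m) (𝓡 (2 * n)) φ ↔
          ∀ (x : M) (hx : x ∈ D) (k : Fin n),
            PHWC.equationDPhi (𝓡 m) m 𝒥 φ (b x hx) ((b x hx).lam k) ((b x hx).vec k) = 0 ∧
            PHWC.equationDPhi (𝓡 m) m 𝒥 φ (b x hx) ((b x hx).lam k)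
              (PHWC.fStructure (𝓡 m) 𝒥 φ x ((b x hx).vec k)) = 0) := by
  have hd : Module.finrank ℝ (EuclideanSpace ℝ (Fin (2 * n))) = 2 * n := finrank_euclideanSpace_fin
  have hm : Module.finrank ℝ (EuclideanSpace ℝ (Fin m)) = m := finrank_euclideanSpace_fin
  refine ⟨fun x hx => PHWC.nonempty_adaptedFrame hphwc hd hx, fun D hD hdense b => ⟨?_, ?_⟩⟩
  · exact PHWC.isHarmonic_iff_of_eq_inner hsub.1 hd hD hdense b
      (fun x hx lam w => PHWC.equationDivF (𝓡 m) m 𝒥 φ (b x hx) lam w)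
      fun x hx lam w _ hlam =>
        PHWC.equationDivF_eq_inner_tensionField hsub.1 (hD hx) (b x hx) hd hphwc hm hlam
  · exact PHWC.isHarmonic_iff_of_eq_inner hsub.1 hd hD hdense b
      (fun x hx lam w => PHWC.equationDPhi (𝓡 m) m 𝒥 φ (b x hx) lam w)
      fun x hx lam w hw hlam =>
        PHWC.equationDPhi_eq_inner_tensionField hsub.1 (hD hx) (b x hx) hd hphwc hm hlam hw
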